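/- For a finite simple undirected graph $G=(V,E)$ with $n$ vertices and an ordering (bijection) $\pi\colon V\to\{1,\dots,n\}$ put $\mathrm{cut}_\pi^i=\{\{u,v\}\in E : \pi(u)\le i<\pi(v)\}$. Undirected Optimal Linear Arrangement asks for an ordering $\pi$ of $V$ minimizing $\mathrm{cost}(\pi)=\sum_{i=1}^{n-1}|\mathrm{cut}_\pi^i|$; a $\rho$-approximation always outputs an ordering whose cost is at most $\rho$ times the minimum. Let $\omega$ be the matrix multiplication exponent (over $\mathbb{Q}$), that is, the infimum of all real $\tau$ such that the rank of the $N\times N$ matrix multiplication tensor is $O(N^\tau)$. **Proposition.** For every constant $0<\alpha<1$ there is a $\left(1+\frac{1}{2(1-\alpha)}\right)$-approximation for undirected Optimal Linear Arrangement that runs in $O^*\!\left(2^{\omega n/3}+2^{(1-\alpha/2)n}\right)$ time, where $O^*$ hides polynomial factors in the input size and, since $\omega$ is an infimum, the term $2^{\omega n/3}$ is understood in the usual way: for every $\varepsilon>0$ there is such an algorithm (a deterministic random access machine with logarithmic cost) running in $O^*\!\left(2^{(\omega+\varepsilon)n/3}+2^{(1-\alpha/2)n}\right)$ time. -/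

import Mathlib

/-! ### A random access machine with logarithmic cost

Programs are finite and structured.  They use registers, which are named directly, and an unbounded
memory, which is addressed indirectly through registers.  All cells hold integers. -/

namespace RAM

/-- A machine state: the contents of the registers and of the memory. -/
structure State where
  reg : ℕ → ℤ
  mem : ℕ → ℤ

/-- The arithmetic operations of the machine (`div` is integer division). -/
inductive Op
  | add
  | sub
  | mul
  | div

/-- The value of an arithmetic operation. -/
def Op.eval : Op → ℤ → ℤ → ℤ
  | .add, x, y => x + y
  | .sub, x, y => x - y
  | .mul, x, y => x * y
  | .div, x, y => x / y

/-- Programs.  Natural numbers are register names; `whilePos r p` repeats `p` as long as register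
`r` is positive. -/
inductive Program
  | skip
  | const (r : ℕ) (c : ℤ)
  | arith (o : Op) (r a b : ℕ)
  | load (r a : ℕ)
  | store (a b : ℕ)
  | seq (p q : Program)
  | ifPos (r : ℕ) (p q : Program)
  | whilePos (r : ℕ) (p : Program)

/-- The bit length `⌊log₂ |z|⌋ + 1` of an integer (equal to `1` for `z = 0`). -/
def bitLen (z : ℤ) : ℕ := Nat.log 2 z.natAbs + 1

/-- Write `z` into register `r`. -/
def State.setReg (s : State) (r : ℕ) (z : ℤ) : State :=
  { s with reg := Function.update s.reg r z }

/-- Write `z` into memory cell `a`. -/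
def State.setMem (s : State) (a : ℕ) (z : ℤ) : State :=
  { s with mem := Function.update s.mem a z }

/-- `Exec p s t s'`: the program `p`, started in state `s`, halts in state `s'` after time `t`.
Every instruction and every test costs the total bit length of the integers (operands, addresses,
transferred contents) that it handles.  A negative address is read as `0`. -/
inductive Exec : Program → State → ℕ → State → Prop
  | skip (s : State) : Exec .skip s 1 s
  | const (s : State) (r : ℕ) (c : ℤ) :
      Exec (.const r c) s (bitLen c) (s.setReg r c)
  | arith (s : State) (o : Op) (r a b : ℕ) :
      Exec (.arith o r a b) s (bitLen (s.reg a) + bitLen (s.reg b))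
        (s.setReg r (o.eval (s.reg a) (s.reg b)))
  | load (s : State) (r a : ℕ) :
      Exec (.load r a) s (bitLen (s.reg a) + bitLen (s.mem (s.reg a).toNat))
        (s.setReg r (s.mem (s.reg a).toNat))
  | store (s : State) (a b : ℕ) :
      Exec (.store a b) s (bitLen (s.reg a) + bitLen (s.reg b))
        (s.setMem (s.reg a).toNat (s.reg b))
  | seq {p q : Program} {s s' s'' : State} {t t' : ℕ} :
      Exec p s t s' → Exec q s' t' s'' → Exec (.seq p q) s (t + t') s''
  | ifPos {r : ℕ} {p q : Program} {s s' : State} {t : ℕ} :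
      0 < s.reg r → Exec p s t s' → Exec (.ifPos r p q) s (bitLen (s.reg r) + t) s'
  | ifNonpos {r : ℕ} {p q : Program} {s s' : State} {t : ℕ} :
      s.reg r ≤ 0 → Exec q s t s' → Exec (.ifPos r p q) s (bitLen (s.reg r) + t) s'
  | whileStep {r : ℕ} {p : Program} {s s' s'' : State} {t t' : ℕ} :
      0 < s.reg r → Exec p s t s' → Exec (.whilePos r p) s' t' s'' →
        Exec (.whilePos r p) s (bitLen (s.reg r) + t + t') s''
  | whileDone {r : ℕ} {p : Program} {s : State} :
      s.reg r ≤ 0 → Exec (.whilePos r p) s (bitLen (s.reg r)) s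

end RAM

/-! ### The exponent of matrix multiplication -/

namespace MatMul

/-- `N × N` matrices over `ℚ` can be multiplied by a bilinear algorithm with `r` essential
multiplications, that is, the tensor `⟨N, N, N⟩` has rank at most `r` over `ℚ`. -/
def RankLE (N r : ℕ) : Prop :=
  ∃ (f g : Fin r → (Matrix (Fin N) (Fin N) ℚ →ₗ[ℚ] ℚ)) (W : Fin r → Matrix (Fin N) (Fin N) ℚ),
    ∀ A B : Matrix (Fin N) (Fin N) ℚ, A * B = ∑ l, (f l A * g l B) • W l

/-- The matrix multiplication exponent `ω`: the infimum of all real `τ` such that the rank of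
`⟨N, N, N⟩` is `O(N ^ τ)`. -/
noncomputable def omega : ℝ :=
  sInf {τ : ℝ | ∃ C : ℝ, ∀ N : ℕ, 1 ≤ N → ∃ r : ℕ, RankLE N r ∧ (r : ℝ) ≤ C * (N : ℝ) ^ τ}

end MatMul

/-! ### Undirected Optimal Linear Arrangement -/

namespace OLA

/-- An ordering `π` sends a vertex `v` to its position `π v + 1 ∈ {1, …, n}`.  `cut G π i` is the
set of edges between a vertex at position at most `i` and a vertex at position after `i`. -/
def cut {n : ℕ} (G : SimpleGraph (Fin n)) (π : Equiv.Perm (Fin n)) (i : ℕ) :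
    Set (Sym2 (Fin n)) :=
  {e | ∃ u v : Fin n, G.Adj u v ∧ e = s(u, v) ∧ (π u : ℕ) + 1 ≤ i ∧ i < (π v : ℕ) + 1}

/-- The objective value of an ordering: the sum of the sizes of the cuts `1, …, n - 1`. -/
noncomputable def cost {n : ℕ} (G : SimpleGraph (Fin n)) (π : Equiv.Perm (Fin n)) : ℕ :=
  ∑ i ∈ Finset.Ico 1 n, (cut G π i).ncard

/-- The optimum, that is, the least objective value of an ordering. -/
noncomputable def opt {n : ℕ} (G : SimpleGraph (Fin n)) : ℕ :=
  ⨅ π : Equiv.Perm (Fin n), cost G π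

open Classical in
/-- The initial state for the input `G`: memory cell `0` holds `n`, the cells `1, …, n ^ 2` hold
the adjacency matrix row by row, and every other cell and register is `0`. -/
noncomputable def input {n : ℕ} (G : SimpleGraph (Fin n)) : RAM.State where
  reg := fun _ => 0
  mem := fun a =>
    if a = 0 then (n : ℤ)
    else if ∃ u v : Fin n, G.Adj u v ∧ a = 1 + (u : ℕ) * n + (v : ℕ) then 1 else 0

/-- The state `s` holds the ordering `π` as its output: memory cell `v` holds the position
of vertex `v`, counted from `0`. -/
def Outputs {n : ℕ} (s : RAM.State) (π : Equiv.Perm (Fin n)) : Prop :=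
  ∀ v : Fin n, s.mem (v : ℕ) = ((π v : ℕ) : ℤ)

/-- The program `p` is a `ρ`-approximation algorithm for undirected Optimal Linear Arrangement that
runs within time `T n` on graphs with `n` vertices. -/
def IsApproxAlgorithm (p : RAM.Program) (ρ : ℝ) (T : ℕ → ℝ) : Prop :=
  ∀ (n : ℕ) (G : SimpleGraph (Fin n)), ∃ (t : ℕ) (s : RAM.State) (π : Equiv.Perm (Fin n)),
    RAM.Exec p (input G) t s ∧ (t : ℝ) ≤ T n ∧ Outputs s π ∧ (cost G π : ℝ) ≤ ρ * (opt G : ℝ)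

/-- A `ρ`-approximation for undirected Optimal Linear Arrangement in time `O*(T n)`: the running
time is at most `T n` times a polynomial in `n` (the input size is polynomial in `n`). -/
def HasApproxInTimeOStar (ρ : ℝ) (T : ℕ → ℝ) : Prop :=
  ∃ (p : RAM.Program) (C : ℝ) (k : ℕ),
    IsApproxAlgorithm p ρ (fun n => C * ((n : ℝ) + 1) ^ k * T n)

end OLA

/-! ### Counting loops of the machine -/

namespace RAM

/-! Call a vertex set medium if it and its complement both have at least `a` elements, where `a` is
`γ n` rounded down for a fixed rational `γ`. The algorithm finds a medium set `S` whose cut is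
smallest, of size `c` say, and then a cheapest ordering among those that begin with `S`.

Approximation. Arrange `S` and then its complement, both in the order of an optimal ordering `τ`; or
do so with both parts reversed. Edges inside a part do not get longer, and the two lengths of an
edge between the parts add up to `n`. Hence the better of the two orderings costs at most `opt + n c
/ 2` (`cost_add_cost_le`). Conversely, every medium prefix of an ordering contributes at least `c`.
Moreover a prefix and a suffix of `i` vertices each, with `a / 2 ≤ i < a`, together form a medium
set, since `3 a ≤ n`; by subadditivity their two cuts together contribute at least `c`. So `opt ≥ c
(n + 1 + ⌊a / 2⌋ - 2 a)` (`le_cost_of_forall_cutN`), which is at least `(1 - α) n c` when `3 a ≤ 2 α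
n`. Both estimates meet in `cost_le_of_min_cut`.

Extension. A dynamic program over the subsets of `S`, followed by one over the subsets of the
complement, needs `2 ^ |S| + 2 ^ (n - |S|)` cells, at most `2 * 2 ^ (n - a)`. Its values are numbers
`cost * (n + 1) ^ n + ∑ position(v) * (n + 1) ^ v`: the cost dominates, and the ordering is read off
the digits of the optimum (`exists_optimal_extension`).

Smallest cut. Split the vertices into three blocks of `q` vertices, `3 q ≥ n`. The cut is a
quadratic polynomial in the indicator of the set, so it is a sum of three terms that each depend on
two blocks only (`cutZ_parts`). With entries that are powers of `2 * 2 ^ q`, larger exponents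
standing for smaller cuts, a product of two matrices of size `2 ^ q` sums over all middle blocks.
There are fewer middle blocks than the base, so the largest weighted entry reveals the outer blocks
of a smallest cut; admissibility is controlled by fixing the size of the middle block
(`exists_middle`). The middle block is then found by trying all of them.

Multiplication. For some `m` the tensor of `2 ^ m × 2 ^ m` matrices has rank `r ≤ 2 ^ ((ω + ε) m)`
(`exists_rankLE`). After clearing denominators one fixed integral decomposition is used; its `k`-th
tensor power multiplies matrices of size `2 ^ (m k)`, and the linear maps involved are applied digit
by digit with `O(k r ^ k)` operations (`layers_eq`, `IsDecomp.matMul`). With `m k` about `n / 3`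
this is `2 ^ ((ω + ε) n / 3)` up to constants and polynomial factors.

Parameters. The guarantee allows `γ ≤ 2 α / 3` and needs `γ ≤ 1 / 3`; the time `2 ^ ((1 - α / 2) n)`
needs `γ ≥ α / 2`. The gap leaves room for a rational `γ` if `α < 1 / 2`. Otherwise `γ = 1 / 3`, and
`2 ^ (2 n / 3)` is covered by the first term because `ω + ε ≥ 2` (`exists_ratio`).

Machine. Everything is written in a small language of expressions and commands relative to a
parameter `P`, polynomial in `n`: all numbers have at most `P` bits, evaluating an expression takes
time polynomial in `P`, and only loops of commands may be exponentially long. Compilation thus costs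
a polynomial factor per step (`Cmd.code_spec`, `hasApprox_of_cmd`). -/

lemma bitLen_le {z : ℤ} {L : ℕ} (hL : 1 ≤ L) (h : z.natAbs < 2 ^ L) : bitLen z ≤ L := by
  unfold bitLen
  rcases Nat.eq_zero_or_pos z.natAbs with h0 | h0
  · simp [h0]; omega
  · have := (Nat.log_lt_iff_lt_pow (b := 2) (by norm_num) h0.ne').2 h
    omega

/-- The body itself lowers the counter register, so there are `z.toNat` rounds, none for negative
`z`. Every test costs the bit length of the counter, at most `b`; the last `b` pays for the test
that fails. -/
lemma exec_while_sum (r : ℕ) (p : Program) (T : ℕ → ℕ) (b : ℕ) (z : ℤ) (I : ℕ → State → Prop)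
    (hb1 : 1 ≤ b) (hb : z.natAbs < 2 ^ b)
    (step : ∀ i < z.toNat, ∀ σ, I i σ → σ.reg r = z - i → ∃ t σ', Exec p σ t σ' ∧ t ≤ T i ∧
      I (i + 1) σ' ∧ σ'.reg r = z - (i + 1 : ℕ))
    (σ : State) (h0 : I 0 σ) (hr : σ.reg r = z) :
    ∃ t σ', Exec (.whilePos r p) σ t σ' ∧ t ≤ ∑ i ∈ Finset.range z.toNat, (T i + b) + b ∧
      I z.toNat σ' := by
  have key : ∀ m i, i + m = z.toNat → ∀ σ, I i σ → σ.reg r = z - i →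
      ∃ t σ', Exec (.whilePos r p) σ t σ' ∧ t ≤ ∑ j ∈ Finset.Ico i z.toNat, (T j + b) + b ∧
        I z.toNat σ' := by
    intro m
    induction m with
    | zero =>
      intro i hi σ hI hr
      have hz : z - i ≤ 0 := by omega
      refine ⟨_, σ, .whileDone (by omega), ?_, by simpa [← hi] using hI⟩
      rw [hr]
      have : bitLen (z - i) ≤ b := bitLen_le hb1 (lt_of_le_of_lt (by omega) hb)
      omega
    | succ m ih =>
      intro i hi σ hI hr
      obtain ⟨t, σ', he, ht, hI', hr'⟩ := step i (by omega) σ hI hr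
      obtain ⟨t', σ'', he', ht', hI''⟩ := ih (i + 1) (by omega) σ' hI' hr'
      refine ⟨_, σ'', .whileStep (by omega) he he', ?_, hI''⟩
      rw [hr]
      have : bitLen (z - i) ≤ b := bitLen_le hb1 (lt_of_le_of_lt (by omega) hb)
      rw [Finset.sum_eq_sum_Ico_succ_bot (by omega)]
      omega
  rw [Finset.range_eq_Ico]
  exact key z.toNat 0 (by simp) σ h0 (by simpa using hr)

lemma exec_while (r : ℕ) (p : Program) (T b : ℕ) (z : ℤ) (I : ℕ → State → Prop)
    (hb1 : 1 ≤ b) (hb : z.natAbs < 2 ^ b)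
    (step : ∀ i < z.toNat, ∀ σ, I i σ → σ.reg r = z - i → ∃ t σ', Exec p σ t σ' ∧ t ≤ T ∧
      I (i + 1) σ' ∧ σ'.reg r = z - (i + 1 : ℕ))
    (σ : State) (h0 : I 0 σ) (hr : σ.reg r = z) :
    ∃ t σ', Exec (.whilePos r p) σ t σ' ∧ t ≤ z.toNat * (T + b) + b ∧ I z.toNat σ' := by
  simpa using exec_while_sum r p (fun _ => T) b z I hb1 hb step σ h0 hr

end RAM

/-! ### A language of expressions -/

namespace Lang

open RAM

/-- Binary operations on integers. -/
inductive Bin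
  | add
  | sub
  | mul
  | div
  | mod
  | min

/-- The value of a binary operation. -/
def Bin.eval : Bin → ℤ → ℤ → ℤ
  | .add, x, y => x + y
  | .sub, x, y => x - y
  | .mul, x, y => x * y
  | .div, x, y => x / y
  | .mod, x, y => x % y
  | .min, x, y => Min.min x y

/-- Expressions over integer variables and sixteen integer arrays.  `letE x e₁ e₂` binds `x` in `e₂`
and `fold o x b e₀ e` combines `e₀` with the values of `e` for `x < b`. -/
inductive Expr
  | const (c : ℤ)
  | var (x : ℕ)
  | bin (o : Bin) (e₁ e₂ : Expr)
  | get (i : Fin 16) (e : Expr)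
  | ifp (c e₁ e₂ : Expr)
  | letE (x : ℕ) (e₁ e₂ : Expr)
  | fold (o : Bin) (x : ℕ) (b e₀ e : Expr)

/-- The values of the variables and of the arrays. -/
structure Env where
  v : ℕ → ℤ
  a : Fin 16 → ℕ → ℤ

/-- Change the value of a variable. -/
def Env.setv (s : Env) (x : ℕ) (z : ℤ) : Env := { s with v := Function.update s.v x z }

/-- Change an array. -/
def Env.seta (s : Env) (i : Fin 16) (f : ℕ → ℤ) : Env := { s with a := Function.update s.a i f }

/-- The value of an expression. -/
def Expr.eval : Expr → Env → ℤ
  | .const c, _ => c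
  | .var x, s => s.v x
  | .bin o e₁ e₂, s => o.eval (e₁.eval s) (e₂.eval s)
  | .get i e, s => s.a i (e.eval s).toNat
  | .ifp c e₁ e₂, s => if 0 < c.eval s then e₁.eval s else e₂.eval s
  | .letE x e₁ e₂, s => e₂.eval (s.setv x (e₁.eval s))
  | .fold o x b e₀ e, s =>
      Nat.rec (e₀.eval s) (fun i acc => o.eval acc (e.eval (s.setv x i))) (b.eval s).toNat

/-- Variables whose values are polynomially bounded. -/
abbrev smallVar (x : ℕ) : Bool := decide (x < 50)

/-- Arrays whose values are polynomially bounded. -/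
abbrev smallArr (i : Fin 16) : Bool := decide (i < 4)

/-- All values are at most exponential in `P`, and those of small variables and arrays at most
`P`. -/
structure Env.Good (P : ℕ) (s : Env) : Prop where
  v : ∀ x, (s.v x).natAbs < 2 ^ P
  sv : ∀ x, smallVar x → (s.v x).natAbs ≤ P
  a : ∀ i j, (s.a i j).natAbs < 2 ^ P
  sa : ∀ i j, smallArr i → (s.a i j).natAbs ≤ P

/-- Folding with this operation grows linearly. -/
def Bin.linear : Bin → Bool
  | .mul => false
  | _ => true

/-- Nonzero constants under the operation `mod`. -/
def Bin.reduces : Bin → Expr → Bool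
  | .mod, .const c => c != 0
  | _, _ => false

/-- Expressions with polynomially bounded values. -/
def Expr.small : Expr → Bool
  | .const _ => true
  | .var x => smallVar x
  | .bin o e₁ e₂ => (e₁.small && e₂.small) || o.reduces e₂
  | .get i _ => smallArr i
  | .ifp _ e₁ e₂ => e₁.small && e₂.small
  | .letE _ _ e₂ => e₂.small
  | .fold o _ _ e₀ e => o.linear && e₀.small && e.small

/-- Expressions whose loops are polynomially bounded. -/
def Expr.ok : Expr → Bool
  | .const _ => true
  | .var _ => true
  | .bin _ e₁ e₂ => e₁.ok && e₂.ok
  | .get _ e => e.ok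
  | .ifp c e₁ e₂ => c.ok && e₁.ok && e₂.ok
  | .letE x e₁ e₂ => e₁.ok && e₂.ok && (!smallVar x || e₁.small)
  | .fold _ x b e₀ e => b.small && b.ok && e₀.ok && e.ok && smallVar x

lemma le_pow_self {P : ℕ} (hP : 2 ≤ P) (c : ℕ) : c ≤ P ^ c :=
  (Nat.lt_pow_self (by omega)).le

/-- Constant factors move into the exponent because `c ≤ P ^ c`. This keeps all polynomial bounds in
the form `P ^ K` with `K` independent of `P`. -/
lemma le_pow_of_le_mul {P : ℕ} (hP : 2 ≤ P) {t c a : ℕ} (h : t ≤ c * P ^ a) : t ≤ P ^ (c + a) := by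
  rw [pow_add]
  exact h.trans (Nat.mul_le_mul_right _ (le_pow_self hP c))

lemma pow_mono {P : ℕ} (hP : 2 ≤ P) {a b : ℕ} (h : a ≤ b) : P ^ a ≤ P ^ b :=
  Nat.pow_le_pow_right (by omega) h

lemma Env.Good.mono {P Q : ℕ} {s : Env} (h : s.Good P) (hPQ : P ≤ Q) : s.Good Q where
  v x := (h.v x).trans_le (Nat.pow_le_pow_right (by norm_num) hPQ)
  sv x hx := (h.sv x hx).trans hPQ
  a i j := (h.a i j).trans_le (Nat.pow_le_pow_right (by norm_num) hPQ)
  sa i j hi := (h.sa i j hi).trans hPQ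

lemma Env.Good.setv {P : ℕ} {s : Env} (h : s.Good P) {x : ℕ} {z : ℤ} (hz : z.natAbs < 2 ^ P)
    (hx : smallVar x → z.natAbs ≤ P) : (s.setv x z).Good P where
  v y := by
    rcases eq_or_ne y x with rfl | hy
    · simpa [Env.setv] using hz
    · simpa [Env.setv, hy] using h.v y
  sv y hs := by
    rcases eq_or_ne y x with rfl | hy
    · simpa [Env.setv] using hx hs
    · simpa [Env.setv, hy] using h.sv y hs
  a := h.a
  sa := h.sa

lemma Env.Good.setv_small {P : ℕ} {s : Env} (h : s.Good P) {x : ℕ} {z : ℤ} (hz : z.natAbs ≤ P) :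
    (s.setv x z).Good P :=
  h.setv (hz.trans_lt Nat.lt_two_pow_self) fun _ => hz

lemma Env.Good.seta {P : ℕ} {s : Env} (h : s.Good P) {i : Fin 16} {f : ℕ → ℤ}
    (hf : ∀ j, (f j).natAbs < 2 ^ P) (hi : smallArr i → ∀ j, (f j).natAbs ≤ P) :
    (s.seta i f).Good P where
  v := h.v
  sv := h.sv
  a y j := by
    rcases eq_or_ne y i with rfl | hy
    · simpa [Env.seta] using hf j
    · simpa [Env.seta, hy] using h.a y j
  sa y j hs := by
    rcases eq_or_ne y i with rfl | hy
    · simpa [Env.seta] using hi hs j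
    · simpa [Env.seta, hy] using h.sa y j hs

lemma natAbs_div_le (x y : ℤ) : (x / y).natAbs ≤ x.natAbs := Int.natAbs_ediv_le_natAbs x y

lemma natAbs_mod_le (x y : ℤ) : (x % y).natAbs ≤ x.natAbs + y.natAbs := by
  rcases eq_or_ne y 0 with rfl | hy
  · simp
  · have h1 := Int.emod_nonneg x hy
    have h2 := Int.emod_lt_abs x hy
    rw [Int.abs_eq_natAbs] at h2
    omega

lemma Bin.eval_linear (o : Bin) (ho : o.linear) (x y : ℤ) :
    (o.eval x y).natAbs ≤ x.natAbs + y.natAbs := by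
  cases o <;> simp only [Bin.eval]
  · exact Int.natAbs_add_le x y
  · exact Int.natAbs_sub_le x y
  · simp [Bin.linear] at ho
  · exact (natAbs_div_le x y).trans (by omega)
  · exact natAbs_mod_le x y
  · rcases min_choice x y with h | h <;> rw [h] <;> omega

/-- With one added to the absolute values, a single multiplicative bound serves all operations, and
it iterates well along a fold. -/
lemma Bin.eval_bound (o : Bin) (x y : ℤ) :
    (o.eval x y).natAbs + 1 ≤ (x.natAbs + 1) * (y.natAbs + 1) := by
  by_cases ho : o.linear
  · have := o.eval_linear ho x y
    nlinarith [Nat.zero_le (x.natAbs * y.natAbs)]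
  · cases o <;> simp [Bin.linear] at ho
    simp only [Bin.eval, Int.natAbs_mul]
    generalize x.natAbs = a
    generalize y.natAbs = b
    ring_nf
    omega

/-- The value of a fold after `i` rounds. -/
def foldVal (o : Bin) (z : ℤ) (f : ℕ → ℤ) (i : ℕ) : ℤ :=
  Nat.rec z (fun i acc => o.eval acc (f i)) i

@[simp] lemma foldVal_zero (o : Bin) (z : ℤ) (f : ℕ → ℤ) : foldVal o z f 0 = z := rfl

lemma foldVal_succ (o : Bin) (z : ℤ) (f : ℕ → ℤ) (i : ℕ) :
    foldVal o z f (i + 1) = o.eval (foldVal o z f i) (f i) := rfl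

lemma eval_fold (o : Bin) (x : ℕ) (b e₀ e : Expr) (s : Env) :
    (Expr.fold o x b e₀ e).eval s =
      foldVal o (e₀.eval s) (fun i => e.eval (s.setv x i)) (b.eval s).toNat := rfl

lemma foldVal_bound (o : Bin) (z : ℤ) (f : ℕ → ℤ) (Y N : ℕ) (hY : ∀ i < N, (f i).natAbs + 1 ≤ Y) :
    ∀ i ≤ N, (foldVal o z f i).natAbs + 1 ≤ (z.natAbs + 1) * Y ^ i := by
  intro i
  induction i with
  | zero => simp
  | succ i ih =>
    intro hi
    rw [foldVal_succ]
    calc _ ≤ _ := o.eval_bound _ _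
      _ ≤ ((z.natAbs + 1) * Y ^ i) * Y :=
        Nat.mul_le_mul (ih (by omega)) (hY i (by omega))
      _ = _ := by ring

lemma foldVal_linear (o : Bin) (ho : o.linear) (z : ℤ) (f : ℕ → ℤ) (Y N : ℕ)
    (hY : ∀ i < N, (f i).natAbs ≤ Y) : ∀ i ≤ N, (foldVal o z f i).natAbs ≤ z.natAbs + i * Y := by
  intro i
  induction i with
  | zero => simp
  | succ i ih =>
    intro hi
    rw [foldVal_succ]
    have h1 := o.eval_linear ho (foldVal o z f i) (f i)
    have h2 := ih (by omega)
    have h3 := hY i (by omega)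
    rw [Nat.succ_mul]
    omega

/-- In bits the right-hand side of `hz` amounts to `P ^ a + P ^ b * P ^ c`, at most twice `P ^ (a +
b + c)`; the `2` in the new exponent absorbs this factor. -/
lemma pow_bound_aux {P : ℕ} (hP : 2 ≤ P) {x Y N a b c : ℕ} (hx : x < 2 ^ P ^ a) (hY : Y < 2 ^ P ^ b)
    (hN : N ≤ P ^ c) {z : ℕ} (hz : z + 1 ≤ (x + 1) * (Y + 1) ^ N) : z < 2 ^ P ^ (2 + (a + b + c)) := by
  have h1 : (x + 1) * (Y + 1) ^ N ≤ 2 ^ (P ^ a + P ^ b * P ^ c) := by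
    rw [pow_add, pow_mul]
    refine Nat.mul_le_mul hx ?_
    exact (Nat.pow_le_pow_left hY _).trans (Nat.pow_le_pow_right (by positivity) hN)
  have h2 : P ^ a + P ^ b * P ^ c ≤ P ^ (2 + (a + b + c)) := by
    apply le_pow_of_le_mul hP
    rw [← pow_add]
    have := pow_mono hP (show a ≤ a + b + c by omega)
    have := pow_mono hP (show b + c ≤ a + b + c by omega)
    omega
  have h3 := Nat.pow_le_pow_right (show 0 < 2 by norm_num) h2
  omega

lemma Bin.eq_of_reduces (o : Bin) {e : Expr} (h : o.reduces e) :
    o = .mod ∧ ∃ c, e = .const c ∧ c ≠ 0 := by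
  cases o <;> cases e <;> simp [Bin.reduces] at h
  exact ⟨rfl, _, rfl, h⟩

/-- The exponent is chosen before `P`, which makes the induction work: under a binder the
environment is good only for a power of `P`, and the hypothesis for the body is applied with that
power in place of `P`. -/
theorem Expr.eval_bound (e : Expr) : e.ok → ∃ K, ∀ P, 2 ≤ P → ∀ s : Env, s.Good P →
    (e.eval s).natAbs < 2 ^ P ^ K ∧ (e.small → (e.eval s).natAbs ≤ P ^ K) := by
  induction e with
  | const c =>
    intro _
    refine ⟨c.natAbs, fun P hP s hs => ?_⟩
    have : c.natAbs ≤ P ^ c.natAbs := le_pow_self hP _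
    exact ⟨this.trans_lt Nat.lt_two_pow_self, fun _ => this⟩
  | var x =>
    intro _
    refine ⟨1, fun P hP s hs => ?_⟩
    simpa [Expr.eval] using ⟨hs.v x, fun h => hs.sv x (by simpa [Expr.small] using h)⟩
  | bin o e₁ e₂ ih₁ ih₂ =>
    intro h
    simp only [Expr.ok, Bool.and_eq_true] at h
    obtain ⟨K₁, h₁⟩ := ih₁ h.1
    obtain ⟨K₂, h₂⟩ := ih₂ h.2
    refine ⟨2 + (K₁ + K₂ + (K₁ + K₂)), fun P hP s hs => ?_⟩
    obtain ⟨a1, b1⟩ := h₁ P hP s hs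
    obtain ⟨a2, b2⟩ := h₂ P hP s hs
    have hb := o.eval_bound (e₁.eval s) (e₂.eval s)
    constructor
    · refine pow_bound_aux hP (N := 1) a1 a2 (Nat.one_le_pow _ _ (by omega)) ?_
      simpa only [pow_one, Expr.eval] using hb
    · intro hsm
      simp only [Expr.small, Bool.or_eq_true, Bool.and_eq_true] at hsm
      rcases hsm with hsm | hsm
      swap
      -- A remainder modulo a constant is small even when the dividend is exponentially large. Thus
      -- bits of large numbers count as small and may occur in exponents.
      · obtain ⟨rfl, c, rfl, hc⟩ := o.eq_of_reduces hsm
        have h1 := Int.emod_nonneg (e₁.eval s) hc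
        have h2 := Int.emod_lt_abs (e₁.eval s) hc
        rw [Int.abs_eq_natAbs] at h2
        have h3 : c.natAbs ≤ P ^ K₂ := b2 rfl
        have h4 := pow_mono hP (show K₂ ≤ 2 + (K₁ + K₂ + (K₁ + K₂)) by omega)
        change (e₁.eval s % c).natAbs ≤ _
        omega
      have c1 := b1 hsm.1
      have c2 := b2 hsm.2
      have p1 := Nat.one_le_pow K₁ P (by omega)
      have p2 := Nat.one_le_pow K₂ P (by omega)
      have : (o.eval (e₁.eval s) (e₂.eval s)).natAbs + 1 ≤ 4 * P ^ (K₁ + K₂) := by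
        refine hb.trans ?_
        rw [pow_add]
        nlinarith [Nat.mul_le_mul c1 c2, Nat.mul_le_mul p1 p2, Nat.mul_le_mul c1 p2,
          Nat.mul_le_mul p1 c2]
      calc _ ≤ 4 * P ^ (K₁ + K₂) := by simp only [Expr.eval]; omega
        _ ≤ P ^ 2 * P ^ (K₁ + K₂) := Nat.mul_le_mul_right _ (by nlinarith)
        _ = P ^ (2 + (K₁ + K₂)) := (pow_add _ _ _).symm
        _ ≤ _ := pow_mono hP (by omega)
  | get i e ih =>
    intro _
    refine ⟨1, fun P hP s hs => ?_⟩
    simpa [Expr.eval] using ⟨hs.a i _, fun h => hs.sa i _ (by simpa [Expr.small] using h)⟩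
  | ifp c e₁ e₂ _ ih₁ ih₂ =>
    intro h
    simp only [Expr.ok, Bool.and_eq_true] at h
    obtain ⟨K₁, h₁⟩ := ih₁ h.1.2
    obtain ⟨K₂, h₂⟩ := ih₂ h.2
    refine ⟨K₁ + K₂, fun P hP s hs => ?_⟩
    obtain ⟨a1, b1⟩ := h₁ P hP s hs
    obtain ⟨a2, b2⟩ := h₂ P hP s hs
    have q1 := pow_mono hP (show K₁ ≤ K₁ + K₂ by omega)
    have q2 := pow_mono hP (show K₂ ≤ K₁ + K₂ by omega)
    simp only [Expr.small, Bool.and_eq_true, Expr.eval]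
    split_ifs
    · exact ⟨a1.trans_le (Nat.pow_le_pow_right (by norm_num) q1), fun h => (b1 h.1).trans q1⟩
    · exact ⟨a2.trans_le (Nat.pow_le_pow_right (by norm_num) q2), fun h => (b2 h.2).trans q2⟩
  | letE x e₁ e₂ ih₁ ih₂ =>
    intro h
    simp only [Expr.ok, Bool.and_eq_true, Bool.or_eq_true, Bool.not_eq_true'] at h
    obtain ⟨K₁, h₁⟩ := ih₁ h.1.1
    obtain ⟨K₂, h₂⟩ := ih₂ h.1.2
    refine ⟨(1 + K₁) * K₂, fun P hP s hs => ?_⟩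
    obtain ⟨a1, b1⟩ := h₁ P hP s hs
    rw [pow_mul]
    have q1 : P ^ K₁ ≤ P ^ (1 + K₁) := pow_mono hP (by omega)
    refine h₂ (P ^ (1 + K₁)) (hP.trans (by simpa using pow_mono hP (show 1 ≤ 1 + K₁ by omega))) _ ?_
    refine (hs.mono (by simpa using pow_mono hP (show 1 ≤ 1 + K₁ by omega))).setv
      (a1.trans_le (Nat.pow_le_pow_right (by norm_num) q1)) fun hx => (b1 ?_).trans q1
    rcases h.2 with h | h
    · rw [hx] at h; cases h
    · exact h
  | fold o x b e₀ e ihb ih₀ ih =>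
    intro h
    simp only [Expr.ok, Bool.and_eq_true] at h
    obtain ⟨⟨⟨⟨hbs, hbo⟩, h0o⟩, heo⟩, hx⟩ := h
    obtain ⟨Kb, hb⟩ := ihb hbo
    obtain ⟨K₀, h₀⟩ := ih₀ h0o
    obtain ⟨K, hK⟩ := ih heo
    refine ⟨2 + (K₀ + (1 + Kb) * K + Kb), fun P hP s hs => ?_⟩
    have hN : (b.eval s).toNat ≤ P ^ Kb := by
      have := (hb P hP s hs).2 hbs
      omega
    have hP' : P ≤ P ^ (1 + Kb) := by simpa using pow_mono hP (show 1 ≤ 1 + Kb by omega)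
    have q1 : P ^ Kb ≤ P ^ (1 + Kb) := pow_mono hP (by omega)
    have hbody : ∀ i < (b.eval s).toNat, _ := fun i hi =>
      hK (P ^ (1 + Kb)) (hP.trans hP') (s.setv x i) ((hs.mono hP').setv_small (by simp; omega))
    simp only [← pow_mul] at hbody
    rw [eval_fold]
    constructor
    · have hpos : 1 ≤ 2 ^ P ^ ((1 + Kb) * K) := Nat.one_le_two_pow
      refine pow_bound_aux hP (h₀ P hP s hs).1 (Y := 2 ^ P ^ ((1 + Kb) * K) - 1) (by omega) hN ?_
      rw [Nat.sub_add_cancel hpos]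
      exact foldVal_bound o _ _ _ _ (fun i hi => (hbody i hi).1) _ le_rfl
    · intro hsm
      simp only [Expr.small, Bool.and_eq_true] at hsm
      have := foldVal_linear o hsm.1.1 (e₀.eval s) _ _ _ (fun i hi => (hbody i hi).2 hsm.2) _ le_rfl
      have h0 := (h₀ P hP s hs).2 hsm.1.2
      apply le_pow_of_le_mul hP
      refine this.trans ?_
      have r1 : P ^ K₀ ≤ P ^ (K₀ + (1 + Kb) * K + Kb) := pow_mono hP (by omega)
      have r2 : (b.eval s).toNat * P ^ ((1 + Kb) * K) ≤ P ^ (K₀ + (1 + Kb) * K + Kb) :=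
        (Nat.mul_le_mul_right _ hN).trans (by rw [← pow_add]; exact pow_mono hP (by omega))
      omega

end Lang

/-! ### Compilation of expressions -/

namespace Lang

open RAM

/-- The register of a variable. -/
abbrev rv (x : ℕ) : ℕ := 2 * x + 1

/-- Scratch registers. -/
abbrev tmp (d : ℕ) : ℕ := 2 * d + 2

/-- Copy register `a` to register `r`, using the scratch register `z`. -/
def mov (r a z : ℕ) : Program := .seq (.const z 0) (.arith .add r a z)

/-- Apply a binary operation to the scratch registers `d` and `d + 1`. -/
def Bin.code : Bin → ℕ → Program
  | .add, d => .arith .add (tmp d) (tmp d) (tmp (d + 1))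
  | .sub, d => .arith .sub (tmp d) (tmp d) (tmp (d + 1))
  | .mul, d => .arith .mul (tmp d) (tmp d) (tmp (d + 1))
  | .div, d => .arith .div (tmp d) (tmp d) (tmp (d + 1))
  | .mod, d => .seq (.arith .div (tmp (d + 2)) (tmp d) (tmp (d + 1)))
      (.seq (.arith .mul (tmp (d + 2)) (tmp (d + 1)) (tmp (d + 2)))
        (.arith .sub (tmp d) (tmp d) (tmp (d + 2))))
  | .min, d => .seq (.arith .sub (tmp (d + 2)) (tmp d) (tmp (d + 1)))
      (.ifPos (tmp (d + 2)) (mov (tmp d) (tmp (d + 1)) (tmp (d + 2))) .skip)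

/-- Turn the index in scratch register `d` into an address of the array `i`. -/
def addrCode (i : Fin 16) (d : ℕ) : Program :=
  .seq (.ifPos (tmp d) .skip (.const (tmp d) 0)) <|
  .seq (.const (tmp (d + 1)) 16) <|
  .seq (.arith .mul (tmp d) (tmp d) (tmp (d + 1))) <|
  .seq (.const (tmp (d + 1)) ((i : ℕ) : ℤ)) <|
  .seq (.arith .add (tmp d) (tmp d) (tmp (d + 1)))
    (.arith .add (tmp d) (tmp d) 0)

/-- The program that leaves the value of an expression in scratch register `d`. -/
def Expr.code : Expr → ℕ → Program
  | .const c, d => .const (tmp d) c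
  | .var x, d => mov (tmp d) (rv x) (tmp d)
  | .bin o e₁ e₂, d => .seq (e₁.code d) (.seq (e₂.code (d + 1)) (o.code d))
  | .get i e, d => .seq (e.code d) (.seq (addrCode i d) (.load (tmp d) (tmp d)))
  | .ifp c e₁ e₂, d => .seq (c.code d) (.ifPos (tmp d) (e₁.code d) (e₂.code d))
  | .letE x e₁ e₂, d =>
      .seq (e₁.code d) <| .seq (mov (tmp (d + 1)) (rv x) (tmp (d + 2))) <|
      .seq (mov (rv x) (tmp d) (tmp (d + 2))) <| .seq (e₂.code (d + 2)) <|
      .seq (mov (rv x) (tmp (d + 1)) (tmp (d + 3))) (mov (tmp d) (tmp (d + 2)) (tmp (d + 3)))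
  -- Scratch register `d` counts the rounds down, `d + 2` keeps the outer value of `x`, `d + 3`
  -- counts up, `d + 4` accumulates, and the body works from `d + 5` on.
  | .fold o x b e₀ e, d =>
      .seq (b.code d) <| .seq (e₀.code (d + 4)) <| .seq (mov (tmp (d + 2)) (rv x) (tmp (d + 3))) <|
      .seq (.const (tmp (d + 3)) 0) <|
      .seq (.whilePos (tmp d) <|
        .seq (mov (rv x) (tmp (d + 3)) (tmp (d + 5))) <|
        .seq (e.code (d + 5)) <| .seq (o.code (d + 4)) <| .seq (.const (tmp (d + 5)) 1) <|
        .seq (.arith .add (tmp (d + 3)) (tmp (d + 3)) (tmp (d + 5)))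
          (.arith .sub (tmp d) (tmp d) (tmp (d + 5)))) <|
      .seq (mov (rv x) (tmp (d + 2)) (tmp (d + 5))) (mov (tmp d) (tmp (d + 4)) (tmp (d + 5)))

/-- The machine state `σ` represents the environment `s`, with the arrays stored from address `B`
on. -/
structure Rep (B : ℕ) (σ : State) (s : Env) : Prop where
  base : σ.reg 0 = B
  v : ∀ x, σ.reg (rv x) = s.v x
  a : ∀ (i : Fin 16) j, σ.mem (B + 16 * j + i) = s.a i j

/-- The states differ only in scratch registers from `d` on. -/
structure Agree (d : ℕ) (σ τ : State) : Prop where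
  mem : τ.mem = σ.mem
  reg : ∀ r, (∀ i, d ≤ i → r ≠ tmp i) → τ.reg r = σ.reg r

lemma Agree.refl (d : ℕ) (σ : State) : Agree d σ σ := ⟨rfl, fun _ _ => rfl⟩

lemma Agree.trans {d d' : ℕ} {σ τ υ : State} (h : Agree d σ τ) (h' : Agree d' τ υ) (hd : d ≤ d') :
    Agree d σ υ :=
  ⟨h'.mem.trans h.mem, fun r hr => (h'.reg r fun i hi => hr i (hd.trans hi)).trans (h.reg r hr)⟩

lemma Agree.tmp {d : ℕ} {σ τ : State} (h : Agree d σ τ) {i : ℕ} (hi : i < d) :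
    τ.reg (tmp i) = σ.reg (tmp i) :=
  h.reg _ fun j hj => by simp only [Lang.tmp]; omega

lemma Agree.rv {d : ℕ} {σ τ : State} (h : Agree d σ τ) (x : ℕ) : τ.reg (rv x) = σ.reg (rv x) :=
  h.reg _ fun j hj => by simp only [Lang.tmp, Lang.rv]; omega

lemma Agree.zero {d : ℕ} {σ τ : State} (h : Agree d σ τ) : τ.reg 0 = σ.reg 0 :=
  h.reg _ fun j hj => by simp only [Lang.tmp]; omega

lemma Rep.agree {B d : ℕ} {σ τ : State} {s : Env} (h : Rep B σ s) (h' : Agree d σ τ) : Rep B τ s :=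
  ⟨h'.zero.trans h.base, fun x => (h'.rv x).trans (h.v x), fun i j => by rw [h'.mem, h.a]⟩

lemma Agree.setTmp {d i : ℕ} (σ : State) (z : ℤ) (hi : d ≤ i) : Agree d σ (σ.setReg (Lang.tmp i) z) :=
  ⟨rfl, fun r hr => by simp [State.setReg, Function.update_of_ne (hr i hi)]⟩

@[simp] lemma setReg_mem (σ : State) (r : ℕ) (z : ℤ) : (σ.setReg r z).mem = σ.mem := rfl

lemma setReg_reg (σ : State) (r r' : ℕ) (z : ℤ) :
    (σ.setReg r z).reg r' = if r' = r then z else σ.reg r' := by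
  simp [State.setReg, Function.update_apply]

lemma exec_mov {r a z : ℕ} (hz : z ≠ a) (σ : State) {b : ℕ} (hb : 1 ≤ b)
    (ha : (σ.reg a).natAbs < 2 ^ b) :
    ∃ t, Exec (mov r a z) σ t ((σ.setReg z 0).setReg r (σ.reg a)) ∧ t ≤ 3 * b := by
  have h := Exec.seq (Exec.const σ z 0) (Exec.arith (σ.setReg z 0) .add r a z)
  simp only [setReg_reg, if_neg hz.symm, if_true, Op.eval, add_zero] at h
  refine ⟨_, h, ?_⟩
  have h0 : bitLen 0 ≤ b := bitLen_le hb (by positivity)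
  have h1 := bitLen_le hb ha
  omega

lemma natAbs_div_mul_le (x y : ℤ) : (y * (x / y)).natAbs ≤ 2 * x.natAbs + y.natAbs := by
  have h := Int.mul_ediv_add_emod x y
  have h2 := natAbs_mod_le x y
  omega

lemma exec_bin (o : Bin) (d : ℕ) (σ : State) {b : ℕ} (hb : 1 ≤ b)
    (h₁ : (σ.reg (tmp d)).natAbs < 2 ^ b) (h₂ : (σ.reg (tmp (d + 1))).natAbs < 2 ^ b) :
    ∃ t σ', Exec (o.code d) σ t σ' ∧ t ≤ 8 * (b + 2) ∧ Agree d σ σ' ∧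
      σ'.reg (tmp d) = o.eval (σ.reg (tmp d)) (σ.reg (tmp (d + 1))) := by
  set x := σ.reg (tmp d) with hx
  set y := σ.reg (tmp (d + 1)) with hy
  have p2 : 2 ^ (b + 2) = 4 * 2 ^ b := by rw [pow_add]; ring
  have hx' : bitLen x ≤ b + 2 := bitLen_le (by omega) (by omega)
  have hy' : bitLen y ≤ b + 2 := bitLen_le (by omega) (by omega)
  have simple : ∀ o' : Op, Exec (.arith o' (tmp d) (tmp d) (tmp (d + 1))) σ (bitLen x + bitLen y)
      (σ.setReg (tmp d) (o'.eval x y)) := fun o' => Exec.arith ..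
  have simple' : ∀ o' : Op, o'.eval x y = o.eval x y →
      Exec (.arith o' (tmp d) (tmp d) (tmp (d + 1))) σ (bitLen x + bitLen y)
      (σ.setReg (tmp d) (o'.eval x y)) ∧ bitLen x + bitLen y ≤ 8 * (b + 2) ∧
      Agree d σ (σ.setReg (tmp d) (o'.eval x y)) ∧
      (σ.setReg (tmp d) (o'.eval x y)).reg (tmp d) = o.eval x y := fun o' ho =>
    ⟨simple o', by omega, Agree.setTmp _ _ le_rfl, by simp [setReg_reg, ho]⟩
  cases o with
  | add => exact ⟨_, _, simple' .add rfl⟩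
  | sub => exact ⟨_, _, simple' .sub rfl⟩
  | mul => exact ⟨_, _, simple' .mul rfl⟩
  | div => exact ⟨_, _, simple' .div rfl⟩
  | mod =>
    have e1 := Exec.arith σ .div (tmp (d + 2)) (tmp d) (tmp (d + 1))
    have e2 := Exec.arith (σ.setReg (tmp (d + 2)) (x / y)) .mul (tmp (d + 2)) (tmp (d + 1))
      (tmp (d + 2))
    have e3 := Exec.arith ((σ.setReg (tmp (d + 2)) (x / y)).setReg (tmp (d + 2)) (y * (x / y)))
      .sub (tmp d) (tmp d) (tmp (d + 2))
    simp [setReg_reg, Op.eval, ← hx, ← hy] at e1 e2 e3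
    refine ⟨_, _, .seq e1 (.seq e2 e3), ?_, ?_, ?_⟩
    · have b1 : bitLen (x / y) ≤ b + 2 :=
        bitLen_le (by omega) (lt_of_le_of_lt (natAbs_div_le x y) (by omega))
      have b2 : bitLen (y * (x / y)) ≤ b + 2 :=
        bitLen_le (by omega) (lt_of_le_of_lt (natAbs_div_mul_le x y) (by omega))
      omega
    · exact ((Agree.setTmp _ _ (by omega)).trans (Agree.setTmp _ _ (by omega)) le_rfl).trans
        (Agree.setTmp _ _ le_rfl) le_rfl
    · simp [setReg_reg, Bin.eval, Int.emod_def]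
  | min =>
    have e1 := Exec.arith σ .sub (tmp (d + 2)) (tmp d) (tmp (d + 1))
    simp only [Op.eval, ← hx, ← hy] at e1
    have b1 : bitLen (x - y) ≤ b + 2 := bitLen_le (by omega) (by omega)
    have a1 : Agree d σ (σ.setReg (tmp (d + 2)) (x - y)) := Agree.setTmp _ _ (by omega)
    have r1 : (σ.setReg (tmp (d + 2)) (x - y)).reg (tmp (d + 2)) = x - y := by simp [setReg_reg]
    rcases lt_or_ge 0 (x - y) with hpos | hneg
    · obtain ⟨t, e2, ht⟩ := exec_mov (r := tmp d) (a := tmp (d + 1)) (z := tmp (d + 2)) (by simp)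
        (σ.setReg (tmp (d + 2)) (x - y)) (b := b + 2) (by omega) (by
          simp [setReg_reg, ← hy]; omega)
      refine ⟨_, _, .seq e1 (.ifPos (by rw [r1]; exact hpos) e2), ?_, ?_, ?_⟩
      · rw [r1]; omega
      · exact (a1.trans (Agree.setTmp _ _ (by omega)) le_rfl).trans
          (Agree.setTmp _ _ le_rfl) le_rfl
      · simp [setReg_reg, Bin.eval, ← hy]; omega
    · refine ⟨_, _, .seq e1 (.ifNonpos (by rw [r1]; exact hneg) (.skip _)), ?_, a1, ?_⟩
      · rw [r1]; omega
      · simp [setReg_reg, Bin.eval, ← hx]; omega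

/-- Nonpositive indices are first replaced by `0`, in accordance with `toNat` in `Expr.eval`. The
sixteen arrays are interleaved, so the address is below `64 * 2 ^ b`, which accounts for the six
extra bits. -/
lemma exec_addr (i : Fin 16) (d : ℕ) (σ : State) {B b : ℕ} (hB : σ.reg 0 = B) (hb : 1 ≤ b)
    (hBb : B < 2 ^ b) (h₁ : (σ.reg (tmp d)).natAbs < 2 ^ b) :
    ∃ t σ', Exec (addrCode i d) σ t σ' ∧ t ≤ 20 * (b + 6) ∧ Agree d σ σ' ∧
      σ'.reg (tmp d) = (B + 16 * (σ.reg (tmp d)).toNat + i : ℕ) ∧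
      (B + 16 * (σ.reg (tmp d)).toNat + i : ℕ) < 2 ^ (b + 6) := by
  set x := σ.reg (tmp d) with hx
  have p2 : 2 ^ (b + 6) = 64 * 2 ^ b := by rw [pow_add]; ring
  have pb := Nat.one_le_two_pow (n := b)
  have hi := i.isLt
  obtain ⟨t, σ₁, e1, ht, a1, r1⟩ : ∃ t σ₁, Exec (.ifPos (tmp d) .skip (.const (tmp d) 0)) σ t σ₁ ∧
      t ≤ 2 * (b + 6) ∧ Agree d σ σ₁ ∧ σ₁.reg (tmp d) = (x.toNat : ℤ) := by
    have hxb : bitLen x ≤ b := bitLen_le hb h₁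
    rcases lt_or_ge 0 x with hpos | hneg
    · refine ⟨_, _, .ifPos hpos (.skip _), ?_, Agree.refl _ _, ?_⟩
      · rw [← hx]; omega
      · rw [← hx]; omega
    · refine ⟨_, _, .ifNonpos hneg (.const _ _ _), ?_, Agree.setTmp _ _ le_rfl, ?_⟩
      · rw [← hx]
        have : bitLen 0 ≤ b := bitLen_le hb (by positivity)
        omega
      · simp [setReg_reg]; omega
  have hz : x.toNat < 2 ^ b := by omega
  generalize x.toNat = m at *
  have e2 := Exec.const σ₁ (tmp (d + 1)) 16
  have e3 := Exec.arith (σ₁.setReg (tmp (d + 1)) 16) .mul (tmp d) (tmp d) (tmp (d + 1))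
  have r3 : (σ₁.setReg (tmp (d + 1)) 16).reg (tmp d) = m := by simp [setReg_reg, r1]
  have r3' : (σ₁.setReg (tmp (d + 1)) 16).reg (tmp (d + 1)) = 16 := by simp [setReg_reg]
  rw [r3, r3'] at e3
  have a3 := (a1.trans (Agree.setTmp σ₁ 16 (show d ≤ d + 1 by omega)) le_rfl).trans
    (Agree.setTmp _ (Op.mul.eval m 16) (le_refl d)) le_rfl
  set σ₃ := (σ₁.setReg (tmp (d + 1)) 16).setReg (tmp d) (Op.mul.eval m 16) with hσ₃
  have r4 : σ₃.reg (tmp d) = m * 16 := by simp [hσ₃, setReg_reg, Op.eval]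
  clear_value σ₃
  have e4 := Exec.const σ₃ (tmp (d + 1)) ((i : ℕ) : ℤ)
  have e5 := Exec.arith (σ₃.setReg (tmp (d + 1)) ((i : ℕ) : ℤ)) .add (tmp d) (tmp d) (tmp (d + 1))
  have r5 : (σ₃.setReg (tmp (d + 1)) ((i : ℕ) : ℤ)).reg (tmp d) = m * 16 := by
    simp [setReg_reg, r4]
  have r5' : (σ₃.setReg (tmp (d + 1)) ((i : ℕ) : ℤ)).reg (tmp (d + 1)) = (i : ℕ) := by
    simp [setReg_reg]
  rw [r5, r5'] at e5
  have a5 := (a3.trans (Agree.setTmp σ₃ ((i : ℕ) : ℤ) (show d ≤ d + 1 by omega)) le_rfl).trans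
    (Agree.setTmp _ (Op.add.eval (m * 16) (i : ℕ)) (le_refl d)) le_rfl
  set σ₅ := (σ₃.setReg (tmp (d + 1)) ((i : ℕ) : ℤ)).setReg (tmp d) (Op.add.eval (m * 16) (i : ℕ))
    with hσ₅
  have r6 : σ₅.reg (tmp d) = m * 16 + (i : ℕ) := by simp [hσ₅, setReg_reg, Op.eval]
  clear_value σ₅
  have e6 := Exec.arith σ₅ .add (tmp d) (tmp d) 0
  have r6' : σ₅.reg 0 = B := a5.zero.trans hB
  rw [r6, r6'] at e6
  refine ⟨_, _, .seq e1 (.seq e2 (.seq e3 (.seq e4 (.seq e5 e6)))), ?_,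
    a5.trans (Agree.setTmp _ _ le_rfl) le_rfl, ?_, by omega⟩
  · have b1 : bitLen 16 ≤ b + 6 := bitLen_le (by omega) (by omega)
    have b2 : bitLen (m : ℤ) ≤ b + 6 := bitLen_le (by omega) (by omega)
    have b3 : bitLen ((i : ℕ) : ℤ) ≤ b + 6 := bitLen_le (by omega) (by omega)
    have b4 : bitLen ((m : ℤ) * 16) ≤ b + 6 := bitLen_le (by omega) (by omega)
    have b5 : bitLen ((m : ℤ) * 16 + (i : ℕ)) ≤ b + 6 := bitLen_le (by omega) (by omega)
    have b6 : bitLen (B : ℤ) ≤ b + 6 := bitLen_le (by omega) (by omega)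
    omega
  · simp [setReg_reg, Op.eval]; ring

end Lang

/-! ### Correctness and running time of compiled expressions -/

namespace Lang

open RAM

lemma Rep.setReg_rv {B : ℕ} {σ : State} {s : Env} (h : Rep B σ s) (x : ℕ) (z : ℤ) :
    Rep B (σ.setReg (rv x) z) (s.setv x z) where
  base := by simp [setReg_reg, h.base]
  v y := by simp [setReg_reg, Env.setv, Function.update_apply, ← h.v]
  a := h.a

@[simp] lemma Env.setv_v_self (s : Env) (x : ℕ) (z : ℤ) : (s.setv x z).v x = z := by
  simp [Env.setv]

lemma Env.setv_v_of_ne (s : Env) {x y : ℕ} (z : ℤ) (h : y ≠ x) : (s.setv x z).v y = s.v y := by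
  simp [Env.setv, h]

@[simp] lemma Env.setv_a (s : Env) (x : ℕ) (z : ℤ) : (s.setv x z).a = s.a := rfl

/-- `K` bounds the running time of the code of `e`. -/
def CodeSpec (e : Expr) (K : ℕ) : Prop :=
  ∀ P, 2 ≤ P → ∀ B < 2 ^ P, ∀ s : Env, s.Good P → ∀ d σ, Rep B σ s →
    ∃ t σ', Exec (e.code d) σ t σ' ∧ t ≤ P ^ K ∧ Agree d σ σ' ∧ σ'.reg (tmp d) = e.eval s

/-- The old content of `x` is kept in scratch register `d + 1` while the body runs and is restored
afterwards, so only scratch registers change in the end. The time of the body is charged with `P ^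
(1 + V₁)`, for which the extended environment is good. -/
lemma codeSpec_letE (x : ℕ) (e₁ e₂ : Expr) (hok : (Expr.letE x e₁ e₂).ok)
    (ih₁ : ∃ K, CodeSpec e₁ K) (ih₂ : ∃ K, CodeSpec e₂ K) : ∃ K, CodeSpec (.letE x e₁ e₂) K := by
  have h := hok
  simp only [Expr.ok, Bool.and_eq_true, Bool.or_eq_true, Bool.not_eq_true'] at h
  obtain ⟨K₁, h₁⟩ := ih₁
  obtain ⟨K₂, h₂⟩ := ih₂
  obtain ⟨V₁, v₁⟩ := e₁.eval_bound h.1.1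
  obtain ⟨V, vb⟩ := (Expr.letE x e₁ e₂).eval_bound hok
  refine ⟨14 + (1 + V₁ + K₁ + (1 + V₁) * K₂ + V), fun P hP B hB s hs d σ hσ => ?_⟩
  apply (fun hh => hh : (∃ t σ', _ ∧ t ≤ P ^ _ ∧ _) → _)
  obtain ⟨a1, b1⟩ := v₁ P hP s hs
  obtain ⟨a2, -⟩ := vb P hP s hs
  set Q := P ^ (1 + V₁ + K₁ + (1 + V₁) * K₂ + V) with hQ
  have q0 : P ≤ P ^ (1 + V₁) := by simpa using pow_mono hP (show 1 ≤ 1 + V₁ by omega)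
  have q1 : P ^ V₁ ≤ P ^ (1 + V₁) := pow_mono hP (by omega)
  have q2 : P ^ (1 + V₁) ≤ Q := pow_mono hP (by omega)
  have q3 : P ^ K₁ ≤ Q := pow_mono hP (by omega)
  have q4 : (P ^ (1 + V₁)) ^ K₂ ≤ Q := by rw [← pow_mul]; exact pow_mono hP (by omega)
  have q5 : P ^ V ≤ Q := pow_mono hP (by omega)
  have two : ∀ {a b : ℕ}, a ≤ b → 2 ^ a ≤ 2 ^ b := fun h => Nat.pow_le_pow_right (by norm_num) h
  have hQ1 : 1 ≤ Q := Nat.one_le_pow _ _ (by omega)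
  obtain ⟨t₁, σ₁, x1, ht1, g1, r1⟩ := h₁ P hP B hB s hs d σ hσ
  have rep1 := hσ.agree g1
  obtain ⟨t₂, x2, ht2⟩ := exec_mov (r := tmp (d + 1)) (a := rv x) (z := tmp (d + 2))
    (by simp only [tmp, rv]; omega) σ₁ hQ1 (by
      rw [rep1.v]; exact (hs.v x).trans_le (two (q0.trans q2)))
  set σ₂ := (σ₁.setReg (tmp (d + 2)) 0).setReg (tmp (d + 1)) (σ₁.reg (rv x)) with hσ₂
  have g2 : Agree (d + 1) σ₁ σ₂ :=
    (Agree.setTmp _ _ (by omega)).trans (Agree.setTmp _ _ le_rfl) le_rfl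
  have r2 : σ₂.reg (tmp (d + 1)) = s.v x := by simp [hσ₂, setReg_reg, ← rep1.v]
  have r2' : σ₂.reg (tmp d) = e₁.eval s := by rw [g2.tmp (by omega), r1]
  clear_value σ₂
  have rep2 := rep1.agree g2
  obtain ⟨t₃, x3, ht3⟩ := exec_mov (r := rv x) (a := tmp d) (z := tmp (d + 2))
    (by simp) σ₂ hQ1 (by rw [r2']; exact a1.trans_le (two (q1.trans q2)))
  rw [r2'] at x3
  have rep3 := (rep2.agree (Agree.setTmp (d := d) σ₂ 0 (show d ≤ d + 2 by omega))).setReg_rv x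
    (e₁.eval s)
  set σ₃ := (σ₂.setReg (tmp (d + 2)) 0).setReg (rv x) (e₁.eval s) with hσ₃
  have m3 : σ₃.mem = σ₂.mem := rfl
  have r3 : ∀ r, r ≠ rv x → r ≠ tmp (d + 2) → σ₃.reg r = σ₂.reg r := fun r h h' => by
    simp only [hσ₃, setReg_reg, if_neg h, if_neg h']
  clear_value σ₃
  have good3 : (s.setv x (e₁.eval s)).Good (P ^ (1 + V₁)) := by
    refine (hs.mono q0).setv (a1.trans_le (two q1)) fun hx => (b1 ?_).trans q1
    rcases h.2 with h | h
    · rw [hx] at h; cases h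
    · exact h
  obtain ⟨t₄, σ₄, x4, ht4, g4, r4⟩ := h₂ _ (hP.trans q0) B (hB.trans_le (two q0)) _ good3 (d + 2)
    σ₃ rep3
  have r4' : σ₄.reg (tmp (d + 1)) = s.v x := by
    rw [g4.tmp (by omega), r3 _ (by simp only [tmp, rv]; omega) (by simp), r2]
  obtain ⟨t₅, x5, ht5⟩ := exec_mov (r := rv x) (a := tmp (d + 1)) (z := tmp (d + 3))
    (by simp) σ₄ hQ1 (by
      rw [r4']; exact (hs.v x).trans_le (two (q0.trans q2)))
  rw [r4'] at x5
  set σ₅ := (σ₄.setReg (tmp (d + 3)) 0).setReg (rv x) (s.v x) with hσ₅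
  have r5 : σ₅.reg (tmp (d + 2)) = (Expr.letE x e₁ e₂).eval s := by
    have : tmp (d + 2) ≠ rv x := by simp only [tmp, rv]; omega
    simp only [hσ₅, setReg_reg, if_neg this]
    rw [if_neg (by simp), r4]; rfl
  have r5' : ∀ r, r ≠ rv x → r ≠ tmp (d + 3) → σ₅.reg r = σ₄.reg r := fun r h h' => by
    simp only [hσ₅, setReg_reg, if_neg h, if_neg h']
  have r5x : σ₅.reg (rv x) = s.v x := by simp [hσ₅, setReg_reg]
  have m5 : σ₅.mem = σ₄.mem := rfl
  clear_value σ₅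
  obtain ⟨t₆, x6, ht6⟩ := exec_mov (r := tmp d) (a := tmp (d + 2)) (z := tmp (d + 3))
    (by simp) σ₅ hQ1 (by rw [r5]; exact a2.trans_le (two q5))
  rw [r5] at x6
  refine ⟨_, _, .seq x1 (.seq x2 (.seq x3 (.seq x4 (.seq x5 x6)))), ?_, ?_, ?_⟩
  · apply le_pow_of_le_mul hP
    omega
  · have g6 : Agree d σ₅ ((σ₅.setReg (tmp (d + 3)) 0).setReg (tmp d) ((Expr.letE x e₁ e₂).eval s)) :=
      (Agree.setTmp _ _ (by omega)).trans (Agree.setTmp _ _ le_rfl) le_rfl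
    refine ⟨by rw [g6.mem, m5, g4.mem, m3, g2.mem, g1.mem], fun r hr => ?_⟩
    rw [g6.reg r hr]
    by_cases hx : r = rv x
    · rw [hx, r5x, hσ.v]
    · rw [r5' r hx (hr _ (by omega)), g4.reg r fun i hi => hr i (by omega),
        r3 r hx (hr _ (by omega)), g2.reg r fun i hi => hr i (by omega), g1.reg r hr]
  · simp [setReg_reg]

lemma codeSpec_fold (o : Bin) (x : ℕ) (b e₀ e : Expr) (hok : (Expr.fold o x b e₀ e).ok)
    (ihb : ∃ K, CodeSpec b K) (ih₀ : ∃ K, CodeSpec e₀ K) (ih : ∃ K, CodeSpec e K) :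
    ∃ K, CodeSpec (.fold o x b e₀ e) K := by
  have h := hok
  simp only [Expr.ok, Bool.and_eq_true] at h
  obtain ⟨⟨⟨⟨hbs, hbo⟩, h0o⟩, heo⟩, hx⟩ := h
  obtain ⟨Kb, hb⟩ := ihb
  obtain ⟨K₀, h₀⟩ := ih₀
  obtain ⟨K, hK⟩ := ih
  obtain ⟨Vb, vb⟩ := b.eval_bound hbo
  obtain ⟨V₀, v₀⟩ := e₀.eval_bound h0o
  obtain ⟨W, w⟩ := e.eval_bound heo
  set R := 2 + (V₀ + (1 + Vb) * W + (1 + Vb)) with hR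
  refine ⟨63 + (Kb + K₀ + (Vb + ((1 + Vb) * K + R))), fun P hP B hB s hs d σ hσ => ?_⟩
  apply (fun hh => hh : (∃ t σ', _ ∧ t ≤ P ^ _ ∧ _) → _)
  have two : ∀ {a b : ℕ}, a ≤ b → 2 ^ a ≤ 2 ^ b := fun h => Nat.pow_le_pow_right (by norm_num) h
  have q0 : P ≤ P ^ (1 + Vb) := by simpa using pow_mono hP (show 1 ≤ 1 + Vb by omega)
  set N := (b.eval s).toNat with hN
  have bb := vb P hP s hs
  have hNP : N ≤ P ^ Vb := by have := bb.2 hbs; omega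
  have q1 : P ^ Vb ≤ P ^ (1 + Vb) := pow_mono hP (by omega)
  set f := fun i : ℕ => e.eval (s.setv x i) with hf
  have good : ∀ i ≤ N, (s.setv x i).Good (P ^ (1 + Vb)) := fun i hi =>
    (hs.mono q0).setv_small (by simp; omega)
  have fb : ∀ i ≤ N, (f i).natAbs < 2 ^ P ^ ((1 + Vb) * W) := fun i hi => by
    have := (w _ (hP.trans q0) _ (good i hi)).1
    rwa [← pow_mul] at this
  have accb : ∀ i ≤ N, (foldVal o (e₀.eval s) f i).natAbs < 2 ^ P ^ R := fun i hi => by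
    have hpos : 1 ≤ 2 ^ P ^ ((1 + Vb) * W) := Nat.one_le_two_pow
    refine pow_bound_aux hP (v₀ P hP s hs).1 (Y := 2 ^ P ^ ((1 + Vb) * W) - 1) (by omega)
      ((hi.trans hNP).trans q1) ?_
    rw [Nat.sub_add_cancel hpos]
    exact foldVal_bound o _ _ _ _ (fun j hj => fb j (by omega)) _ hi
  set Q := P ^ R with hQ
  have hQ1 : 1 ≤ Q := Nat.one_le_pow _ _ (by omega)
  have q2 : P ^ (1 + Vb) ≤ Q := pow_mono hP (by omega)
  have q3 : P ^ ((1 + Vb) * W) ≤ Q := pow_mono hP (by omega)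
  have small : ∀ i : ℤ, i.natAbs ≤ P ^ (1 + Vb) → i.natAbs < 2 ^ Q := fun i hi =>
    (hi.trans q2).trans_lt Nat.lt_two_pow_self
  obtain ⟨t₁, σ₁, x1, ht1, g1, r1⟩ := hb P hP B hB s hs d σ hσ
  have rep1 := hσ.agree g1
  obtain ⟨t₂, σ₂, x2, ht2, g2, r2⟩ := h₀ P hP B hB s hs (d + 4) σ₁ rep1
  have rep2 := rep1.agree g2
  obtain ⟨t₃, x3, ht3⟩ := exec_mov (r := tmp (d + 2)) (a := rv x) (z := tmp (d + 3))
    (by simp only [tmp, rv]; omega) σ₂ hQ1 (by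
      rw [rep2.v]; exact (hs.v x).trans_le (two (q0.trans q2)))
  rw [rep2.v] at x3
  set σ₃ := (σ₂.setReg (tmp (d + 3)) 0).setReg (tmp (d + 2)) (s.v x) with hσ₃
  have g3 : Agree (d + 2) σ₂ σ₃ :=
    (Agree.setTmp _ _ (by omega)).trans (Agree.setTmp _ _ le_rfl) le_rfl
  have x4 := Exec.const σ₃ (tmp (d + 3)) 0
  set σ₄ := σ₃.setReg (tmp (d + 3)) 0 with hσ₄
  have g4 : Agree (d + 2) σ₃ σ₄ := Agree.setTmp _ _ (by omega)
  have g04 : Agree d σ σ₄ := ((g1.trans g2 (by omega)).trans g3 (by omega)).trans g4 (by omega)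
  -- The register of `x` is exempt from the invariant, since it runs through the loop indices; it is
  -- restored after the loop.
  let I : ℕ → State → Prop := fun i τ => τ.mem = σ.mem ∧
    (∀ r, r ≠ rv x → (∀ j, d ≤ j → r ≠ tmp j) → τ.reg r = σ.reg r) ∧
    τ.reg (tmp (d + 2)) = s.v x ∧ τ.reg (tmp (d + 3)) = i ∧
    τ.reg (tmp (d + 4)) = foldVal o (e₀.eval s) f i
  have I0 : I 0 σ₄ := by
    refine ⟨g04.mem, fun r _ hr => g04.reg r hr, ?_, ?_, ?_⟩
    · simp [hσ₄, hσ₃, setReg_reg]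
    · simp [hσ₄, setReg_reg]
    · simp [hσ₄, hσ₃, setReg_reg, r2]
  have hrd : σ₄.reg (tmp d) = b.eval s := by
    rw [(g3.trans g4 le_rfl).tmp (by omega), g2.tmp (by omega), r1]
  have step : ∀ i < N, ∀ τ, I i τ → τ.reg (tmp d) = b.eval s - i → ∃ t τ',
      Exec (.seq (mov (rv x) (tmp (d + 3)) (tmp (d + 5))) <|
        .seq (e.code (d + 5)) <| .seq (o.code (d + 4)) <| .seq (.const (tmp (d + 5)) 1) <|
        .seq (.arith .add (tmp (d + 3)) (tmp (d + 3)) (tmp (d + 5)))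
          (.arith .sub (tmp d) (tmp d) (tmp (d + 5)))) τ t τ' ∧
      t ≤ P ^ ((1 + Vb) * K) + 32 * Q ∧ I (i + 1) τ' ∧
      τ'.reg (tmp d) = b.eval s - (i + 1 : ℕ) := by
    rintro i hi τ ⟨im, ir, isv, iix, iacc⟩ hτ
    obtain ⟨s1, y1, hs1⟩ := exec_mov (r := rv x) (a := tmp (d + 3)) (z := tmp (d + 5))
      (by simp) τ hQ1 (by
        rw [iix]; exact small _ (by simp; omega))
    rw [iix] at y1
    set τ₁ := (τ.setReg (tmp (d + 5)) 0).setReg (rv x) (i : ℤ) with hτ₁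
    have u1 : ∀ r, r ≠ rv x → r ≠ tmp (d + 5) → τ₁.reg r = τ.reg r := fun r h h' => by
      simp only [hτ₁, setReg_reg, if_neg h, if_neg h']
    have rep : Rep B τ₁ (s.setv x i) := by
      refine ⟨?_, fun y => ?_, fun k j => ?_⟩
      · rw [u1 _ (by simp [rv]) (by simp), ir _ (by simp [rv]) (by simp), hσ.base]
      · rcases eq_or_ne y x with rfl | hy
        · simp [hτ₁, setReg_reg]
        · rw [Env.setv_v_of_ne _ _ hy, u1 _ (by simpa [rv] using hy) (by simp only [tmp, rv]; omega),
            ir _ (by simpa [rv] using hy) (by intro j _; simp only [tmp, rv]; omega), hσ.v]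
      · change τ.mem _ = _
        rw [im, hσ.a]; rfl
    obtain ⟨s2, τ₂, y2, hs2, k2, l2⟩ := hK _ (hP.trans q0) B (hB.trans_le (two q0)) _ (good i hi.le)
      (d + 5) τ₁ rep
    have m1 : τ₁.mem = τ.mem := rfl
    have acc2 : τ₂.reg (tmp (d + 4)) = foldVal o (e₀.eval s) f i := by
      rw [k2.tmp (by omega), u1 _ (by simp only [tmp, rv]; omega) (by simp), iacc]
    have d2 : τ₂.reg (tmp d) = b.eval s - i := by
      rw [k2.tmp (by omega), u1 _ (by simp only [tmp, rv]; omega) (by simp), hτ]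
    have d23 : τ₂.reg (tmp (d + 3)) = i := by
      rw [k2.tmp (by omega), u1 _ (by simp only [tmp, rv]; omega) (by simp), iix]
    have d22 : τ₂.reg (tmp (d + 2)) = s.v x := by
      rw [k2.tmp (by omega), u1 _ (by simp only [tmp, rv]; omega) (by simp), isv]
    clear_value τ₁
    obtain ⟨s3, τ₃, y3, hs3, k3, l3⟩ := exec_bin o (d + 4) τ₂ hQ1 (by rw [acc2]; exact accb i hi.le)
      (by rw [l2]; exact (fb i hi.le).trans_le (two q3))
    rw [acc2, l2] at l3
    have y4 := Exec.const τ₃ (tmp (d + 5)) 1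
    have y5 := Exec.arith (τ₃.setReg (tmp (d + 5)) 1) .add (tmp (d + 3)) (tmp (d + 3)) (tmp (d + 5))
    have e33 : τ₃.reg (tmp (d + 3)) = i := by rw [k3.tmp (by omega), d23]
    have e3d : τ₃.reg (tmp d) = b.eval s - i := by rw [k3.tmp (by omega), d2]
    simp only [setReg_reg, Op.eval] at y5
    rw [if_neg (by simp), if_pos trivial, e33] at y5
    have y6 := Exec.arith ((τ₃.setReg (tmp (d + 5)) 1).setReg (tmp (d + 3)) (i + 1)) .sub (tmp d)
      (tmp d) (tmp (d + 5))
    simp only [setReg_reg, Op.eval] at y6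
    rw [if_neg (by simp), if_neg (by simp), if_neg (by simp), if_pos trivial, e3d] at y6
    refine ⟨_, _, .seq y1 (.seq y2 (.seq y3 (.seq y4 (.seq y5 y6)))), ?_,
      ⟨?_, fun r h1 h2 => ?_, ?_, ?_, ?_⟩, ?_⟩
    · rw [← pow_mul] at hs2
      have c1 : bitLen 1 ≤ Q := bitLen_le hQ1 (small 1 (by simpa using Nat.one_le_pow _ _ (by omega)))
      have c2 : bitLen (i : ℤ) ≤ Q := bitLen_le hQ1 (small _ (by simp; omega))
      have c3 : bitLen (b.eval s - i) ≤ Q := bitLen_le hQ1 (small _ (by omega))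
      omega
    · simp only [setReg_mem]
      rw [k3.mem, k2.mem, m1, im]
    · simp only [setReg_reg]
      rw [if_neg (h2 _ le_rfl), if_neg (h2 _ (by omega)), if_neg (h2 _ (by omega)),
        k3.reg r fun j hj => h2 j (by omega), k2.reg r fun j hj => h2 j (by omega),
        u1 r h1 (h2 _ (by omega)), ir r h1 h2]
    · simp only [setReg_reg]
      rw [if_neg (by simp), if_neg (by simp), if_neg (by simp), k3.tmp (by omega), d22]
    · simp only [setReg_reg]
      rw [if_neg (by simp), if_pos trivial]; push_cast; ring
    · simp only [setReg_reg]
      rw [if_neg (by simp), if_neg (by simp), if_neg (by simp), l3, foldVal_succ]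
    · simp only [setReg_reg]
      rw [if_pos trivial]; push_cast; ring
  obtain ⟨t₅, σ₅, x5, ht5, ⟨jm, jr, jsv, -, jacc⟩, -⟩ : ∃ t τ, _ ∧ _ ∧ I N τ ∧ True := by
    obtain ⟨t, τ, h1, h2, h3⟩ := exec_while (tmp d) _ _ Q (b.eval s) I hQ1
      (small _ ((bb.2 hbs).trans q1)) step σ₄ I0 hrd
    exact ⟨t, τ, h1, h2, h3, trivial⟩
  obtain ⟨t₆, x6, ht6⟩ := exec_mov (r := rv x) (a := tmp (d + 2)) (z := tmp (d + 5))
    (by simp) σ₅ hQ1 (by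
      rw [jsv]; exact (hs.v x).trans_le (two (q0.trans q2)))
  rw [jsv] at x6
  set σ₆ := (σ₅.setReg (tmp (d + 5)) 0).setReg (rv x) (s.v x) with hσ₆
  have acc6 : σ₆.reg (tmp (d + 4)) = foldVal o (e₀.eval s) f N := by
    have : tmp (d + 4) ≠ rv x := by simp only [tmp, rv]; omega
    simp only [hσ₆, setReg_reg, if_neg this]
    rw [if_neg (by simp), jacc]
  obtain ⟨t₇, x7, ht7⟩ := exec_mov (r := tmp d) (a := tmp (d + 4)) (z := tmp (d + 5))
    (by simp) σ₆ hQ1 (by rw [acc6]; exact accb N le_rfl)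
  refine ⟨_, _, .seq x1 (.seq x2 (.seq x3 (.seq x4 (.seq x5 (.seq x6 x7))))), ?_, ?_, ?_⟩
  · apply le_pow_of_le_mul hP
    have c1 : bitLen 0 ≤ Q := bitLen_le hQ1 (by positivity)
    set Z := P ^ (Kb + K₀ + (Vb + ((1 + Vb) * K + R))) with hZ
    have z1 : P ^ Kb ≤ Z := pow_mono hP (by omega)
    have z2 : P ^ K₀ ≤ Z := pow_mono hP (by omega)
    have z3 : Q ≤ Z := pow_mono hP (by omega)
    have z4 : N * (P ^ ((1 + Vb) * K) + 32 * Q + Q) ≤ 34 * Z := by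
      calc _ ≤ P ^ Vb * (34 * P ^ ((1 + Vb) * K + R)) := by
            refine Nat.mul_le_mul hNP ?_
            have := pow_mono hP (show (1 + Vb) * K ≤ (1 + Vb) * K + R by omega)
            have := pow_mono hP (show R ≤ (1 + Vb) * K + R by omega)
            omega
        _ = 34 * P ^ (Vb + ((1 + Vb) * K + R)) := by rw [pow_add]; ring
        _ ≤ _ := Nat.mul_le_mul_left _ (pow_mono hP (by omega))
    rw [← hN] at ht5
    omega
  · refine ⟨by simp only [setReg_mem, hσ₆]; exact jm, fun r hr => ?_⟩
    simp only [setReg_reg]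
    rw [if_neg (hr _ le_rfl), if_neg (hr _ (by omega))]
    by_cases hx : r = rv x
    · rw [hx, hσ.v]; simp [hσ₆, setReg_reg]
    · simp only [hσ₆, setReg_reg]
      rw [if_neg hx, if_neg (hr _ (by omega)), jr r hx hr]
  · simp only [setReg_reg]
    rw [if_pos trivial, acc6, eval_fold]

theorem Expr.code_spec (e : Expr) : e.ok → ∃ K, CodeSpec e K := by
  induction e with
  | const c =>
    intro _
    refine ⟨bitLen c, fun P hP B hB s hs d σ hσ => ?_⟩
    refine ⟨_, _, .const _ _ _, le_pow_self hP _, Agree.setTmp _ _ le_rfl, ?_⟩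
    simp [setReg_reg, Expr.eval]
  | var x =>
    intro _
    refine ⟨3 + 1, fun P hP B hB s hs d σ hσ => ?_⟩
    obtain ⟨t, h, ht⟩ := exec_mov (r := tmp d) (a := rv x) (z := tmp d)
      (by simp only [tmp, rv]; omega) σ (b := P) (by omega) (by rw [hσ.v]; exact hs.v x)
    exact ⟨t, _, h, le_pow_of_le_mul hP (by simpa using ht),
      (Agree.setTmp _ _ le_rfl).trans (Agree.setTmp _ _ le_rfl) le_rfl,
      by simp [setReg_reg, Expr.eval, ← hσ.v]⟩
  | bin o e₁ e₂ ih₁ ih₂ =>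
    intro h
    simp only [Expr.ok, Bool.and_eq_true] at h
    obtain ⟨K₁, h₁⟩ := ih₁ h.1
    obtain ⟨K₂, h₂⟩ := ih₂ h.2
    obtain ⟨V₁, v₁⟩ := e₁.eval_bound h.1
    obtain ⟨V₂, v₂⟩ := e₂.eval_bound h.2
    refine ⟨26 + (K₁ + K₂ + (V₁ + V₂)), fun P hP B hB s hs d σ hσ => ?_⟩
    apply (fun hh => hh : (∃ t σ', _ ∧ t ≤ P ^ _ ∧ _) → _)
    obtain ⟨t₁, σ₁, x1, ht1, g1, r1⟩ := h₁ P hP B hB s hs d σ hσ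
    obtain ⟨t₂, σ₂, x2, ht2, g2, r2⟩ := h₂ P hP B hB s hs (d + 1) σ₁ (hσ.agree g1)
    have r1' : σ₂.reg (tmp d) = e₁.eval s := by rw [g2.tmp (by omega), r1]
    obtain ⟨t₃, σ₃, x3, ht3, g3, r3⟩ := exec_bin o d σ₂ (b := P ^ (V₁ + V₂))
      (Nat.one_le_pow _ _ (by omega))
      (by rw [r1']; exact ((v₁ P hP s hs).1).trans_le
            (Nat.pow_le_pow_right (by norm_num) (pow_mono hP (by omega))))
      (by rw [r2]; exact ((v₂ P hP s hs).1).trans_le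
            (Nat.pow_le_pow_right (by norm_num) (pow_mono hP (by omega))))
    rw [r1', r2] at r3
    refine ⟨_, σ₃, .seq x1 (.seq x2 x3), le_pow_of_le_mul hP ?_,
      (g1.trans g2 (by omega)).trans g3 le_rfl, r3⟩
    have z1 : P ^ K₁ ≤ P ^ (K₁ + K₂ + (V₁ + V₂)) := pow_mono hP (by omega)
    have z2 : P ^ K₂ ≤ P ^ (K₁ + K₂ + (V₁ + V₂)) := pow_mono hP (by omega)
    have z3 : P ^ (V₁ + V₂) ≤ P ^ (K₁ + K₂ + (V₁ + V₂)) := pow_mono hP (by omega)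
    have z4 : 1 ≤ P ^ (V₁ + V₂) := Nat.one_le_pow _ _ (by omega)
    omega
  | get i e ih =>
    intro h
    obtain ⟨K, hK⟩ := ih h
    obtain ⟨V, v⟩ := e.eval_bound h
    refine ⟨190 + (1 + K + V), fun P hP B hB s hs d σ hσ => ?_⟩
    apply (fun hh => hh : (∃ t σ', _ ∧ t ≤ P ^ _ ∧ _) → _)
    obtain ⟨t₁, σ₁, x1, ht1, g1, r1⟩ := hK P hP B hB s hs d σ hσ
    have rep1 := hσ.agree g1
    have two : ∀ {a b : ℕ}, a ≤ b → 2 ^ a ≤ 2 ^ b := fun h => Nat.pow_le_pow_right (by norm_num) h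
    set Q := P ^ (1 + K + V) with hQ
    have z1 : P ^ K ≤ Q := pow_mono hP (by omega)
    have z2 : P ≤ Q := by simpa using pow_mono hP (show 1 ≤ 1 + K + V by omega)
    have z3 : P ^ V ≤ Q := pow_mono hP (by omega)
    obtain ⟨t₂, σ₂, x2, ht2, g2, r2, q2⟩ := exec_addr i d σ₁ (b := Q) rep1.base (by omega)
      (hB.trans_le (two z2)) (by rw [r1]; exact ((v P hP s hs).1).trans_le (two z3))
    rw [r1] at r2 q2
    have rep2 := rep1.agree g2
    have x3 := Exec.load σ₂ (tmp d) (tmp d)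
    rw [r2, Int.toNat_natCast, rep2.a] at x3
    refine ⟨_, _, .seq x1 (.seq x2 x3), le_pow_of_le_mul hP ?_,
      (g1.trans g2 le_rfl).trans (Agree.setTmp _ _ le_rfl) le_rfl, ?_⟩
    · have c1 : bitLen ((B + 16 * (e.eval s).toNat + i : ℕ) : ℤ) ≤ Q + 6 :=
        bitLen_le (by omega) (by rwa [Int.natAbs_natCast])
      have c2 : bitLen (s.a i (e.eval s).toNat) ≤ Q := bitLen_le (by omega)
        ((hs.a _ _).trans_le (two z2))
      omega
    · simp [setReg_reg, Expr.eval]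
  | ifp c e₁ e₂ ihc ih₁ ih₂ =>
    intro h
    simp only [Expr.ok, Bool.and_eq_true] at h
    obtain ⟨K, hK⟩ := ihc h.1.1
    obtain ⟨K₁, h₁⟩ := ih₁ h.1.2
    obtain ⟨K₂, h₂⟩ := ih₂ h.2
    obtain ⟨V, v⟩ := c.eval_bound h.1.1
    refine ⟨3 + (K + K₁ + K₂ + V), fun P hP B hB s hs d σ hσ => ?_⟩
    apply (fun hh => hh : (∃ t σ', _ ∧ t ≤ P ^ _ ∧ _) → _)
    obtain ⟨t₀, σ₀, x0, ht0, g0, r0⟩ := hK P hP B hB s hs d σ hσ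
    have z0 : P ^ K ≤ P ^ (K + K₁ + K₂ + V) := pow_mono hP (by omega)
    have z1 : P ^ K₁ ≤ P ^ (K + K₁ + K₂ + V) := pow_mono hP (by omega)
    have z2 : P ^ K₂ ≤ P ^ (K + K₁ + K₂ + V) := pow_mono hP (by omega)
    have z3 : P ^ V ≤ P ^ (K + K₁ + K₂ + V) := pow_mono hP (by omega)
    have c0 : bitLen (σ₀.reg (tmp d)) ≤ P ^ V := by
      rw [r0]; exact bitLen_le (Nat.one_le_pow _ _ (by omega)) (v P hP s hs).1
    by_cases hc : 0 < c.eval s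
    · obtain ⟨t₁, σ₁, x1, ht1, g1, r1⟩ := h₁ P hP B hB s hs d σ₀ (hσ.agree g0)
      refine ⟨_, _, .seq x0 (.ifPos (by rwa [r0]) x1), le_pow_of_le_mul hP (by omega),
        g0.trans g1 le_rfl, by simp [Expr.eval, hc, r1]⟩
    · obtain ⟨t₁, σ₁, x1, ht1, g1, r1⟩ := h₂ P hP B hB s hs d σ₀ (hσ.agree g0)
      refine ⟨_, _, .seq x0 (.ifNonpos (by rw [r0]; omega) x1), le_pow_of_le_mul hP (by omega),
        g0.trans g1 le_rfl, by simp [Expr.eval, hc, r1]⟩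
  | letE x e₁ e₂ ih₁ ih₂ =>
    intro h
    have h' := h
    simp only [Expr.ok, Bool.and_eq_true] at h'
    exact codeSpec_letE x e₁ e₂ h (ih₁ h'.1.1) (ih₂ h'.1.2)
  | fold o x b e₀ e ihb ih₀ ih =>
    intro h
    have h' := h
    simp only [Expr.ok, Bool.and_eq_true] at h'
    exact codeSpec_fold o x b e₀ e h (ihb h'.1.1.1.2) (ih₀ h'.1.1.2) (ih h'.1.2)

end Lang

/-! ### A language of commands -/

namespace Lang

open RAM

/-- Commands over the variables and arrays of an environment. -/
inductive Cmd
  | assign (x : ℕ) (e : Expr)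
  | store (i : Fin 16) (e₁ e₂ : Expr)
  | seq (c₁ c₂ : Cmd)
  | loop (x : ℕ) (b : Expr) (c : Cmd)

/-- The effect of a command. -/
def Cmd.run : Cmd → Env → Env
  | .assign x e, s => s.setv x (e.eval s)
  | .store i e₁ e₂, s =>
      s.seta i (Function.update (s.a i) (e₁.eval s).toNat (e₂.eval s))
  | .seq c₁ c₂, s => c₂.run (c₁.run s)
  | .loop x b c, s => Nat.rec s (fun i s' => c.run (s'.setv x i)) (b.eval s).toNat

/-- The environment after `i` rounds of a loop. -/
def iter (x : ℕ) (f : Env → Env) (s : Env) (i : ℕ) : Env :=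
  Nat.rec s (fun i s' => f (s'.setv x i)) i

/-- The number of elementary steps of a command. -/
def Cmd.steps : Cmd → Env → ℕ
  | .assign _ _, _ => 1
  | .store _ _ _, _ => 1
  | .seq c₁ c₂, s => c₁.steps s + c₂.steps (c₁.run s)
  | .loop x b c, s =>
      1 + ∑ i ∈ Finset.range (b.eval s).toNat, (1 + c.steps ((iter x c.run s i).setv x i))

/-- All environments met on the way are good. -/
def Cmd.safe (P : ℕ) : Cmd → Env → Prop
  | .assign _ _, s => s.Good P
  | .store _ _ _, s => s.Good P
  | .seq c₁ c₂, s => c₁.safe P s ∧ c₂.safe P (c₁.run s)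
  | .loop x b c, s =>
      s.Good P ∧ ∀ i < (b.eval s).toNat, c.safe P ((iter x c.run s i).setv x i)

/-- Commands whose expressions have polynomially bounded loops. -/
def Cmd.ok : Cmd → Bool
  | .assign _ e => e.ok
  | .store _ e₁ e₂ => e₁.ok && e₂.ok
  | .seq c₁ c₂ => c₁.ok && c₂.ok
  | .loop _ b c => b.ok && c.ok

/-- The machine program of a command. -/
def Cmd.code : Cmd → ℕ → Program
  | .assign x e, d => .seq (e.code d) (mov (rv x) (tmp d) (tmp (d + 1)))
  | .store i e₁ e₂, d =>
      .seq (e₂.code d) <| .seq (e₁.code (d + 1)) <| .seq (addrCode i (d + 1))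
        (.store (tmp (d + 1)) (tmp d))
  | .seq c₁ c₂, d => .seq (c₁.code d) (c₂.code d)
  | .loop x b c, d =>
      .seq (b.code d) <| .seq (.const (tmp (d + 1)) 0) <|
      .whilePos (tmp d) <|
        .seq (mov (rv x) (tmp (d + 1)) (tmp (d + 2))) <|
        .seq (c.code (d + 2)) <| .seq (.const (tmp (d + 2)) 1) <|
        .seq (.arith .add (tmp (d + 1)) (tmp (d + 1)) (tmp (d + 2)))
          (.arith .sub (tmp d) (tmp d) (tmp (d + 2)))

/-- `P ^ K` bounds the running time of one step of `c`. -/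
def CmdSpec (c : Cmd) (K : ℕ) : Prop :=
  ∀ P, 2 ≤ P → ∀ B < 2 ^ P, ∀ s : Env, c.safe P s → ∀ d σ, Rep B σ s →
    ∃ t σ', Exec (c.code d) σ t σ' ∧ t ≤ P ^ K * c.steps s ∧ Rep B σ' (c.run s) ∧
      ∀ i < d, σ'.reg (tmp i) = σ.reg (tmp i)

lemma run_loop (x : ℕ) (b : Expr) (c : Cmd) (s : Env) :
    (Cmd.loop x b c).run s = iter x c.run s (b.eval s).toNat := rfl

lemma Rep.setMem {B : ℕ} {σ : State} {s : Env} (h : Rep B σ s) (i : Fin 16) (j : ℕ) (z : ℤ) :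
    Rep B (σ.setMem (B + 16 * j + i) z) (s.seta i (Function.update (s.a i) j z)) where
  base := h.base
  v := h.v
  a i' j' := by
    have h1 := i.isLt
    have h2 := i'.isLt
    simp only [State.setMem, Env.seta, Function.update_apply]
    by_cases hi : i' = i
    · subst hi
      by_cases hj : j' = j
      · simp [hj]
      · rw [if_neg (by omega), if_pos rfl, Function.update_of_ne hj, h.a]
    · have : (i' : ℕ) ≠ i := fun h => hi (Fin.ext h)
      rw [if_neg (by omega), if_neg hi, h.a]

/-- Expressions are evaluated in time polynomial in `P`, whereas loops of commands may have
exponentially many rounds. Hence the time is measured as `P ^ K` per elementary step, and loop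
overhead is paid for by the additional step counted in every round. -/
theorem Cmd.code_spec (c : Cmd) : c.ok → ∃ K, CmdSpec c K := by
  have two : ∀ {a b : ℕ}, a ≤ b → 2 ^ a ≤ 2 ^ b := fun h => Nat.pow_le_pow_right (by norm_num) h
  induction c with
  | assign x e =>
    intro hok
    obtain ⟨K, hK⟩ := e.code_spec hok
    obtain ⟨V, hV⟩ := e.eval_bound hok
    refine ⟨4 + (K + V), fun P hP B hB s hs d σ hσ => ?_⟩
    apply (fun hh => hh : (∃ t σ', _ ∧ t ≤ P ^ _ * _ ∧ _) → _)
    obtain ⟨t₁, σ₁, x1, ht1, g1, r1⟩ := hK P hP B hB s hs d σ hσ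
    have rep1 := hσ.agree g1
    obtain ⟨t₂, x2, ht2⟩ := exec_mov (r := rv x) (a := tmp d) (z := tmp (d + 1)) (by simp) σ₁
      (b := P ^ V) (Nat.one_le_pow _ _ (by omega)) (by rw [r1]; exact (hV P hP s hs).1)
    rw [r1] at x2
    refine ⟨_, _, .seq x1 x2, ?_, ?_, ?_⟩
    · rw [show (Cmd.assign x e).steps s = 1 from rfl, mul_one]
      apply le_pow_of_le_mul hP
      have z1 : P ^ K ≤ P ^ (K + V) := pow_mono hP (by omega)
      have z2 : P ^ V ≤ P ^ (K + V) := pow_mono hP (by omega)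
      omega
    · exact (rep1.agree (Agree.setTmp (d := d + 1) _ _ le_rfl)).setReg_rv x _
    · intro i hi
      simp only [setReg_reg]
      rw [if_neg (by simp only [tmp, rv]; omega), if_neg (by simp; omega), g1.tmp hi]
  | store i e₁ e₂ =>
    intro hok
    simp only [Cmd.ok, Bool.and_eq_true] at hok
    obtain ⟨K₁, h₁⟩ := e₁.code_spec hok.1
    obtain ⟨V₁, v₁⟩ := e₁.eval_bound hok.1
    obtain ⟨K₂, h₂⟩ := e₂.code_spec hok.2
    obtain ⟨V₂, v₂⟩ := e₂.eval_bound hok.2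
    refine ⟨200 + (1 + K₁ + K₂ + V₁ + V₂), fun P hP B hB s hs d σ hσ => ?_⟩
    apply (fun hh => hh : (∃ t σ', _ ∧ t ≤ P ^ _ * _ ∧ _) → _)
    set Q := P ^ (1 + K₁ + K₂ + V₁ + V₂) with hQ
    have z1 : P ^ K₁ ≤ Q := pow_mono hP (by omega)
    have z2 : P ^ K₂ ≤ Q := pow_mono hP (by omega)
    have z3 : P ^ V₁ ≤ Q := pow_mono hP (by omega)
    have z4 : P ^ V₂ ≤ Q := pow_mono hP (by omega)
    have z5 : P ≤ Q := by simpa using pow_mono hP (show 1 ≤ 1 + K₁ + K₂ + V₁ + V₂ by omega)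
    obtain ⟨t₁, σ₁, x1, ht1, g1, r1⟩ := h₂ P hP B hB s hs d σ hσ
    have rep1 := hσ.agree g1
    obtain ⟨t₂, σ₂, x2, ht2, g2, r2⟩ := h₁ P hP B hB s hs (d + 1) σ₁ rep1
    have rep2 := rep1.agree g2
    obtain ⟨t₃, σ₃, x3, ht3, g3, r3, q3⟩ := exec_addr i (d + 1) σ₂ (b := Q) rep2.base (by omega)
      (hB.trans_le (two z5)) (by rw [r2]; exact ((v₁ P hP s hs).1).trans_le (two z3))
    rw [r2] at r3 q3
    have rep3 := rep2.agree g3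
    have x4 := Exec.store σ₃ (tmp (d + 1)) (tmp d)
    have r4 : σ₃.reg (tmp d) = e₂.eval s := by rw [g3.tmp (by omega), g2.tmp (by omega), r1]
    rw [r3, r4, Int.toNat_natCast] at x4
    refine ⟨_, _, .seq x1 (.seq x2 (.seq x3 x4)), ?_, rep3.setMem _ _ _, ?_⟩
    · rw [show (Cmd.store i e₁ e₂).steps s = 1 from rfl, mul_one]
      apply le_pow_of_le_mul hP
      have c1 : bitLen ((B + 16 * (e₁.eval s).toNat + i : ℕ) : ℤ) ≤ Q + 6 :=
        bitLen_le (by omega) (by rwa [Int.natAbs_natCast])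
      have c2 : bitLen (e₂.eval s) ≤ Q := bitLen_le (by omega)
        (((v₂ P hP s hs).1).trans_le (two z4))
      omega
    · intro j hj
      change σ₃.reg _ = _
      rw [g3.tmp (by omega), g2.tmp (by omega), g1.tmp hj]
  | seq c₁ c₂ ih₁ ih₂ =>
    intro hok
    simp only [Cmd.ok, Bool.and_eq_true] at hok
    obtain ⟨K₁, h₁⟩ := ih₁ hok.1
    obtain ⟨K₂, h₂⟩ := ih₂ hok.2
    refine ⟨K₁ + K₂, fun P hP B hB s hs d σ hσ => ?_⟩
    obtain ⟨t₁, σ₁, x1, ht1, rep1, f1⟩ := h₁ P hP B hB s hs.1 d σ hσ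
    obtain ⟨t₂, σ₂, x2, ht2, rep2, f2⟩ := h₂ P hP B hB _ hs.2 d σ₁ rep1
    refine ⟨_, _, .seq x1 x2, ?_, rep2, fun i hi => (f2 i hi).trans (f1 i hi)⟩
    change _ ≤ _ * (c₁.steps s + c₂.steps (c₁.run s))
    rw [mul_add]
    exact Nat.add_le_add (ht1.trans (Nat.mul_le_mul_right _ (pow_mono hP (by omega))))
      (ht2.trans (Nat.mul_le_mul_right _ (pow_mono hP (by omega))))
  | loop x b c ih =>
    intro hok
    simp only [Cmd.ok, Bool.and_eq_true] at hok
    obtain ⟨Kb, hb⟩ := b.code_spec hok.1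
    obtain ⟨Vb, vb⟩ := b.eval_bound hok.1
    obtain ⟨K, hK⟩ := ih hok.2
    refine ⟨20 + (Kb + Vb + K), fun P hP B hB s hs d σ hσ => ?_⟩
    apply (fun hh => hh : (∃ t σ', _ ∧ t ≤ P ^ _ * _ ∧ _) → _)
    set Q := P ^ Vb with hQ
    have hQ1 : 1 ≤ Q := Nat.one_le_pow _ _ (by omega)
    have hbv := (vb P hP s hs.1).1
    obtain ⟨t₁, σ₁, x1, ht1, g1, r1⟩ := hb P hP B hB s hs.1 d σ hσ
    have g2 : Agree (d + 1) σ₁ (σ₁.setReg (tmp (d + 1)) 0) := Agree.setTmp _ _ le_rfl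
    have rep2 := (hσ.agree g1).agree g2
    let I : ℕ → State → Prop := fun i τ => Rep B τ (iter x c.run s i) ∧
      (∀ j < d, τ.reg (tmp j) = σ.reg (tmp j)) ∧ τ.reg (tmp (d + 1)) = i
    have I0 : I 0 (σ₁.setReg (tmp (d + 1)) 0) :=
      ⟨rep2, fun j hj => by rw [g2.tmp (by omega), g1.tmp hj], by simp [setReg_reg]⟩
    have step : ∀ i < (b.eval s).toNat, ∀ τ, I i τ → τ.reg (tmp d) = b.eval s - i → ∃ t τ',
        Exec (.seq (mov (rv x) (tmp (d + 1)) (tmp (d + 2))) <|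
          .seq (c.code (d + 2)) <| .seq (.const (tmp (d + 2)) 1) <|
          .seq (.arith .add (tmp (d + 1)) (tmp (d + 1)) (tmp (d + 2)))
            (.arith .sub (tmp d) (tmp d) (tmp (d + 2)))) τ t τ' ∧
        t ≤ P ^ K * c.steps ((iter x c.run s i).setv x i) + 8 * Q ∧ I (i + 1) τ' ∧
        τ'.reg (tmp d) = b.eval s - (i + 1 : ℕ) := by
      rintro i hi τ ⟨irep, ir, iix⟩ hτ
      obtain ⟨s1, y1, hs1⟩ := exec_mov (r := rv x) (a := tmp (d + 1)) (z := tmp (d + 2))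
        (by simp) τ hQ1 (by rw [iix]; exact lt_of_le_of_lt (by omega) hbv)
      rw [iix] at y1
      have rep1 := (irep.agree (Agree.setTmp (d := d + 1) τ 0 (show d + 1 ≤ d + 2 by omega))).setReg_rv
        x i
      set τ₁ := (τ.setReg (tmp (d + 2)) 0).setReg (rv x) (i : ℤ) with hτ₁
      have u1 : ∀ r, r ≠ rv x → r ≠ tmp (d + 2) → τ₁.reg r = τ.reg r := fun r h h' => by
        simp only [hτ₁, setReg_reg, if_neg h, if_neg h']
      have u2 : ∀ j < d + 2, τ₁.reg (tmp j) = τ.reg (tmp j) := fun j hj =>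
        u1 _ (by simp only [tmp, rv]; omega) (by simp; omega)
      clear_value τ₁
      obtain ⟨s2, τ₂, y2, hs2, rep2, f2⟩ := hK P hP B hB _ (hs.2 i hi) (d + 2) τ₁ rep1
      have y3 := Exec.const τ₂ (tmp (d + 2)) 1
      have y4 := Exec.arith (τ₂.setReg (tmp (d + 2)) 1) .add (tmp (d + 1)) (tmp (d + 1))
        (tmp (d + 2))
      have e21 : τ₂.reg (tmp (d + 1)) = i := by rw [f2 _ (by omega), u2 _ (by omega), iix]
      have e2d : τ₂.reg (tmp d) = b.eval s - i := by rw [f2 _ (by omega), u2 _ (by omega), hτ]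
      simp only [setReg_reg, Op.eval] at y4
      rw [if_neg (by simp), if_pos trivial, e21] at y4
      have y5 := Exec.arith ((τ₂.setReg (tmp (d + 2)) 1).setReg (tmp (d + 1)) (i + 1)) .sub (tmp d)
        (tmp d) (tmp (d + 2))
      simp only [setReg_reg, Op.eval] at y5
      rw [if_neg (by simp), if_neg (by simp), if_neg (by simp), if_pos trivial, e2d] at y5
      have g5 : Agree d τ₂ (((τ₂.setReg (tmp (d + 2)) 1).setReg (tmp (d + 1)) (i + 1)).setReg
          (tmp d) (b.eval s - i - 1)) :=
        ((Agree.setTmp _ _ (by omega)).trans (Agree.setTmp _ _ (by omega)) le_rfl).trans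
          (Agree.setTmp _ _ le_rfl) le_rfl
      refine ⟨_, _, .seq y1 (.seq y2 (.seq y3 (.seq y4 y5))), ?_,
        ⟨rep2.agree g5, fun j hj => ?_, ?_⟩, ?_⟩
      · have c1 : bitLen 1 ≤ Q := bitLen_le hQ1 (by simpa using Nat.one_lt_two_pow (by omega))
        have c2 : bitLen (i : ℤ) ≤ Q := bitLen_le hQ1 (lt_of_le_of_lt (by omega) hbv)
        have c3 : bitLen (b.eval s - i) ≤ Q := bitLen_le hQ1 (lt_of_le_of_lt (by omega) hbv)
        omega
      · rw [g5.tmp hj, f2 _ (by omega), u2 _ (by omega), ir j hj]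
      · simp only [setReg_reg]
        rw [if_neg (by simp), if_pos trivial]; push_cast; ring
      · simp only [setReg_reg]
        rw [if_pos trivial]; push_cast; ring
    obtain ⟨t₅, σ₅, x5, ht5, ⟨jrep, jr, -⟩⟩ := exec_while_sum (tmp d) _ _ Q (b.eval s) I hQ1
      hbv step _ I0 (by rw [g2.tmp (by omega), r1])
    refine ⟨_, σ₅, .seq x1 (.seq (.const _ _ _) x5), ?_, jrep, jr⟩
    have c0 : bitLen 0 ≤ Q := bitLen_le hQ1 (by positivity)
    change _ ≤ _ * (1 + ∑ i ∈ Finset.range (b.eval s).toNat,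
      (1 + c.steps ((iter x c.run s i).setv x i)))
    have z0 : ∀ k, k ≤ Kb + Vb + K → 12 * P ^ k ≤ P ^ (20 + (Kb + Vb + K)) := fun k hk => by
      rw [pow_add]
      refine Nat.mul_le_mul ?_ (pow_mono hP hk)
      exact (show 12 ≤ 20 by omega).trans (le_pow_self hP 20)
    have z1 := z0 Kb (by omega)
    have z2 := z0 Vb (by omega)
    have z3 := z0 K (by omega)
    rw [← hQ] at z2
    have key : ∑ i ∈ Finset.range (b.eval s).toNat,
          (P ^ K * c.steps ((iter x c.run s i).setv x i) + 8 * Q + Q) ≤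
        P ^ (20 + (Kb + Vb + K)) * ∑ i ∈ Finset.range (b.eval s).toNat,
          (1 + c.steps ((iter x c.run s i).setv x i)) := by
      rw [Finset.mul_sum]
      refine Finset.sum_le_sum fun i _ => ?_
      rw [mul_add, mul_one]
      have := Nat.mul_le_mul_right (c.steps ((iter x c.run s i).setv x i))
        (show P ^ K ≤ P ^ (20 + (Kb + Vb + K)) by omega)
      omega
    rw [mul_add, mul_one]
    omega

/-! ### Rules for total correctness with time bounds -/

/-- From `s` the command `c` stays within good environments, takes at most `N` steps, and
establishes `Q`. -/
def Triple (P : ℕ) (c : Cmd) (s : Env) (N : ℕ) (Q : Env → Prop) : Prop :=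
  c.safe P s ∧ c.steps s ≤ N ∧ Q (c.run s)

lemma Triple.mono {P : ℕ} {c : Cmd} {s : Env} {N N' : ℕ} {Q Q' : Env → Prop}
    (h : Triple P c s N Q) (hN : N ≤ N') (hQ : ∀ s', Q s' → Q' s') : Triple P c s N' Q' :=
  ⟨h.1, h.2.1.trans hN, hQ _ h.2.2⟩

lemma Triple.assign {P : ℕ} {x : ℕ} {e : Expr} {s : Env} {Q : Env → Prop} (hs : s.Good P)
    (hQ : Q (s.setv x (e.eval s))) : Triple P (.assign x e) s 1 Q :=
  ⟨hs, le_rfl, hQ⟩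

lemma Triple.store {P : ℕ} {i : Fin 16} {e₁ e₂ : Expr} {s : Env} {Q : Env → Prop} (hs : s.Good P)
    (hQ : Q (s.seta i (Function.update (s.a i) (e₁.eval s).toNat (e₂.eval s)))) :
    Triple P (.store i e₁ e₂) s 1 Q :=
  ⟨hs, le_rfl, hQ⟩

lemma Triple.seq {P : ℕ} {c₁ c₂ : Cmd} {s : Env} {N₁ N₂ : ℕ} {R Q : Env → Prop}
    (h₁ : Triple P c₁ s N₁ R) (h₂ : ∀ s', R s' → Triple P c₂ s' N₂ Q) :
    Triple P (.seq c₁ c₂) s (N₁ + N₂) Q :=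
  have h := h₂ _ h₁.2.2
  ⟨⟨h₁.1, h.1⟩, Nat.add_le_add h₁.2.1 h.2.1, h.2.2⟩

lemma Triple.loop {P : ℕ} {x : ℕ} {b : Expr} {c : Cmd} {s : Env} {N M : ℕ} (I : ℕ → Env → Prop)
    (hs : s.Good P) (hN : (b.eval s).toNat = N) (h0 : I 0 s)
    (step : ∀ i < N, ∀ s', I i s' → Triple P c (s'.setv x i) M (I (i + 1))) :
    Triple P (.loop x b c) s (1 + N * (1 + M)) (I N) := by
  have key : ∀ i ≤ N, I i (iter x c.run s i) := by
    intro i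
    induction i with
    | zero => intro _; exact h0
    | succ i ih => intro hi; exact (step i (by omega) _ (ih (by omega))).2.2
  refine ⟨⟨hs, fun i hi => (step i (by omega) _ (key i (by omega))).1⟩, ?_, ?_⟩
  · simp only [Cmd.steps, hN]
    refine Nat.add_le_add_left ?_ 1
    calc _ ≤ ∑ i ∈ Finset.range N, (1 + M) := Finset.sum_le_sum fun i hi =>
          Nat.add_le_add_left (step i (Finset.mem_range.1 hi) _
            (key i (Finset.mem_range.1 hi).le)).2.1 1
      _ = _ := by simp
  · rw [run_loop, hN]
    exact key N le_rfl

end Lang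

/-! ### From commands to approximation algorithms -/

namespace Lang

open RAM

/-- The environment that holds the input: variable `0` is the number of vertices and array `0` the
input. -/
noncomputable def initEnv {n : ℕ} (G : SimpleGraph (Fin n)) : Env where
  v := fun x => if x = 0 then (n : ℤ) else 0
  a := fun i j => if i = 0 then (OLA.input G).mem j else 0

lemma input_mem_zero {n : ℕ} (G : SimpleGraph (Fin n)) : (OLA.input G).mem 0 = n := by
  simp [OLA.input]

open Classical in
lemma input_mem_adj {n : ℕ} (G : SimpleGraph (Fin n)) (u v : Fin n) :
    (OLA.input G).mem (1 + u * n + v) = if G.Adj u v then 1 else 0 := by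
  have h0 : 1 + (u : ℕ) * n + v ≠ 0 := by omega
  simp only [OLA.input, if_neg h0]
  congr 1
  apply propext
  constructor
  · rintro ⟨u', v', h, he⟩
    have e : (u : ℕ) * n + v = u' * n + v' := by omega
    have hn : 0 < n := Fin.pos u
    have hu : (u : ℕ) = u' := by
      have h1 : ∀ a b : Fin n, ((a : ℕ) * n + b) / n = a := fun a b => by
        rw [mul_comm, Nat.mul_add_div hn, Nat.div_eq_of_lt b.isLt, add_zero]
      rw [← h1 u v, e, h1]
    have hv : (v : ℕ) = v' := by rw [hu] at e; omega
    rwa [Fin.ext hu, Fin.ext hv]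
  · intro h
    exact ⟨u, v, h, rfl⟩

lemma input_mem_large {n : ℕ} (G : SimpleGraph (Fin n)) {a : ℕ} (ha : n * n < a) :
    (OLA.input G).mem a = 0 := by
  have h0 : a ≠ 0 := by omega
  simp only [OLA.input, if_neg h0]
  rw [if_neg]
  rintro ⟨u, v, -, rfl⟩
  have := u.isLt
  have := v.isLt
  have : (u : ℕ) * n + n ≤ n * n := by nlinarith
  omega

lemma input_mem_le {n : ℕ} (G : SimpleGraph (Fin n)) (a : ℕ) :
    ((OLA.input G).mem a).natAbs ≤ n + 1 := by
  simp only [OLA.input]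
  split_ifs <;> simp

/-- Sets up the array area and copies the input to array `0`. -/
def prelude : Program :=
  .seq (.load (rv 0) (tmp 0)) <| .seq (.arith .mul (tmp 0) (rv 0) (rv 0)) <|
  .seq (.const (tmp 1) 1) <| .seq (.arith .add (tmp 0) (tmp 0) (tmp 1)) <|
  .seq (mov 0 (tmp 0) (tmp 2)) <|
  .whilePos (tmp 0) <|
    .seq (.load (tmp 4) (tmp 3)) <| .seq (.const (tmp 2) 16) <|
    .seq (.arith .mul (tmp 5) (tmp 3) (tmp 2)) <| .seq (.arith .add (tmp 5) (tmp 5) 0) <|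
    .seq (.store (tmp 5) (tmp 4)) <| .seq (.arith .add (tmp 3) (tmp 3) (tmp 1))
      (.arith .sub (tmp 0) (tmp 0) (tmp 1))

/-- Copies the first cells of array `i` to the output cells. -/
def postlude (i : Fin 16) : Program :=
  .seq (.const (tmp 1) 1) <| .seq (mov (tmp 0) (rv 0) (tmp 2)) <| .seq (.const (tmp 3) 0) <|
  .whilePos (tmp 0) <|
    .seq (mov (tmp 5) (tmp 3) (tmp 2)) <| .seq (addrCode i 5) <| .seq (.load (tmp 4) (tmp 5)) <|
    .seq (.store (tmp 3) (tmp 4)) <| .seq (.const (tmp 1) 1) <|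
    .seq (.arith .add (tmp 3) (tmp 3) (tmp 1)) (.arith .sub (tmp 0) (tmp 0) (tmp 1))

lemma bitLen_le_of_le {z : ℤ} {b : ℕ} (hb : 1 ≤ b) (h : z.natAbs ≤ b) : bitLen z ≤ b :=
  bitLen_le hb (h.trans_lt Nat.lt_two_pow_self)

/-- The arrays start right behind the input cells, so copying never destroys input that is still to
be read. The index register `tmp 3` is not set by the program: it relies on registers being `0`
initially. The other arrays vanish because the memory behind the input does. -/
lemma exec_prelude {n : ℕ} (G : SimpleGraph (Fin n)) {b : ℕ} (hb : b = 17 * (n * n + 2)) :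
    ∃ t σ, Exec prelude (OLA.input G) t σ ∧ t ≤ 42 * b ^ 2 ∧ Rep (n * n + 1) σ (initEnv G) := by
  set B := n * n + 1 with hB
  have hnn : n ≤ n * n + 1 := by nlinarith
  have hb1 : 1 ≤ b := by omega
  have e1 := Exec.load (OLA.input G) (rv 0) (tmp 0)
  have r0 : ∀ r, (OLA.input G).reg r = 0 := fun r => rfl
  rw [r0, Int.toNat_zero, input_mem_zero] at e1
  set σ₁ := (OLA.input G).setReg (rv 0) n with h1
  have e2 := Exec.arith σ₁ .mul (tmp 0) (rv 0) (rv 0)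
  have f1 : σ₁.reg (rv 0) = n := by simp [h1, setReg_reg]
  rw [f1] at e2
  set σ₂ := σ₁.setReg (tmp 0) (Op.mul.eval n n) with h2
  have e3 := Exec.const σ₂ (tmp 1) 1
  set σ₃ := σ₂.setReg (tmp 1) 1 with h3
  have e4 := Exec.arith σ₃ .add (tmp 0) (tmp 0) (tmp 1)
  have f3 : σ₃.reg (tmp 0) = n * n := by simp [h3, h2, setReg_reg, Op.eval]
  have f3' : σ₃.reg (tmp 1) = 1 := by simp [h3, setReg_reg]
  rw [f3, f3'] at e4
  set σ₄ := σ₃.setReg (tmp 0) (Op.add.eval (n * n) 1) with h4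
  have f4 : σ₄.reg (tmp 0) = (B : ℕ) := by simp [h4, setReg_reg, Op.eval, hB]
  obtain ⟨t₅, e5, ht5⟩ := exec_mov (r := 0) (a := tmp 0) (z := tmp 2) (by simp) σ₄ hb1 (by
    rw [f4]; exact lt_of_le_of_lt (b := b) (by simp; omega) Nat.lt_two_pow_self)
  rw [f4] at e5
  set σ₅ := (σ₄.setReg (tmp 2) 0).setReg 0 (B : ℕ) with h5
  let I : ℕ → State → Prop := fun i τ => τ.reg 0 = (B : ℕ) ∧ τ.reg (tmp 1) = 1 ∧
    τ.reg (tmp 3) = i ∧ (∀ x, τ.reg (rv x) = if x = 0 then (n : ℤ) else 0) ∧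
    (∀ a < B, τ.mem a = (OLA.input G).mem a) ∧
    ∀ a, B ≤ a → τ.mem a =
      if (∃ j < i, a = B + 16 * j) then (OLA.input G).mem ((a - B) / 16) else 0
  have hreg5 : ∀ r, σ₅.reg r = if r = 0 then (B : ℤ) else if r = tmp 2 then 0 else
      if r = tmp 0 then (B : ℤ) else if r = tmp 1 then 1 else if r = rv 0 then (n : ℤ) else 0 := by
    intro r
    simp only [h5, h4, h3, h2, h1, setReg_reg, r0, Op.eval, hB]
    split_ifs <;> simp
  have I0 : I 0 σ₅ := by
    refine ⟨?_, ?_, ?_, fun x => ?_, fun a _ => rfl, fun a ha => ?_⟩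
    · simp [hreg5]
    · simp [hreg5]
    · norm_num [hreg5, tmp, rv]
    · rw [hreg5]
      simp only [rv, tmp]
      rw [if_neg (by omega), if_neg (by omega), if_neg (by omega), if_neg (by omega)]
      congr 1
      apply propext
      constructor <;> intro h <;> omega
    · rw [if_neg (by simp)]
      exact input_mem_large G (by omega)
  have step : ∀ i < ((B : ℕ) : ℤ).toNat, ∀ τ, I i τ → τ.reg (tmp 0) = (B : ℕ) - i → ∃ t τ',
      Exec (.seq (.load (tmp 4) (tmp 3)) <| .seq (.const (tmp 2) 16) <|
        .seq (.arith .mul (tmp 5) (tmp 3) (tmp 2)) <| .seq (.arith .add (tmp 5) (tmp 5) 0) <|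
        .seq (.store (tmp 5) (tmp 4)) <| .seq (.arith .add (tmp 3) (tmp 3) (tmp 1))
          (.arith .sub (tmp 0) (tmp 0) (tmp 1))) τ t τ' ∧ t ≤ 14 * b ∧ I (i + 1) τ' ∧
      τ'.reg (tmp 0) = (B : ℕ) - (i + 1 : ℕ) := by
    rintro i hi τ ⟨i0, i1, i3, ix, im, ia⟩ hτ
    have hiB : i < B := by omega
    have y1 := Exec.load τ (tmp 4) (tmp 3)
    rw [i3, Int.toNat_natCast, im i hiB] at y1
    set w := (OLA.input G).mem i with hw
    set τ₁ := τ.setReg (tmp 4) w with k1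
    have y2 := Exec.const τ₁ (tmp 2) 16
    set τ₂ := τ₁.setReg (tmp 2) 16 with k2
    have y3 := Exec.arith τ₂ .mul (tmp 5) (tmp 3) (tmp 2)
    have l3 : τ₂.reg (tmp 3) = i := by simp [k2, k1, setReg_reg, i3]
    have l3' : τ₂.reg (tmp 2) = 16 := by simp [k2, setReg_reg]
    rw [l3, l3'] at y3
    set τ₃ := τ₂.setReg (tmp 5) (Op.mul.eval i 16) with k3
    have y4 := Exec.arith τ₃ .add (tmp 5) (tmp 5) 0
    have l4 : τ₃.reg (tmp 5) = i * 16 := by simp [k3, setReg_reg, Op.eval]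
    have l4' : τ₃.reg 0 = (B : ℕ) := by simp [k3, k2, k1, setReg_reg, i0]
    rw [l4, l4'] at y4
    set τ₄ := τ₃.setReg (tmp 5) (Op.add.eval (i * 16) (B : ℕ)) with k4
    have y5 := Exec.store τ₄ (tmp 5) (tmp 4)
    have l5 : τ₄.reg (tmp 5) = ((B + 16 * i : ℕ) : ℤ) := by
      simp [k4, setReg_reg, Op.eval]; ring
    have l5' : τ₄.reg (tmp 4) = w := by simp [k4, k3, k2, k1, setReg_reg]
    rw [l5, l5', Int.toNat_natCast] at y5
    set τ₅ := τ₄.setMem (B + 16 * i) w with k5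
    have hr5 : ∀ r, τ₅.reg r = if r = tmp 5 then ((B + 16 * i : ℕ) : ℤ) else if r = tmp 2 then 16
        else if r = tmp 4 then w else τ.reg r := by
      intro r
      change τ₄.reg r = _
      by_cases hr : r = tmp 5
      · rw [hr, l5, if_pos rfl]
      · simp only [k4, k3, k2, k1, setReg_reg, if_neg hr]
    have y6 := Exec.arith τ₅ .add (tmp 3) (tmp 3) (tmp 1)
    have l6 : τ₅.reg (tmp 3) = i := by simp [hr5, i3]
    have l6' : τ₅.reg (tmp 1) = 1 := by simp [hr5, i1]
    rw [l6, l6'] at y6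
    set τ₆ := τ₅.setReg (tmp 3) (Op.add.eval i 1) with k6
    have y7 := Exec.arith τ₆ .sub (tmp 0) (tmp 0) (tmp 1)
    have l7 : τ₆.reg (tmp 0) = (B : ℕ) - i := by simp [k6, setReg_reg, hr5, hτ]
    have l7' : τ₆.reg (tmp 1) = 1 := by simp [k6, setReg_reg, hr5, i1]
    rw [l7, l7'] at y7
    have hwb := input_mem_le G i
    rw [← hw] at hwb
    refine ⟨_, _, .seq y1 (.seq y2 (.seq y3 (.seq y4 (.seq y5 (.seq y6 y7))))), ?_,
      ⟨?_, ?_, ?_, fun x => ?_, fun a ha => ?_, fun a ha => ?_⟩, ?_⟩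
    · have c1 : bitLen (i : ℤ) ≤ b := bitLen_le_of_le hb1 (by omega)
      have c2 : bitLen w ≤ b := bitLen_le_of_le hb1 (by omega)
      have c3 : bitLen 16 ≤ b := bitLen_le_of_le hb1 (by omega)
      have c4 : bitLen ((i : ℤ) * 16) ≤ b := bitLen_le_of_le hb1 (by omega)
      have c5 : bitLen (B : ℤ) ≤ b := bitLen_le_of_le hb1 (by omega)
      have c6 : bitLen ((B + 16 * i : ℕ) : ℤ) ≤ b := bitLen_le_of_le hb1 (by omega)
      have c7 : bitLen 1 ≤ b := bitLen_le_of_le hb1 (by omega)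
      have c8 : bitLen ((B : ℤ) - i) ≤ b := bitLen_le_of_le hb1 (by omega)
      omega
    · simp [setReg_reg, k6, hr5, i0]
    · simp [setReg_reg, k6, hr5, i1]
    · simp [setReg_reg, k6, Op.eval]
    · rw [← ix x]
      simp only [setReg_reg, k6, hr5]
      have h : ∀ j, rv x ≠ tmp j := fun j => by simp only [rv, tmp]; omega
      simp only [if_neg (h _)]
    · change τ₅.mem a = _
      simp only [k5, State.setMem, Function.update_apply]
      rw [if_neg (by omega)]
      exact im a ha
    · change τ₅.mem a = _
      simp only [k5, State.setMem, Function.update_apply]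
      by_cases hai : a = B + 16 * i
      · rw [if_pos hai, if_pos ⟨i, by omega, hai⟩, hw]
        congr 1
        omega
      · rw [if_neg hai]
        refine (ia a ha).trans ?_
        congr 1
        apply propext
        constructor
        · rintro ⟨j, hj, rfl⟩; exact ⟨j, by omega, rfl⟩
        · rintro ⟨j, hj, rfl⟩; exact ⟨j, by omega, rfl⟩
    · simp [setReg_reg, Op.eval]; ring
  obtain ⟨t₆, σ₆, e6, ht6, ⟨j0, -, -, jx, -, ja⟩⟩ := exec_while (tmp 0) _ _ b (B : ℕ) I hb1
    (lt_of_le_of_lt (b := b) (by omega) Nat.lt_two_pow_self) step σ₅ I0 (by simp [hreg5])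
  refine ⟨_, σ₆, .seq e1 (.seq e2 (.seq e3 (.seq e4 (.seq e5 e6)))), ?_, j0, jx, fun i j => ?_⟩
  · have c0 : bitLen 0 ≤ b := bitLen_le_of_le hb1 (by omega)
    have c1 : bitLen (n : ℤ) ≤ b := bitLen_le_of_le hb1 (by omega)
    have c2 : bitLen ((n : ℤ) * n) ≤ b := bitLen_le_of_le hb1 (by
      rw [Int.natAbs_mul, Int.natAbs_natCast]; omega)
    have c7 : bitLen 1 ≤ b := bitLen_le_of_le hb1 (by omega)
    rw [Int.toNat_natCast] at ht6
    have hB' : B * (14 * b + b) ≤ b * (14 * b + b) := Nat.mul_le_mul_right _ (by omega)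
    have hbb : b ≤ b * b := Nat.le_mul_self b
    have : b * (14 * b + b) = 15 * (b * b) := by ring
    rw [pow_two]
    omega
  · have := i.isLt
    rw [ja _ (by omega), Int.toNat_natCast]
    simp only [initEnv]
    by_cases hi : i = 0
    · subst hi
      rw [if_pos rfl]
      by_cases hj : j < B
      · rw [if_pos ⟨j, hj, by simp⟩]
        congr 1
        simp
      · rw [input_mem_large G (a := j) (by omega), if_neg]
        rintro ⟨k, hk, h⟩
        simp at h
        omega
    · rw [if_neg hi, if_neg]
      rintro ⟨k, hk, h⟩
      have : (i : ℕ) ≠ 0 := fun h => hi (Fin.ext h)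
      omega

/-- The output occupies cells below `n` and the arrays begin at `n * n + 1`, so no array cell is
overwritten while it is still needed. -/
lemma exec_postlude {n : ℕ} (i : Fin 16) {b B : ℕ} (hb : b = 17 * (n * n + 2))
    (hB : B = n * n + 1) (σ : State) (s : Env) (hσ : Rep B σ s) (hn : s.v 0 = n)
    (hs : ∀ v < n, (s.a i v).natAbs ≤ n) :
    ∃ t σ', Exec (postlude i) σ t σ' ∧ t ≤ 400 * b ^ 2 ∧ ∀ v < n, σ'.mem v = s.a i v := by
  have hnn : n ≤ n * n := Nat.le_mul_self n
  have hb1 : 1 ≤ b := by omega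
  have bl : ∀ {k : ℕ}, k ≤ b → k < 2 ^ b := fun h => lt_of_le_of_lt h Nat.lt_two_pow_self
  have e1 := Exec.const σ (tmp 1) 1
  have g1 : Agree 0 σ (σ.setReg (tmp 1) 1) := Agree.setTmp _ _ (by omega)
  set σ₁ := σ.setReg (tmp 1) 1 with h1
  have f1 : σ₁.reg (rv 0) = n := by rw [g1.rv, hσ.v, hn]
  obtain ⟨t₂, e2, ht2⟩ := exec_mov (r := tmp 0) (a := rv 0) (z := tmp 2) (by norm_num [tmp, rv]) σ₁ hb1 (by
    rw [f1]; exact bl (by simp; omega))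
  rw [f1] at e2
  set σ₂ := (σ₁.setReg (tmp 2) 0).setReg (tmp 0) n with h2
  have g2 : Agree 0 σ σ₂ := (g1.trans (Agree.setTmp _ _ (by omega)) le_rfl).trans
    (Agree.setTmp _ _ (by omega)) le_rfl
  have e3 := Exec.const σ₂ (tmp 3) 0
  have g3 : Agree 0 σ (σ₂.setReg (tmp 3) 0) := g2.trans (Agree.setTmp _ _ (by omega)) le_rfl
  set σ₃ := σ₂.setReg (tmp 3) 0 with h3
  let I : ℕ → State → Prop := fun k τ => τ.reg 0 = (B : ℕ) ∧
    τ.reg (tmp 3) = k ∧ (∀ a, B ≤ a → τ.mem a = σ.mem a) ∧ ∀ v < k, τ.mem v = s.a i v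
  have step : ∀ k < ((n : ℕ) : ℤ).toNat, ∀ τ, I k τ → τ.reg (tmp 0) = (n : ℕ) - k → ∃ t τ',
      Exec (.seq (mov (tmp 5) (tmp 3) (tmp 2)) <| .seq (addrCode i 5) <|
        .seq (.load (tmp 4) (tmp 5)) <|
        .seq (.store (tmp 3) (tmp 4)) <| .seq (.const (tmp 1) 1) <|
        .seq (.arith .add (tmp 3) (tmp 3) (tmp 1)) (.arith .sub (tmp 0) (tmp 0) (tmp 1))) τ t τ' ∧
        t ≤ 200 * b ∧ I (k + 1) τ' ∧ τ'.reg (tmp 0) = (n : ℕ) - (k + 1 : ℕ) := by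
    rintro k hk τ ⟨i0, i3, im, iv⟩ hτ
    have hkn : k < n := by omega
    obtain ⟨t₁, y1, hy1⟩ := exec_mov (r := tmp 5) (a := tmp 3) (z := tmp 2) (by simp) τ hb1 (by
      rw [i3]; exact bl (by simp; omega))
    rw [i3] at y1
    have k1 : Agree 1 τ ((τ.setReg (tmp 2) 0).setReg (tmp 5) (k : ℤ)) :=
      (Agree.setTmp _ _ (by omega)).trans (Agree.setTmp _ _ (by omega)) le_rfl
    have l3 : ((τ.setReg (tmp 2) 0).setReg (tmp 5) (k : ℤ)).reg (tmp 3) = k := by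
      simp [setReg_reg, i3]
    have l5 : ((τ.setReg (tmp 2) 0).setReg (tmp 5) (k : ℤ)).reg (tmp 5) = k := by
      simp [setReg_reg]
    set τ₁ := (τ.setReg (tmp 2) 0).setReg (tmp 5) (k : ℤ)
    clear_value τ₁
    obtain ⟨t₂, τ₂, y2, hy2, k2, l2, l2'⟩ := exec_addr i 5 τ₁ (B := B) (b := b)
      (by rw [k1.zero, i0]) hb1 (bl (by omega)) (by rw [l5]; exact bl (by simp; omega))
    rw [l5, Int.toNat_natCast] at l2 l2'
    have l23 : τ₂.reg (tmp 3) = k := by rw [k2.tmp (by omega), l3]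
    have l20 : τ₂.reg (tmp 0) = (n : ℕ) - k := by
      rw [k2.tmp (by omega), k1.tmp (by omega), hτ]
    have l2z : τ₂.reg 0 = (B : ℕ) := by rw [k2.zero, k1.zero, i0]
    have y3 := Exec.load τ₂ (tmp 4) (tmp 5)
    have m2 : τ₂.mem = τ.mem := by rw [k2.mem, k1.mem]
    have hval : τ.mem (B + 16 * k + i) = s.a i k := by rw [im _ (by omega), hσ.a]
    rw [l2, Int.toNat_natCast, m2, hval] at y3
    set τ₃ := τ₂.setReg (tmp 4) (s.a i k) with k3
    have y4 := Exec.store τ₃ (tmp 3) (tmp 4)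
    have l33 : τ₃.reg (tmp 3) = k := by simp [k3, setReg_reg, l23]
    have l34 : τ₃.reg (tmp 4) = s.a i k := by simp [k3, setReg_reg]
    rw [l33, l34, Int.toNat_natCast] at y4
    have y5 := Exec.const (τ₃.setMem k (s.a i k)) (tmp 1) 1
    set τ₅ := (τ₃.setMem k (s.a i k)).setReg (tmp 1) 1 with k5
    have y6 := Exec.arith τ₅ .add (tmp 3) (tmp 3) (tmp 1)
    have hr5 : ∀ r, τ₅.reg r = if r = tmp 1 then 1 else if r = tmp 4 then s.a i k else
        τ₂.reg r := fun r => by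
      simp only [k5, setReg_reg]; congr 1; change τ₃.reg r = _; simp only [k3, setReg_reg]
    have l53 : τ₅.reg (tmp 3) = k := by simp [hr5, l23]
    have l51 : τ₅.reg (tmp 1) = 1 := by simp [hr5]
    rw [l53, l51] at y6
    set τ₆ := τ₅.setReg (tmp 3) (Op.add.eval k 1) with k6
    have y7 := Exec.arith τ₆ .sub (tmp 0) (tmp 0) (tmp 1)
    have l60 : τ₆.reg (tmp 0) = (n : ℕ) - k := by simp [k6, setReg_reg, hr5, l20]
    have l61 : τ₆.reg (tmp 1) = 1 := by simp [k6, setReg_reg, hr5]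
    rw [l60, l61] at y7
    have hmem : ∀ a, τ₅.mem a = if a = k then s.a i k else τ.mem a := fun a => by
      change (τ₃.setMem k (s.a i k)).mem a = _
      simp only [State.setMem, Function.update_apply]
      congr 1
      change τ₂.mem a = _
      rw [m2]
    refine ⟨_, _, .seq y1 (.seq y2 (.seq y3 (.seq y4 (.seq y5 (.seq y6 y7))))), ?_,
      ⟨?_, ?_, fun a ha => ?_, fun v hv => ?_⟩, ?_⟩
    · have c1 : bitLen (k : ℤ) ≤ b := bitLen_le_of_le hb1 (by omega)
      have c2 : bitLen (s.a i k) ≤ b := bitLen_le_of_le hb1 ((hs k hkn).trans (by omega))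
      have c4 : bitLen ((B + 16 * k + i : ℕ) : ℤ) ≤ b + 6 :=
        bitLen_le (by omega) (by rwa [Int.natAbs_natCast])
      have c7 : bitLen 1 ≤ b := bitLen_le_of_le hb1 (by omega)
      have c8 : bitLen ((n : ℤ) - k) ≤ b := bitLen_le_of_le hb1 (by omega)
      omega
    · simp [setReg_reg, k6, hr5, l2z]
    · simp [setReg_reg, k6, Op.eval]
    · change τ₅.mem a = _
      rw [hmem, if_neg (by omega), im a ha]
    · change τ₅.mem v = _
      rw [hmem]
      split_ifs with h
      · rw [h]
      · exact iv v (by omega)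
    · simp [setReg_reg, Op.eval]; ring
  obtain ⟨t₄, σ₄, e4, ht4, ⟨-, -, -, jv⟩⟩ := exec_while (tmp 0) _ _ b (n : ℕ) I hb1
    (lt_of_le_of_lt (b := b) (by omega) Nat.lt_two_pow_self) step σ₃
    ⟨by rw [g3.zero, hσ.base], by simp [h3, setReg_reg], fun a _ => by rw [g3.mem],
      fun v hv => by omega⟩ (by simp [h3, h2, setReg_reg])
  rw [Int.toNat_natCast] at ht4 jv
  refine ⟨_, σ₄, .seq e1 (.seq e2 (.seq e3 e4)), ?_, jv⟩
  have c0 : bitLen 0 ≤ b := bitLen_le_of_le hb1 (by omega)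
  have c7 : bitLen 1 ≤ b := bitLen_le_of_le hb1 (by omega)
  have hB' : n * (200 * b + b) ≤ b * (200 * b + b) := Nat.mul_le_mul_right _ (by omega)
  have hbb : b ≤ b * b := Nat.le_mul_self b
  have : b * (200 * b + b) = 201 * (b * b) := by ring
  rw [pow_two]
  omega

/-- The exponent `K` from `Cmd.code_spec` depends on the command alone and `P` is polynomial in `n`;
so `P ^ K` is a polynomial factor. The copying of input and output is polynomial and is absorbed
because `T n ≥ 1`. -/
theorem hasApprox_of_cmd (ρ : ℝ) (T : ℕ → ℝ) (hT : ∀ n, 1 ≤ T n) (c : Cmd) (hc : c.ok)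
    (out : Fin 16) (c₀ κ : ℕ) (hP : ∀ n, n * n + 2 ≤ c₀ * (n + 1) ^ κ) (C : ℝ) (k : ℕ)
    (h : ∀ (n : ℕ) (G : SimpleGraph (Fin n)), ∃ N : ℕ, (N : ℝ) ≤ C * ((n : ℝ) + 1) ^ k * T n ∧
      Triple (c₀ * (n + 1) ^ κ) c (initEnv G) N fun s => s.v 0 = n ∧
        ∃ π : Equiv.Perm (Fin n), (∀ v : Fin n, s.a out v = ((π v : ℕ) : ℤ)) ∧
          (OLA.cost G π : ℝ) ≤ ρ * (OLA.opt G : ℝ)) :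
    OLA.HasApproxInTimeOStar ρ T := by
  obtain ⟨K, hK⟩ := c.code_spec hc
  refine ⟨.seq prelude (.seq (c.code 0) (postlude out)), 442 * 34 ^ 2 + (c₀ : ℝ) ^ K * |C|,
    4 + κ * K + k, fun n G => ?_⟩
  obtain ⟨N, hN, hsafe, hsteps, hv, π, hπ, hcost⟩ := h n G
  set P := c₀ * (n + 1) ^ κ with hPdef
  have hP' := hP n
  obtain ⟨t₁, σ₁, e1, ht1, rep1⟩ := exec_prelude G (b := 17 * (n * n + 2)) rfl
  obtain ⟨t₂, σ₂, e2, ht2, rep2, -⟩ := hK P (by omega) (n * n + 1)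
    (lt_of_lt_of_le (by omega) (Nat.lt_two_pow_self (n := P)).le) _ hsafe 0 σ₁ rep1
  obtain ⟨t₃, σ₃, e3, ht3, hout⟩ := exec_postlude out (b := 17 * (n * n + 2)) rfl rfl σ₂ _ rep2 hv
    (fun v hv => by rw [hπ ⟨v, hv⟩]; simp)
  refine ⟨_, σ₃, π, .seq e1 (.seq e2 e3), ?_, fun v => by rw [hout v v.isLt, hπ], hcost⟩
  have hb : 17 * (n * n + 2) ≤ 34 * (n + 1) ^ 2 := by nlinarith
  have h13 : t₁ + t₃ ≤ 442 * (34 * (n + 1) ^ 2) ^ 2 := by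
    have := Nat.pow_le_pow_left hb 2
    omega
  have h2 : t₂ ≤ P ^ K * N := ht2.trans (Nat.mul_le_mul_left _ hsteps)
  have h13' : ((t₁ : ℝ) + t₃) ≤ 442 * 34 ^ 2 * ((n : ℝ) + 1) ^ 4 := by
    have : ((t₁ + t₃ : ℕ) : ℝ) ≤ ((442 * (34 * (n + 1) ^ 2) ^ 2 : ℕ) : ℝ) := by exact_mod_cast h13
    push_cast at this
    linarith
  have h2' : (t₂ : ℝ) ≤ (c₀ * ((n : ℝ) + 1) ^ κ) ^ K * N := by
    have : (t₂ : ℝ) ≤ ((P ^ K * N : ℕ) : ℝ) := by exact_mod_cast h2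
    rw [hPdef] at this
    push_cast at this
    exact this
  have hn1 : (1 : ℝ) ≤ (n : ℝ) + 1 := by linarith [(Nat.cast_nonneg n : (0 : ℝ) ≤ n)]
  have hT' := hT n
  have e1' : ((n : ℝ) + 1) ^ 4 ≤ ((n : ℝ) + 1) ^ (4 + κ * K + k) * T n := by
    calc ((n : ℝ) + 1) ^ 4 ≤ ((n : ℝ) + 1) ^ (4 + κ * K + k) :=
          pow_le_pow_right₀ hn1 (by omega)
      _ ≤ _ := le_mul_of_one_le_right (by positivity) hT'
  have e2' : (c₀ * ((n : ℝ) + 1) ^ κ) ^ K * N ≤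
      (c₀ : ℝ) ^ K * |C| * (((n : ℝ) + 1) ^ (4 + κ * K + k) * T n) := by
    calc (c₀ * ((n : ℝ) + 1) ^ κ) ^ K * N
        ≤ (c₀ * ((n : ℝ) + 1) ^ κ) ^ K * (|C| * ((n : ℝ) + 1) ^ k * T n) := by
          refine mul_le_mul_of_nonneg_left (hN.trans ?_) (by positivity)
          gcongr
          exact le_abs_self C
      _ = (c₀ : ℝ) ^ K * |C| * (((n : ℝ) + 1) ^ (κ * K + k) * T n) := by
          rw [mul_pow, ← pow_mul, pow_add]; ring
      _ ≤ _ := by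
          have : ((n : ℝ) + 1) ^ (κ * K + k) ≤ ((n : ℝ) + 1) ^ (4 + κ * K + k) :=
            pow_le_pow_right₀ hn1 (by omega)
          gcongr
  push_cast
  calc (t₁ : ℝ) + (t₂ + t₃) = (t₁ + t₃) + t₂ := by ring
    _ ≤ 442 * 34 ^ 2 * (((n : ℝ) + 1) ^ (4 + κ * K + k) * T n) +
        (c₀ : ℝ) ^ K * |C| * (((n : ℝ) + 1) ^ (4 + κ * K + k) * T n) := by
        refine add_le_add (h13'.trans ?_) (h2'.trans e2')
        gcongr
    _ = _ := by ring

end Lang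

/-! ### Cuts and the approximation guarantee -/

namespace OLA

open Classical in
/-- The number of edges that leave `X`. -/
noncomputable def cutN {n : ℕ} (G : SimpleGraph (Fin n)) (X : Finset (Fin n)) : ℕ :=
  ∑ u, ∑ v, if G.Adj u v ∧ u ∈ X ∧ v ∉ X then 1 else 0

/-- The vertices at the first `i` positions. -/
def pre {n : ℕ} (π : Equiv.Perm (Fin n)) (i : ℕ) : Finset (Fin n) :=
  Finset.univ.filter fun v => (π v : ℕ) < i

lemma mem_pre {n : ℕ} {π : Equiv.Perm (Fin n)} {i : ℕ} {v : Fin n} :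
    v ∈ pre π i ↔ (π v : ℕ) < i := by simp [pre]

lemma card_pre {n : ℕ} (π : Equiv.Perm (Fin n)) {i : ℕ} (hi : i ≤ n) : (pre π i).card = i := by
  have : pre π i = (Finset.univ.filter fun v : Fin n => (v : ℕ) < i).map π.symm.toEmbedding := by
    ext v
    simp [mem_pre]
  rw [this, Finset.card_map, Fin.card_filter_val_lt, min_eq_right hi]

/-- An edge of the cut has exactly one orientation from inside to outside, so ordered pairs count
each edge once. -/
lemma ncard_cut {n : ℕ} (G : SimpleGraph (Fin n)) (π : Equiv.Perm (Fin n)) (i : ℕ) :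
    (cut G π i).ncard = cutN G (pre π i) := by
  classical
  have h : cut G π i = (fun p : Fin n × Fin n => s(p.1, p.2)) ''
      ((Finset.univ.filter fun p : Fin n × Fin n =>
        G.Adj p.1 p.2 ∧ p.1 ∈ pre π i ∧ p.2 ∉ pre π i : Finset (Fin n × Fin n)) : Set _) := by
    ext e
    simp only [cut, Set.mem_ofPred_eq, Set.mem_image, Finset.coe_filter, Finset.mem_univ, true_and,
      mem_pre, Prod.exists, not_lt]
    constructor
    · rintro ⟨u, v, h, rfl, h1, h2⟩
      exact ⟨u, v, ⟨h, by omega, by omega⟩, rfl⟩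
    · rintro ⟨u, v, ⟨h, h1, h2⟩, rfl⟩
      exact ⟨u, v, h, rfl, by omega, by omega⟩
  rw [h, Set.InjOn.ncard_image, Set.ncard_coe_finset, Finset.card_filter, cutN,
    ← Finset.univ_product_univ, Finset.sum_product]
  rintro ⟨u, v⟩ hp ⟨u', v'⟩ hp' he
  simp only [Finset.coe_filter, Set.mem_ofPred_eq] at hp hp'
  rw [Sym2.eq_iff] at he
  rcases he with ⟨rfl, rfl⟩ | ⟨rfl, rfl⟩
  · rfl
  · exact absurd hp.2.2.1 hp'.2.2.2

lemma cost_eq_sum_cutN {n : ℕ} (G : SimpleGraph (Fin n)) (π : Equiv.Perm (Fin n)) :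
    cost G π = ∑ i ∈ Finset.Ico 1 n, cutN G (pre π i) := by
  simp only [cost, ncard_cut]

open Classical in
-- An edge lies in as many cuts as its length in the ordering; ordered pairs count every edge twice.
lemma two_mul_cost {n : ℕ} (G : SimpleGraph (Fin n)) (π : Equiv.Perm (Fin n)) :
    (2 * cost G π : ℤ) = ∑ u, ∑ v, if G.Adj u v then |((π u : ℕ) : ℤ) - (π v : ℕ)| else 0 := by
  -- Truncated subtraction discards the orientation in which `v` precedes `u`.
  have h1 : cost G π = ∑ u, ∑ v, if G.Adj u v then (π v : ℕ) - (π u : ℕ) else 0 := by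
    rw [cost_eq_sum_cutN]
    simp only [cutN]
    rw [Finset.sum_comm]
    refine Finset.sum_congr rfl fun u _ => ?_
    rw [Finset.sum_comm]
    refine Finset.sum_congr rfl fun v _ => ?_
    split_ifs with h
    · simp only [h, true_and]
      rw [← Finset.card_filter, ← Nat.card_Ioc]
      congr 1
      ext i
      have := (π v).isLt
      simp only [Finset.mem_filter, Finset.mem_Ico, mem_pre, Finset.mem_Ioc]
      omega
    · simp [h]
  have h2 : (cost G π : ℤ) = ∑ u, ∑ v, if G.Adj u v then (((π u : ℕ) - (π v : ℕ) : ℕ) : ℤ) else 0 := by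
    rw [h1, Finset.sum_comm]
    push_cast
    refine Finset.sum_congr rfl fun u _ => Finset.sum_congr rfl fun v _ => ?_
    simp only [G.adj_comm]
  have h3 : (cost G π : ℤ) = ∑ u, ∑ v, if G.Adj u v then (((π v : ℕ) - (π u : ℕ) : ℕ) : ℤ) else 0 := by
    rw [h1]
    push_cast
    rfl
  rw [two_mul]
  conv_lhs => rw [h2]
  rw [← h2]
  nth_rw 1 [h2]
  rw [h3, ← Finset.sum_add_distrib]
  refine Finset.sum_congr rfl fun u _ => ?_
  rw [← Finset.sum_add_distrib]
  refine Finset.sum_congr rfl fun v _ => ?_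
  split_ifs with h
  · rcases le_total (π u : ℕ) (π v : ℕ) with h | h
    · rw [abs_of_nonpos (by omega)]; omega
    · rw [abs_of_nonneg (by omega)]; omega
  · simp

lemma cutN_compl {n : ℕ} (G : SimpleGraph (Fin n)) (X : Finset (Fin n)) :
    cutN G Xᶜ = cutN G X := by
  classical
  rw [cutN, cutN, Finset.sum_comm]
  refine Finset.sum_congr rfl fun u _ => Finset.sum_congr rfl fun v _ => ?_
  congr 1
  simp only [Finset.mem_compl, not_not, eq_iff_iff]
  rw [G.adj_comm]
  tauto

lemma cutN_union_le {n : ℕ} (G : SimpleGraph (Fin n)) (X Y : Finset (Fin n)) :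
    cutN G (X ∪ Y) ≤ cutN G X + cutN G Y := by
  classical
  simp only [cutN]
  rw [← Finset.sum_add_distrib]
  refine Finset.sum_le_sum fun u _ => ?_
  rw [← Finset.sum_add_distrib]
  refine Finset.sum_le_sum fun v _ => ?_
  by_cases h1 : u ∈ X <;> by_cases h2 : v ∈ X <;> by_cases h3 : u ∈ Y <;> by_cases h4 : v ∈ Y <;>
    by_cases h5 : G.Adj u v <;> simp [*]

lemma cutN_empty {n : ℕ} (G : SimpleGraph (Fin n)) : cutN G ∅ = 0 := by simp [cutN]

/-- If every set of medium size has a large cut, then every ordering is expensive. -/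
lemma le_cost_of_forall_cutN {n : ℕ} (G : SimpleGraph (Fin n)) {a c : ℕ} (h3a : 3 * a ≤ n)
    (hc : ∀ X : Finset (Fin n), a ≤ X.card → X.card ≤ n - a → c ≤ cutN G X)
    (π : Equiv.Perm (Fin n)) : c * (n + 1 + a / 2 - 2 * a) ≤ cost G π := by
  rcases Nat.eq_zero_or_pos a with rfl | ha
  -- For `a = 0` the empty set is admissible, which forces `c = 0`.
  · have := hc ∅ (by simp) (by simp)
    rw [cutN_empty] at this
    simp [Nat.le_zero.1 this]
  set f := fun i => cutN G (pre π i) with hf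
  have hmid : ∀ i ∈ Finset.Ico a (n - a + 1), c ≤ f i := by
    intro i hi
    rw [Finset.mem_Ico] at hi
    refine hc _ ?_ ?_ <;> rw [card_pre π (by omega)] <;> omega
  -- `s = ⌈a / 2⌉` is the least `i` with `2 * i ≥ a`. For `i < a` the hypothesis `3 * a ≤ n` gives
  -- `2 * i ≤ n - a`, so a prefix and a suffix of length `i` form a set of medium size.
  set s := (a + 1) / 2 with hs
  have htail : ∀ i ∈ Finset.Ico s a, c ≤ f i + f (n - i) := by
    intro i hi
    rw [Finset.mem_Ico] at hi
    have hd : Disjoint (pre π i) (pre π (n - i))ᶜ := by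
      rw [Finset.disjoint_left]
      intro v h1 h2
      rw [Finset.mem_compl, mem_pre] at h2
      rw [mem_pre] at h1
      omega
    have hcard : (pre π i ∪ (pre π (n - i))ᶜ).card = 2 * i := by
      rw [Finset.card_union_of_disjoint hd, Finset.card_compl, Fintype.card_fin,
        card_pre π (by omega), card_pre π (by omega)]
      omega
    refine (hc (pre π i ∪ (pre π (n - i))ᶜ) (by omega) (by omega)).trans ?_
    refine (cutN_union_le G _ _).trans ?_
    rw [cutN_compl]
  have e1 : ∑ i ∈ Finset.Ico s a, f (n - i) = ∑ i ∈ Finset.Ico (n - a + 1) (n - s + 1), f i := by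
    have := Finset.sum_Ico_reflect f s (m := a) (n := n) (by omega)
    rw [this, show n + 1 - a = n - a + 1 by omega, show n + 1 - s = n - s + 1 by omega]
  rw [cost_eq_sum_cutN]
  have hsub : ∑ i ∈ Finset.Ico s (n - s + 1), f i ≤ ∑ i ∈ Finset.Ico 1 n, f i :=
    Finset.sum_le_sum_of_subset (Finset.Ico_subset_Ico (by omega) (by omega))
  refine le_trans ?_ hsub
  rw [← Finset.sum_Ico_consecutive f (show s ≤ a by omega) (show a ≤ n - s + 1 by omega),
    ← Finset.sum_Ico_consecutive f (show a ≤ n - a + 1 by omega)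
      (show n - a + 1 ≤ n - s + 1 by omega), ← e1]
  have h1 := Finset.card_nsmul_le_sum _ _ c hmid
  have h2 := Finset.card_nsmul_le_sum _ _ c htail
  rw [Finset.sum_add_distrib] at h2
  simp only [Nat.card_Ico, smul_eq_mul] at h1 h2
  change _ ≤ ∑ i ∈ _, f i at h1
  -- There are `n - 2 a + 1` prefixes of medium size and `a - ⌈a / 2⌉ = ⌊a / 2⌋` pairs of a short
  -- and a long prefix.
  have : c * (n + 1 + a / 2 - 2 * a) = (n - a + 1 - a) * c + (a - s) * c := by
    rw [← add_mul, mul_comm]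
    congr 1
    omega
  omega

open Classical in
-- Both orderings put `S` first; `π₁` sorts each part by `τ`, `π₂` by the reverse of `τ`. Ranks
-- within a part differ by no more than positions in `τ`, so inner edges do not get longer. For `u`
-- in `S` and `v` outside, with ranks `r u` and `r v`, the distances are `s + r v - r u` and `n - s
-- - r v + r u`, with sum `n`.
lemma cost_add_cost_le {n : ℕ} (G : SimpleGraph (Fin n)) (S : Finset (Fin n))
    (τ : Equiv.Perm (Fin n)) : ∃ π₁ π₂ : Equiv.Perm (Fin n),
      pre π₁ S.card = S ∧ pre π₂ S.card = S ∧
      cost G π₁ + cost G π₂ ≤ 2 * cost G τ + n * cutN G S := by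
  set s := S.card with hs
  -- ranks inside the two parts
  set r : Fin n → ℕ := fun v =>
    (Finset.univ.filter fun u => (u ∈ S ↔ v ∈ S) ∧ τ u < τ v).card with hr
  have hsn : s ≤ n := by simpa using Finset.card_le_univ S
  have hrS : ∀ v ∈ S, r v < s := fun v hv => by
    apply Finset.card_lt_card
    refine ⟨fun u hu => ?_, fun h => ?_⟩
    · simp only [Finset.mem_filter, hv, iff_true] at hu; exact hu.2.1
    · simpa using h hv
  have hrT : ∀ v, v ∉ S → r v < n - s := fun v hv => by
    have : Sᶜ.card = n - s := by rw [Finset.card_compl, Fintype.card_fin]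
    rw [← this]
    apply Finset.card_lt_card
    refine ⟨fun u hu => ?_, fun h => ?_⟩
    · simp only [Finset.mem_filter, hv, iff_false] at hu; simpa using hu.2.1
    · simpa using h (Finset.mem_compl.2 hv)
  have hlip : ∀ u v : Fin n, (u ∈ S ↔ v ∈ S) → τ u < τ v →
      r u < r v ∧ r v ≤ r u + ((τ v : ℕ) - (τ u : ℕ)) := by
    intro u v huv hlt
    constructor
    · apply Finset.card_lt_card
      refine ⟨fun w hw => ?_, fun h => ?_⟩
      · simp only [Finset.mem_filter, Finset.mem_univ, true_and] at hw ⊢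
        exact ⟨by tauto, hw.2.trans hlt⟩
      · have := h (show u ∈ _ by simp [huv, hlt])
        simp at this
    -- The vertices counted in the rank of `v` but not in that of `u` have their `τ`-positions in
    -- the interval from `τ u` to `τ v`.
    · have hsub : (Finset.univ.filter fun w => (w ∈ S ↔ v ∈ S) ∧ τ w < τ v) ⊆
          (Finset.univ.filter fun w => (w ∈ S ↔ u ∈ S) ∧ τ w < τ u) ∪
            (Finset.Ico (τ u) (τ v)).map τ.symm.toEmbedding := by
        intro w hw
        simp only [Finset.mem_filter, Finset.mem_univ, true_and] at hw
        simp only [Finset.mem_union, Finset.mem_filter, Finset.mem_univ, true_and, Finset.mem_map,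
          Finset.mem_Ico]
        rcases lt_or_ge (τ w) (τ u) with h | h
        · left; exact ⟨by tauto, h⟩
        · right; exact ⟨τ w, ⟨h, hw.2⟩, by simp⟩
      refine (Finset.card_le_card hsub).trans ((Finset.card_union_le _ _).trans ?_)
      rw [Finset.card_map, Fin.card_Ico]
  have hrinj : ∀ u v : Fin n, (u ∈ S ↔ v ∈ S) → r u = r v → u = v := by
    intro u v huv he
    rcases lt_trichotomy (τ u) (τ v) with h | h | h
    · have := (hlip u v huv h).1; omega
    · exact τ.injective h
    · have := (hlip v u huv.symm h).1; omega
  have habs : ∀ u v : Fin n, (u ∈ S ↔ v ∈ S) →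
      |(r u : ℤ) - r v| ≤ |((τ u : ℕ) : ℤ) - (τ v : ℕ)| := by
    intro u v huv
    rcases lt_trichotomy (τ u) (τ v) with h | h | h
    · obtain ⟨h1, h2⟩ := hlip u v huv h
      have h' : (τ u : ℕ) < τ v := h
      rw [abs_of_neg (by omega), abs_of_neg (by omega)]
      omega
    · rw [τ.injective h]; simp
    · obtain ⟨h1, h2⟩ := hlip v u huv.symm h
      have h' : (τ v : ℕ) < τ u := h
      rw [abs_of_pos (by omega), abs_of_pos (by omega)]
      omega
  let f₁ : Fin n → Fin n := fun v => ⟨if v ∈ S then r v else s + r v, by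
    have := v.isLt
    split_ifs with h
    · have := hrS v h; omega
    · have := hrT v h; omega⟩
  let f₂ : Fin n → Fin n := fun v => ⟨if v ∈ S then s - 1 - r v else n - 1 - r v, by
    have := v.isLt
    split_ifs with h <;> omega⟩
  have i₁ : Function.Injective f₁ := by
    intro u v he
    have he' : (if u ∈ S then r u else s + r u) = if v ∈ S then r v else s + r v :=
      congrArg Fin.val he
    split_ifs at he' with h1 h2 h2
    · exact hrinj u v (by tauto) he'
    · have := hrS u h1; omega
    · have := hrS v h2; omega
    · exact hrinj u v (by tauto) (by omega)
  have i₂ : Function.Injective f₂ := by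
    intro u v he
    have he' : (if u ∈ S then s - 1 - r u else n - 1 - r u) =
        if v ∈ S then s - 1 - r v else n - 1 - r v := congrArg Fin.val he
    split_ifs at he' with h1 h2 h2
    · have := hrS u h1; have := hrS v h2
      exact hrinj u v (by tauto) (by omega)
    · have := hrS u h1; have := hrT v h2; omega
    · have := hrT u h1; have := hrS v h2; omega
    · have := hrT u h1; have := hrT v h2
      exact hrinj u v (by tauto) (by omega)
  refine ⟨Equiv.ofBijective f₁ (Finite.injective_iff_bijective.1 i₁),
    Equiv.ofBijective f₂ (Finite.injective_iff_bijective.1 i₂), ?_, ?_, ?_⟩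
  · ext v
    rw [mem_pre]
    change (if v ∈ S then r v else s + r v) < s ↔ _
    split_ifs with h
    · simp [h, hrS v h]
    · simp [h]
  · ext v
    rw [mem_pre]
    change (if v ∈ S then s - 1 - r v else n - 1 - r v) < s ↔ _
    split_ifs with h
    · have := hrS v h; simp only [h, iff_true]; omega
    · have := hrT v h; simp only [h, iff_false]; omega
  · set π₁ := Equiv.ofBijective f₁ (Finite.injective_iff_bijective.1 i₁)
    set π₂ := Equiv.ofBijective f₂ (Finite.injective_iff_bijective.1 i₂)
    -- As sums over ordered pairs the costs are doubled, and the crossing edges appear once from the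
    -- side of `S` and once from the side of `Sᶜ`.
    have key : (2 * cost G π₁ + 2 * cost G π₂ : ℤ) ≤
        2 * (2 * cost G τ) + n * (cutN G S + cutN G Sᶜ) := by
      rw [two_mul_cost, two_mul_cost, two_mul_cost, cutN, cutN]
      push_cast
      simp only [← Finset.sum_add_distrib, Finset.mul_sum]
      refine Finset.sum_le_sum fun u _ => Finset.sum_le_sum fun v _ => ?_
      by_cases huv : G.Adj u v
      swap
      · simp [huv]
      have p1 : ∀ w, ((π₁ w : ℕ) : ℤ) = if w ∈ S then (r w : ℤ) else s + r w := fun w => by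
        change (((if w ∈ S then r w else s + r w : ℕ)) : ℤ) = _
        split_ifs <;> simp
      have p2 : ∀ w, ((π₂ w : ℕ) : ℤ) = if w ∈ S then (s - 1 - r w : ℤ) else n - 1 - r w := fun w => by
        change (((if w ∈ S then s - 1 - r w else n - 1 - r w : ℕ)) : ℤ) = _
        split_ifs with h
        · have := hrS w h; omega
        · have := hrT w h; omega
      have hlu := habs u v
      have su := hrS u
      have sv := hrS v
      have tu := hrT u
      have tv := hrT v
      rw [p1, p1, p2, p2]
      simp only [huv, if_true, true_and, Finset.mem_compl, not_not]
      by_cases hu : u ∈ S <;> by_cases hv : v ∈ S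
      · have hl := hlu (by tauto)
        simp only [hu, hv, if_true, not_true_eq_false, and_false, false_and, if_false]
        have e : |(s - 1 - r u : ℤ) - (s - 1 - r v)| = |(r u : ℤ) - r v| := by
          rw [← abs_neg]; congr 1; ring
        rw [e]; linarith
      · have := su hu; have := tv hv
        simp only [hu, hv, if_true, not_true_eq_false, not_false_eq_true, and_self, if_false]
        rw [abs_of_neg (by omega), abs_of_neg (by omega)]
        have := abs_nonneg (((τ u : ℕ) : ℤ) - (τ v : ℕ))
        linarith
      · have := sv hv; have := tu hu
        simp only [hu, hv, if_true, not_true_eq_false, not_false_eq_true, and_self, if_false]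
        rw [abs_of_pos (by omega), abs_of_pos (by omega)]
        have := abs_nonneg (((τ u : ℕ) : ℤ) - (τ v : ℕ))
        linarith
      · have hl := hlu (by tauto)
        simp only [hu, hv, not_false_eq_true, and_false, false_and, if_false]
        have e1 : |(s + r u : ℤ) - (s + r v)| = |(r u : ℤ) - r v| := by
          congr 1; ring
        have e : |(n - 1 - r u : ℤ) - (n - 1 - r v)| = |(r u : ℤ) - r v| := by
          rw [← abs_neg]; congr 1; ring
        rw [e, e1]; linarith
    rw [cutN_compl] at key
    have : (cost G π₁ + cost G π₂ : ℤ) ≤ 2 * cost G τ + n * cutN G S := by linarith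
    exact_mod_cast this

lemma exists_cost_eq_opt {n : ℕ} (G : SimpleGraph (Fin n)) : ∃ τ, cost G τ = opt G := by
  obtain ⟨τ, h⟩ := ciInf_mem (cost G)
  exact ⟨τ, h⟩

/-- The approximation guarantee: take a smallest cut among the sets of medium size and continue
optimally. -/
theorem cost_le_of_min_cut {n : ℕ} (G : SimpleGraph (Fin n)) {a : ℕ} (h3a : 3 * a ≤ n)
    {S : Finset (Fin n)} (hmin : ∀ X : Finset (Fin n), a ≤ X.card → X.card ≤ n - a →
      cutN G S ≤ cutN G X) {π : Equiv.Perm (Fin n)}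
    (hopt : ∀ π', pre π' S.card = S → cost G π ≤ cost G π') {α : ℝ} (hα : α < 1)
    (haα : 3 * (a : ℝ) ≤ 2 * (α * n)) :
    (cost G π : ℝ) ≤ (1 + 1 / (2 * (1 - α))) * opt G := by
  obtain ⟨τ, hτ⟩ := exists_cost_eq_opt G
  obtain ⟨π₁, π₂, h1, h2, h12⟩ := cost_add_cost_le G S τ
  have hlow := le_cost_of_forall_cutN G h3a hmin τ
  rw [hτ] at h12 hlow
  -- `π` is at least as good as the two orderings, hence as their average.
  have h3 : 2 * cost G π ≤ 2 * opt G + n * cutN G S := by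
    have := hopt π₁ h1
    have := hopt π₂ h2
    omega
  have h3' : 2 * (cost G π : ℝ) ≤ 2 * opt G + n * cutN G S := by exact_mod_cast h3
  -- Since `2 * (a / 2) ≥ a - 1`, twice the count is at least `2 n - 3 a + 1`, and `3 a ≤ 2 α n`.
  have h4 : (1 - α) * n ≤ ((n + 1 + a / 2 - 2 * a : ℕ) : ℝ) := by
    have : (2 * (n + 1 + a / 2 - 2 * a) : ℕ) + 3 * a ≥ 2 * n := by omega
    have : (2 * ((n + 1 + a / 2 - 2 * a : ℕ) : ℝ)) + 3 * a ≥ 2 * n := by exact_mod_cast this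
    linarith
  have h5 : (cutN G S : ℝ) * ((1 - α) * n) ≤ opt G := by
    refine (mul_le_mul_of_nonneg_left h4 (by positivity)).trans ?_
    exact_mod_cast hlow
  have hpos : 0 < 1 - α := by linarith
  have h6 : (n * cutN G S : ℝ) ≤ opt G / (1 - α) := by
    rw [le_div_iff₀ hpos]
    linarith
  have : (1 + 1 / (2 * (1 - α))) * (opt G : ℝ) = opt G + opt G / (1 - α) / 2 := by
    field_simp
  rw [this]
  linarith

end OLA

/-! ### Fast multiplication from a tensor decomposition -/

namespace MatMul

open Finset

lemma sum_range_mul_add {M : Type*} [AddCommMonoid M] (A B : ℕ) (f : ℕ → M) :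
    ∑ x ∈ range (A * B), f x = ∑ a ∈ range A, ∑ b ∈ range B, f (a * B + b) := by
  induction A with
  | zero => simp
  | succ A ih => rw [Nat.succ_mul, sum_range_add, ih, sum_range_succ]

/-- The tensor power of a table, with indices in base `R` and `C`. -/
def ten (M : ℕ → ℕ → ℤ) (R C : ℕ) : ℕ → ℕ → ℕ → ℤ
  | 0, _, _ => 1
  | k + 1, x, y => ten M R C k (x / R) (y / C) * M (x % R) (y % C)

lemma ten_succ_add (M : ℕ → ℕ → ℤ) {R C : ℕ} (k x y : ℕ) {x₀ y₀ : ℕ} (hx : x₀ < R) (hy : y₀ < C) :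
    ten M R C (k + 1) (x * R + x₀) (y * C + y₀) = ten M R C k x y * M x₀ y₀ := by
  have h1 : (x * R + x₀) / R = x := by
    rw [mul_comm, Nat.mul_add_div (by omega), Nat.div_eq_of_lt hx, add_zero]
  have h2 : (y * C + y₀) / C = y := by
    rw [mul_comm, Nat.mul_add_div (by omega), Nat.div_eq_of_lt hy, add_zero]
  have h3 : (x * R + x₀) % R = x₀ := by rw [mul_comm, Nat.mul_add_mod, Nat.mod_eq_of_lt hx]
  have h4 : (y * C + y₀) % C = y₀ := by rw [mul_comm, Nat.mul_add_mod, Nat.mod_eq_of_lt hy]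
  rw [ten, h1, h2, h3, h4]

/-- One layer of the transform: it consumes the leading digit in base `C` and appends a digit in
base `R`. -/
def layer (M : ℕ → ℕ → ℤ) (R C L : ℕ) (v : ℕ → ℤ) (i : ℕ) : ℤ :=
  ∑ e ∈ range C, M (i % R) e * v (e * L + i / R)

/-- This is Yates's algorithm for a Kronecker power. After `j` layers an index consists of `k - j`
unread digits `s` in base `C`, followed by `j` finished digits `x` in base `R`. Reading in front and
appending at the end keeps the digits in order, so after `k` layers the index is just `x`. -/
theorem layers_eq (M : ℕ → ℕ → ℤ) {R C : ℕ} (k : ℕ) (v : ℕ → ℕ → ℤ)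
    (hv : ∀ j < k, ∀ i < C ^ (k - 1 - j) * R ^ j * R,
      v (j + 1) i = layer M R C (C ^ (k - 1 - j) * R ^ j) (v j) i) :
    ∀ j ≤ k, ∀ s < C ^ (k - j), ∀ x < R ^ j,
      v j (s * R ^ j + x) = ∑ y ∈ range (C ^ j), ten M R C j x y * v 0 (y * C ^ (k - j) + s) := by
  intro j
  induction j with
  | zero =>
    intro _ s _ x hx
    have : x = 0 := by simpa using hx
    simp [this, ten]
  | succ j ih =>
    intro hj s hs x hx
    have hR : 0 < R := by
      rcases Nat.eq_zero_or_pos R with rfl | h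
      · simp at hx
      · exact h
    have hxR : x / R < R ^ j := by
      rw [Nat.div_lt_iff_lt_mul hR, ← pow_succ]; exact hx
    have e0 : C ^ (k - 1 - j) = C ^ (k - (j + 1)) := by congr 1; omega
    have hlt : s * R ^ j + x / R < C ^ (k - 1 - j) * R ^ j := by
      rw [e0]
      calc s * R ^ j + x / R < s * R ^ j + R ^ j := by omega
        _ = (s + 1) * R ^ j := by ring
        _ ≤ _ := Nat.mul_le_mul_right _ hs
    have e1 : s * R ^ (j + 1) + x = (s * R ^ j + x / R) * R + x % R := by
      have := Nat.div_add_mod' x R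
      rw [pow_succ, add_mul]
      nlinarith
    have hmod : x % R < R := Nat.mod_lt _ hR
    have d1 : ((s * R ^ j + x / R) * R + x % R) / R = s * R ^ j + x / R := by
      rw [mul_comm, Nat.mul_add_div hR, Nat.div_eq_of_lt hmod, add_zero]
    have d2 : ((s * R ^ j + x / R) * R + x % R) % R = x % R := by
      rw [mul_comm, Nat.mul_add_mod, Nat.mod_eq_of_lt hmod]
    rw [e1, hv j (by omega) _ (by nlinarith), layer, d1, d2, pow_succ C, sum_range_mul_add,
      sum_comm]
    refine sum_congr rfl fun e he => ?_
    rw [mem_range] at he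
    have hpow : C ^ (k - j) = C * C ^ (k - (j + 1)) := by
      rw [← pow_succ']; congr 1; omega
    have e2 : e * (C ^ (k - 1 - j) * R ^ j) + (s * R ^ j + x / R) =
        (e * C ^ (k - (j + 1)) + s) * R ^ j + x / R := by rw [e0]; ring
    rw [e2, ih (by omega) _ (by rw [hpow]; nlinarith) _ hxR, mul_sum]
    refine sum_congr rfl fun y _ => ?_
    have e3 : (y * C + e) * C ^ (k - (j + 1)) + s = y * C ^ (k - j) + (e * C ^ (k - (j + 1)) + s) := by
      rw [hpow]; ring
    conv_rhs => rw [← Nat.div_add_mod' x R, ten_succ_add M j _ _ hmod he, e3]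
    ring

/-- The entries of the matrix multiplication tensor, the matrix entry `(i, j)` being numbered
`i * N + j`. -/
def str (N z x y : ℕ) : ℤ := if x % N = y / N ∧ z / N = x / N ∧ z % N = y % N then 1 else 0

/-- Integer tables that decompose `δ` times the matrix multiplication tensor. -/
structure IsDecomp (N r : ℕ) (δ : ℕ) (F G W : ℕ → ℕ → ℤ) : Prop where
  pos : 0 < δ
  eq : ∀ z < N * N, ∀ x < N * N, ∀ y < N * N,
    ∑ l ∈ range r, W z l * F l x * G l y = δ * str N z x y

/-- The tensor of the multiplication of block matrices. -/
def strPow (N : ℕ) : ℕ → ℕ → ℕ → ℕ → ℤ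
  | 0, _, _, _ => 1
  | k + 1, z, x, y => strPow N k (z / (N * N)) (x / (N * N)) (y / (N * N)) *
      str N (z % (N * N)) (x % (N * N)) (y % (N * N))

/-- Splitting off the last digit of the summation index factors every summand, so the sum becomes a
product of one sum for each digit. -/
lemma IsDecomp.pow {N r δ : ℕ} {F G W : ℕ → ℕ → ℤ} (h : IsDecomp N r δ F G W) (hN : 0 < N)
    (k : ℕ) : ∀ z x y, ∑ l ∈ range (r ^ k), ten W (N * N) r k z l * ten F r (N * N) k l x *
      ten G r (N * N) k l y = (δ : ℤ) ^ k * strPow N k z x y := by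
  induction k with
  | zero => simp [ten, strPow]
  | succ k ih =>
    intro z x y
    have hQ : 0 < N * N := by positivity
    rw [pow_succ r, sum_range_mul_add, strPow, pow_succ]
    have : ∀ a ∈ range (r ^ k), ∀ b ∈ range r,
        ten W (N * N) r (k + 1) z (a * r + b) * ten F r (N * N) (k + 1) (a * r + b) x *
          ten G r (N * N) (k + 1) (a * r + b) y =
        (ten W (N * N) r k (z / (N * N)) a * ten F r (N * N) k a (x / (N * N)) *
          ten G r (N * N) k a (y / (N * N))) *
        (W (z % (N * N)) b * F b (x % (N * N)) * G b (y % (N * N))) := by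
      intro a _ b hb
      rw [mem_range] at hb
      conv_lhs =>
        rw [← Nat.div_add_mod' z (N * N), ← Nat.div_add_mod' x (N * N), ← Nat.div_add_mod' y (N * N),
          ten_succ_add _ _ _ _ (Nat.mod_lt _ hQ) hb, ten_succ_add _ _ _ _ hb (Nat.mod_lt _ hQ),
          ten_succ_add _ _ _ _ hb (Nat.mod_lt _ hQ)]
      ring
    rw [sum_congr rfl fun a ha => sum_congr rfl (this a ha)]
    simp only [← mul_sum, ← sum_mul]
    rw [ih, h.eq _ (Nat.mod_lt _ hQ) _ (Nat.mod_lt _ hQ) _ (Nat.mod_lt _ hQ)]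
    ring

/-- The row of a matrix entry that is given by its digits. -/
def dec₁ (N k x : ℕ) : ℕ := ∑ d ∈ range k, x / (N * N) ^ d % (N * N) / N * N ^ d

/-- The column of a matrix entry that is given by its digits. -/
def dec₂ (N k x : ℕ) : ℕ := ∑ d ∈ range k, x / (N * N) ^ d % N * N ^ d

lemma dec₁_succ (N k x : ℕ) :
    dec₁ N (k + 1) x = dec₁ N k (x / (N * N)) * N + x % (N * N) / N := by
  simp only [dec₁]
  rw [sum_range_succ', sum_mul]
  simp only [pow_zero, Nat.div_one, mul_one]
  congr 1
  refine sum_congr rfl fun d _ => ?_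
  rw [pow_succ', ← Nat.div_div_eq_div_mul, pow_succ]
  ring

lemma dec₂_succ (N k x : ℕ) :
    dec₂ N (k + 1) x = dec₂ N k (x / (N * N)) * N + x % N := by
  simp only [dec₂]
  rw [sum_range_succ', sum_mul]
  simp only [pow_zero, Nat.div_one, mul_one]
  congr 1
  refine sum_congr rfl fun d _ => ?_
  rw [pow_succ', ← Nat.div_div_eq_div_mul, pow_succ]
  ring

lemma dec_lt {N : ℕ} (hN : 0 < N) (k x : ℕ) : dec₁ N k x < N ^ k ∧ dec₂ N k x < N ^ k := by
  induction k generalizing x with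
  | zero => simp [dec₁, dec₂]
  | succ k ih =>
    rw [dec₁_succ, dec₂_succ, pow_succ]
    have h1 := (ih (x / (N * N))).1
    have h2 := (ih (x / (N * N))).2
    have h3 : x % (N * N) / N < N :=
      (Nat.div_lt_iff_lt_mul hN).2 (Nat.mod_lt _ (by positivity))
    have h4 : x % N < N := Nat.mod_lt _ hN
    constructor <;> nlinarith

/-- Every pair of a row and a column is named by some digit string. A maximum over the cells of an
array is therefore a maximum over all matrix entries. -/
lemma exists_dec {N : ℕ} (hN : 0 < N) (k : ℕ) : ∀ i < N ^ k, ∀ j < N ^ k,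
    ∃ z < (N * N) ^ k, dec₁ N k z = i ∧ dec₂ N k z = j := by
  induction k with
  | zero =>
    intro i hi j hj
    exact ⟨0, by simp, by simp [dec₁] at *; omega, by simp [dec₂] at *; omega⟩
  | succ k ih =>
    intro i hi j hj
    rw [pow_succ, ← Nat.div_lt_iff_lt_mul hN] at hi hj
    obtain ⟨z, hz, h1, h2⟩ := ih _ hi _ hj
    have hi' := Nat.mod_lt i hN
    have hj' := Nat.mod_lt j hN
    have hlt : i % N * N + j % N < N * N := by nlinarith
    have hQ : 0 < N * N := by positivity
    have hm : (z * (N * N) + (i % N * N + j % N)) % (N * N) = i % N * N + j % N := by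
      rw [mul_comm, Nat.mul_add_mod, Nat.mod_eq_of_lt hlt]
    have hd : (z * (N * N) + (i % N * N + j % N)) / (N * N) = z := by
      rw [mul_comm, Nat.mul_add_div hQ, Nat.div_eq_of_lt hlt, add_zero]
    refine ⟨z * (N * N) + (i % N * N + j % N), ?_, ?_, ?_⟩
    · rw [pow_succ]; nlinarith
    · rw [dec₁_succ, hm, hd, h1, mul_comm (i % N), Nat.mul_add_div hN, Nat.div_eq_of_lt hj', add_zero,
        Nat.div_add_mod']
    · rw [dec₂_succ, hd, h2]
      have : (z * (N * N) + (i % N * N + j % N)) % N = j % N := by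
        rw [show z * (N * N) + (i % N * N + j % N) = N * (z * N + i % N) + j % N by ring,
          Nat.mul_add_mod, Nat.mod_mod]
      rw [this, Nat.div_add_mod']

lemma sum_str {N : ℕ} (hN : 0 < N) {z : ℕ} (hz : z < N * N) (h : ℕ → ℕ → ℕ → ℕ → ℤ) :
    ∑ x ∈ range (N * N), ∑ y ∈ range (N * N), str N z x y * h (x / N) (x % N) (y / N) (y % N) =
      ∑ t ∈ range N, h (z / N) t t (z % N) := by
  have hd : ∀ i, ∀ j < N, (i * N + j) / N = i := fun i j hj => by
    rw [mul_comm, Nat.mul_add_div hN, Nat.div_eq_of_lt hj, add_zero]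
  have hm : ∀ i, ∀ j < N, (i * N + j) % N = j := fun i j hj => by
    rw [mul_comm, Nat.mul_add_mod, Nat.mod_eq_of_lt hj]
  have hz1 : z / N ∈ range N := by rw [mem_range, Nat.div_lt_iff_lt_mul hN]; exact hz
  have hz2 : z % N ∈ range N := by rw [mem_range]; exact Nat.mod_lt _ hN
  simp only [sum_range_mul_add]
  have : ∀ i ∈ range N, ∀ j ∈ range N, ∀ i' ∈ range N, ∀ j' ∈ range N,
      str N z (i * N + j) (i' * N + j') * h ((i * N + j) / N) ((i * N + j) % N)
        ((i' * N + j') / N) ((i' * N + j') % N) =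
      if z / N = i then (if j = i' then (if z % N = j' then h i j i' j' else 0) else 0) else 0 := by
    intro i _ j hj i' _ j' hj'
    rw [mem_range] at hj hj'
    simp only [str, hd _ _ hj, hm _ _ hj, hd _ _ hj', hm _ _ hj']
    by_cases h1 : z / N = i <;> by_cases h2 : j = i' <;> by_cases h3 : z % N = j' <;> simp [*]
  rw [sum_congr rfl fun i hi => sum_congr rfl fun j hj => sum_congr rfl fun i' hi' =>
    sum_congr rfl (this i hi j hj i' hi')]
  have step : ∀ i j, ∑ i' ∈ range N, ∑ j' ∈ range N,
      (if z / N = i then (if j = i' then (if z % N = j' then h i j i' j' else 0) else 0) else 0) =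
      if z / N = i then (if j ∈ range N then h i j j (z % N) else 0) else 0 := by
    intro i j
    split_ifs with h1 h2
    · rw [sum_eq_single_of_mem j h2 (fun i' _ hne => by simp [hne.symm])]
      simp only [if_true]
      rw [sum_ite_eq, if_pos hz2]
    · refine sum_eq_zero fun i' hi' => sum_eq_zero fun j' _ => ?_
      rw [if_neg]; rintro rfl; exact h2 hi'
    · simp
  simp only [step]
  rw [sum_eq_single_of_mem (z / N) hz1 (fun i _ hne => by simp [hne.symm])]
  simp only [if_true]
  exact sum_congr rfl fun j hj => if_pos hj

/-- Block multiplication: the last digit in base `N * N` locates an entry within a block, the other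
digits locate the block. For fixed last digits the remaining sum is the case `k` for submatrices of
`a` and `b`; `sum_str` then sums over the last digits. -/
lemma sum_strPow {N : ℕ} (hN : 0 < N) (k : ℕ) : ∀ (z : ℕ) (a b : ℕ → ℕ → ℤ),
    ∑ x ∈ range ((N * N) ^ k), ∑ y ∈ range ((N * N) ^ k), strPow N k z x y *
      (a (dec₁ N k x) (dec₂ N k x) * b (dec₁ N k y) (dec₂ N k y)) =
    ∑ t ∈ range (N ^ k), a (dec₁ N k z) t * b t (dec₂ N k z) := by
  induction k with
  | zero => intro z a b; simp [strPow, dec₁, dec₂]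
  | succ k ih =>
    intro z a b
    have hQ : 0 < N * N := by positivity
    have hd : ∀ i, ∀ j < N * N, (i * (N * N) + j) / (N * N) = i := fun i j hj => by
      rw [mul_comm, Nat.mul_add_div hQ, Nat.div_eq_of_lt hj, add_zero]
    have hm : ∀ i, ∀ j < N * N, (i * (N * N) + j) % (N * N) = j := fun i j hj => by
      rw [mul_comm, Nat.mul_add_mod, Nat.mod_eq_of_lt hj]
    have hm' : ∀ i j, (i * (N * N) + j) % N = j % N := fun i j => by
      rw [← mul_assoc, mul_comm, Nat.mul_add_mod]
    have hz : z % (N * N) / N = z / N % N := by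
      rw [Nat.mod_mul_left_div_self]
    calc _ = ∑ x ∈ range ((N * N) ^ k), ∑ x₀ ∈ range (N * N), ∑ y ∈ range ((N * N) ^ k),
          ∑ y₀ ∈ range (N * N), str N (z % (N * N)) x₀ y₀ * (strPow N k (z / (N * N)) x y *
            (a (dec₁ N k x * N + x₀ / N) (dec₂ N k x * N + x₀ % N) *
              b (dec₁ N k y * N + y₀ / N) (dec₂ N k y * N + y₀ % N))) := by
          have split : ∀ f : ℕ → ℤ, ∑ x ∈ range ((N * N) ^ (k + 1)), f x =
              ∑ x ∈ range ((N * N) ^ k), ∑ x₀ ∈ range (N * N), f (x * (N * N) + x₀) := fun f => by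
            rw [pow_succ, sum_range_mul_add]
          simp only [split]
          refine sum_congr rfl fun x _ => sum_congr rfl fun x₀ hx => sum_congr rfl fun y _ =>
            sum_congr rfl fun y₀ hy => ?_
          rw [mem_range] at hx hy
          simp only [strPow, dec₁_succ, dec₂_succ, hd _ _ hx, hd _ _ hy, hm _ _ hx, hm _ _ hy, hm']
          ring
      _ = ∑ x₀ ∈ range (N * N), ∑ y₀ ∈ range (N * N), str N (z % (N * N)) x₀ y₀ *
            ∑ t ∈ range (N ^ k), a (dec₁ N k (z / (N * N)) * N + x₀ / N) (t * N + x₀ % N) *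
              b (t * N + y₀ / N) (dec₂ N k (z / (N * N)) * N + y₀ % N) := by
          rw [sum_comm]
          refine sum_congr rfl fun x₀ _ => ?_
          have : ∀ x ∈ range ((N * N) ^ k), ∀ f : ℕ → ℕ → ℤ, ∑ y ∈ range ((N * N) ^ k),
            ∑ y₀ ∈ range (N * N), f y y₀ = ∑ y₀ ∈ range (N * N), ∑ y ∈ range ((N * N) ^ k), f y y₀ :=
            fun x _ f => sum_comm
          rw [sum_congr rfl fun x hx => this x hx _, sum_comm]
          refine sum_congr rfl fun y₀ _ => ?_
          simp only [← mul_sum]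
          congr 1
          exact ih (z / (N * N)) (fun i j => a (i * N + x₀ / N) (j * N + x₀ % N))
            (fun i j => b (i * N + y₀ / N) (j * N + y₀ % N))
      _ = ∑ t₀ ∈ range N, ∑ t ∈ range (N ^ k),
            a (dec₁ N k (z / (N * N)) * N + z % (N * N) / N) (t * N + t₀) *
              b (t * N + t₀) (dec₂ N k (z / (N * N)) * N + z % (N * N) % N) :=
          sum_str hN (Nat.mod_lt z hQ) fun i j i' j' => ∑ t ∈ range (N ^ k),
            a (dec₁ N k (z / (N * N)) * N + i) (t * N + j) *
              b (t * N + i') (dec₂ N k (z / (N * N)) * N + j')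
      _ = _ := by
          rw [sum_comm, pow_succ, sum_range_mul_add]
          simp only [dec₁_succ, dec₂_succ, Nat.mod_mul_right_mod]

/-- Interchanging the sums produces the tensor power of the decomposition, which `IsDecomp.pow` and
`sum_strPow` evaluate. The factor `δ ^ k` is the price for integral tables; being positive, it does
not affect comparisons of entries. -/
theorem IsDecomp.matMul {N r δ : ℕ} {F G W : ℕ → ℕ → ℤ} (h : IsDecomp N r δ F G W) (hN : 0 < N)
    (k z : ℕ) (a b : ℕ → ℕ → ℤ) :
    ∑ l ∈ range (r ^ k), ten W (N * N) r k z l *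
      ((∑ x ∈ range ((N * N) ^ k), ten F r (N * N) k l x * a (dec₁ N k x) (dec₂ N k x)) *
        ∑ y ∈ range ((N * N) ^ k), ten G r (N * N) k l y * b (dec₁ N k y) (dec₂ N k y)) =
    (δ : ℤ) ^ k * ∑ t ∈ range (N ^ k), a (dec₁ N k z) t * b t (dec₂ N k z) := by
  rw [← sum_strPow hN, mul_sum]
  simp only [sum_mul_sum]
  simp only [mul_sum]
  rw [sum_comm]
  refine sum_congr rfl fun x _ => ?_
  rw [sum_comm]
  refine sum_congr rfl fun y _ => ?_
  rw [← mul_assoc, ← h.pow hN, sum_mul]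
  refine sum_congr rfl fun l _ => ?_
  ring

/-! ### Tables from the rank -/

/-- The schoolbook method. It shows that the set whose infimum is `omega` contains `3`, hence is not
empty. -/
lemma rankLE_cube (N : ℕ) : RankLE N (N ^ 3) := by
  let e : Fin (N ^ 3) ≃ Fin N × Fin N × Fin N :=
    Fintype.equivOfCardEq (by simp; ring)
  refine ⟨fun l => Matrix.entryLinearMap ℚ ℚ (e l).1 (e l).2.1,
    fun l => Matrix.entryLinearMap ℚ ℚ (e l).2.1 (e l).2.2,
    fun l => Matrix.single (e l).1 (e l).2.2 1, fun A B => ?_⟩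
  rw [e.sum_comp (fun p => (Matrix.entryLinearMap ℚ ℚ p.1 p.2.1 A *
    Matrix.entryLinearMap ℚ ℚ p.2.1 p.2.2 B) • Matrix.single p.1 p.2.2 (1 : ℚ))]
  simp only [← univ_product_univ, sum_product]
  ext i j
  simp [Matrix.sum_apply, Matrix.mul_apply, Matrix.single_apply]
  simp only [ite_and]
  simp

/-- By `A = A * 1` the matrices `W l` span a space of dimension `N * N`. -/
lemma RankLE.sq_le {N r : ℕ} (h : RankLE N r) : N * N ≤ r := by
  obtain ⟨f, g, W, h⟩ := h
  have hs : Submodule.span ℚ (Set.range W) = ⊤ := by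
    rw [eq_top_iff]
    rintro A -
    rw [← mul_one A, h A 1]
    exact Submodule.sum_mem _ fun l _ =>
      Submodule.smul_mem _ _ (Submodule.subset_span ⟨l, rfl⟩)
  have := finrank_range_le_card (R := ℚ) W
  rw [Set.finrank, hs, finrank_top, Module.finrank_matrix] at this
  simpa using this

/-- Some `τ < omega + ε` has the rank bound `C * N ^ τ`. For `N = 2 ^ m` with `m` large, the gap in
the exponent outweighs the constant `C`. The decomposition is fixed once and for all, so its size
does not depend on the input. -/
lemma exists_rankLE {ε : ℝ} (hε : 0 < ε) : ∃ m r : ℕ, 1 ≤ m ∧ RankLE (2 ^ m) r ∧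
    (r : ℝ) ≤ (2 : ℝ) ^ ((omega + ε) * m) := by
  obtain ⟨τ, ⟨C, hC⟩, hτ⟩ := exists_lt_of_csInf_lt (s := {τ : ℝ | ∃ C : ℝ, ∀ N : ℕ, 1 ≤ N →
      ∃ r : ℕ, RankLE N r ∧ (r : ℝ) ≤ C * (N : ℝ) ^ τ})
    ⟨3, 1, fun N _ => ⟨N ^ 3, rankLE_cube N, by
      rw [one_mul]; norm_cast⟩⟩ (show omega < omega + ε by linarith)
  have hγ : 0 < omega + ε - τ := by linarith
  have h1 : (1 : ℝ) < (2 : ℝ) ^ (omega + ε - τ) := Real.one_lt_rpow (by norm_num) hγ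
  obtain ⟨m, hm⟩ := pow_unbounded_of_one_lt C h1
  have hm' : C ≤ ((2 : ℝ) ^ (omega + ε - τ)) ^ (m + 1) :=
    hm.le.trans (pow_le_pow_right₀ h1.le (by omega))
  obtain ⟨r, hr, hrC⟩ := hC (2 ^ (m + 1)) Nat.one_le_two_pow
  refine ⟨m + 1, r, by omega, hr, hrC.trans ?_⟩
  rw [← Real.rpow_natCast ((2 : ℝ) ^ (omega + ε - τ)), ← Real.rpow_mul (by norm_num)] at hm'
  push_cast at hm' ⊢
  rw [← Real.rpow_natCast, ← Real.rpow_mul (by norm_num)]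
  calc _ ≤ (2 : ℝ) ^ ((omega + ε - τ) * (m + 1)) * 2 ^ (((m + 1 : ℕ) : ℝ) * τ) := by gcongr
    _ = _ := by
      rw [← Real.rpow_add (by norm_num)]; congr 1; push_cast; ring

lemma exists_common_denominator {ι : Type*} (s : Finset ι) (q : ι → ℚ) :
    ∃ d : ℕ, 0 < d ∧ ∀ i ∈ s, ∃ z : ℤ, (d : ℚ) * q i = z := by
  refine ⟨∏ i ∈ s, (q i).den, prod_pos fun i _ => (q i).den_pos, fun i hi => ?_⟩
  obtain ⟨c, hc⟩ := dvd_prod_of_mem (fun i => (q i).den) hi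
  refine ⟨c * (q i).num, ?_⟩
  rw [hc]
  push_cast
  have := Rat.mul_den_eq_num (q i)
  linear_combination (c : ℚ) * this

lemma exists_int_table (A B : ℕ) (q : ℕ → ℕ → ℚ) : ∃ (d : ℕ) (T : ℕ → ℕ → ℤ), 0 < d ∧
    ∀ i < A, ∀ j < B, (d : ℚ) * q i j = T i j := by
  obtain ⟨d, hd, h⟩ := exists_common_denominator (range A ×ˢ range B) fun p => q p.1 p.2
  have h' : ∀ i j, ∃ z : ℤ, i < A → j < B → (d : ℚ) * q i j = z := fun i j => by
    by_cases hij : i < A ∧ j < B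
    · obtain ⟨z, hz⟩ := h (i, j) (by simpa using hij)
      exact ⟨z, fun _ _ => hz⟩
    · exact ⟨0, fun h1 h2 => absurd ⟨h1, h2⟩ hij⟩
  choose T hT using h'
  exact ⟨d, T, hd, fun i hi j hj => hT i j hi hj⟩

/-- Evaluate the bilinear identity on matrix units and clear denominators separately in the three
families of coefficients; `δ` is the product of the three denominators. -/
theorem RankLE.exists_isDecomp {N r : ℕ} (hN : 0 < N) (h : RankLE N r) :
    ∃ (δ : ℕ) (F G W : ℕ → ℕ → ℤ), IsDecomp N r δ F G W := by
  obtain ⟨f, g, w, h⟩ := h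
  have hQ : 0 < N * N := by positivity
  let row : ℕ → Fin N := fun x => ⟨x % (N * N) / N, (Nat.div_lt_iff_lt_mul hN).2 (Nat.mod_lt _ hQ)⟩
  let col : ℕ → Fin N := fun x => ⟨x % N, Nat.mod_lt _ hN⟩
  let E : ℕ → Matrix (Fin N) (Fin N) ℚ := fun x => Matrix.single (row x) (col x) 1
  obtain ⟨d₁, F, hd₁, hF⟩ := exists_int_table r (N * N) fun l x =>
    if h : l < r then f ⟨l, h⟩ (E x) else 0
  obtain ⟨d₂, G, hd₂, hG⟩ := exists_int_table r (N * N) fun l x =>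
    if h : l < r then g ⟨l, h⟩ (E x) else 0
  obtain ⟨d₃, W, hd₃, hW⟩ := exists_int_table (N * N) r fun z l =>
    if h : l < r then w ⟨l, h⟩ (row z) (col z) else 0
  refine ⟨d₁ * d₂ * d₃, F, G, W, by positivity, fun z hz x hx y hy => ?_⟩
  have key := congrFun (congrFun (h (E x) (E y)) (row z)) (col z)
  rw [Matrix.sum_apply] at key
  have hstr : (E x * E y) (row z) (col z) = (str N z x y : ℚ) := by
    have hrow : ∀ x < N * N, (row x : ℕ) = x / N := fun x hx => by
      simp [row, Nat.mod_eq_of_lt hx]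
    simp only [E]
    by_cases hc : col x = row y
    · rw [← hc, Matrix.single_mul_single_same, Matrix.single_apply]
      have hc' := congrArg Fin.val hc
      rw [hrow y hy] at hc'
      simp only [str, mul_one, Fin.ext_iff, hrow x hx, hrow z hz]
      simp only [col] at hc' ⊢
      simp only [hc', true_and, eq_comm]
      push_cast
      rfl
    · rw [Matrix.single_mul_single_of_ne (h := hc)]
      have hc' : x % N ≠ y / N := fun h => hc (Fin.ext (by rw [hrow y hy]; exact h))
      simp [str, hc']
  rw [hstr] at key
  have : ((∑ l ∈ range r, W z l * F l x * G l y : ℤ) : ℚ) = (d₁ * d₂ * d₃ : ℕ) * (str N z x y : ℚ) := by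
    rw [key]
    push_cast
    rw [Finset.sum_range, mul_sum]
    refine sum_congr rfl fun l _ => ?_
    rw [← hW z hz l l.isLt, ← hF l l.isLt x hx, ← hG l l.isLt y hy]
    simp only [l.isLt, dif_pos, Matrix.smul_apply, smul_eq_mul, Fin.eta]
    ring
  exact_mod_cast this

end MatMul

/-! ### Sets of vertices as binary numbers -/

namespace OLA

/-- The binary digit number `u` of `m`. -/
def bit (m u : ℕ) : ℕ := m / 2 ^ u % 2

lemma bit_eq (m u : ℕ) : bit m u = if m.testBit u then 1 else 0 := by
  simp only [bit, Nat.testBit_eq_decide_div_mod_eq, decide_eq_true_eq]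
  split_ifs <;> omega

/-- The vertices whose bit is set in `m`. -/
def setOf (n m : ℕ) : Finset (Fin n) := Finset.univ.filter fun v => m.testBit v

lemma mem_setOf {n m : ℕ} {v : Fin n} : v ∈ setOf n m ↔ m.testBit v := by simp [setOf]

/-- The number whose bits are the elements of `X`. -/
def mk {n : ℕ} (X : Finset (Fin n)) : ℕ := ∑ v ∈ X, 2 ^ (v : ℕ)

lemma testBit_sum_two_pow (s : Finset ℕ) (i : ℕ) :
    (∑ j ∈ s, 2 ^ j).testBit i = decide (i ∈ s) := by
  rw [Bool.eq_iff_iff, ← Nat.mem_bitIndices, ← List.mem_toFinset]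
  simp

lemma mk_eq {n : ℕ} (X : Finset (Fin n)) : mk X = ∑ j ∈ X.map Fin.valEmbedding, 2 ^ j := by
  simp [mk]

lemma testBit_mk {n : ℕ} (X : Finset (Fin n)) (v : Fin n) :
    (mk X).testBit v = decide (v ∈ X) := by
  rw [mk_eq, testBit_sum_two_pow]
  simp [Fin.val_inj]

@[simp] lemma setOf_mk {n : ℕ} (X : Finset (Fin n)) : setOf n (mk X) = X := by
  ext v; simp [mem_setOf, testBit_mk]

lemma mk_add_mk_compl {n : ℕ} (X : Finset (Fin n)) : mk X + mk Xᶜ + 1 = 2 ^ n := by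
  rw [mk, mk, Finset.sum_add_sum_compl, Fin.sum_univ_eq_sum_range (fun i => 2 ^ i),
    Nat.geomSum_eq le_rfl]
  have := Nat.one_le_two_pow (n := n)
  simp
  omega

lemma mk_lt {n : ℕ} (X : Finset (Fin n)) : mk X < 2 ^ n := by
  have := mk_add_mk_compl X
  omega

lemma mk_setOf {n m : ℕ} (hm : m < 2 ^ n) : mk (setOf n m) = m := by
  apply Nat.eq_of_testBit_eq
  intro i
  by_cases hi : i < n
  · have := testBit_mk (setOf n m) ⟨i, hi⟩
    simp only [mem_setOf] at this
    simp [this]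
  · rw [Nat.testBit_eq_false_of_lt, Nat.testBit_eq_false_of_lt]
    · exact hm.trans_le (Nat.pow_le_pow_right (by norm_num) (by omega))
    · exact (mk_lt _).trans_le (Nat.pow_le_pow_right (by norm_num) (by omega))

lemma setOf_mod (n m : ℕ) : setOf n (m % 2 ^ n) = setOf n m := by
  ext v; simp [mem_setOf]

open Classical in
/-- The adjacency matrix of a graph. -/
noncomputable def adj {n : ℕ} (G : SimpleGraph (Fin n)) (u v : ℕ) : ℤ :=
  (input G).mem (1 + u * n + v)

/-- The cut of the set with binary number `m`. -/
noncomputable def cutZ {n : ℕ} (G : SimpleGraph (Fin n)) (m : ℕ) : ℤ :=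
  ∑ u ∈ Finset.range n, ∑ v ∈ Finset.range n, (bit m u : ℤ) * (1 - bit m v) * adj G u v

/-- The size of the set with binary number `m`. -/
def pcZ (n m : ℕ) : ℤ := ∑ u ∈ Finset.range n, (bit m u : ℤ)

lemma cutZ_eq {n : ℕ} (G : SimpleGraph (Fin n)) (m : ℕ) : cutZ G m = cutN G (setOf n m) := by
  classical
  rw [cutZ, cutN, Finset.sum_range]
  push_cast
  refine Finset.sum_congr rfl fun u _ => ?_
  rw [Finset.sum_range]
  refine Finset.sum_congr rfl fun v _ => ?_
  simp only [adj, Lang.input_mem_adj, mem_setOf, bit_eq]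
  by_cases h1 : m.testBit u <;> by_cases h2 : m.testBit v <;> by_cases h3 : G.Adj u v <;> simp [*]

lemma pcZ_eq (n m : ℕ) : pcZ n m = ((setOf n m).card : ℤ) := by
  rw [pcZ, Finset.sum_range, setOf, Finset.card_filter]
  push_cast
  exact Finset.sum_congr rfl fun v _ => by rw [bit_eq]; split_ifs <;> rfl

lemma cutN_le {n : ℕ} (G : SimpleGraph (Fin n)) (X : Finset (Fin n)) : cutN G X ≤ n * n := by
  classical
  calc cutN G X ≤ ∑ _u : Fin n, ∑ _v : Fin n, 1 :=
        Finset.sum_le_sum fun u _ => Finset.sum_le_sum fun v _ => by split_ifs <;> simp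
    _ = _ := by simp

end OLA

/-! ### Evaluation of expressions and derived commands -/

namespace Lang

instance : Add Expr := ⟨.bin .add⟩
instance : Sub Expr := ⟨.bin .sub⟩
instance : Mul Expr := ⟨.bin .mul⟩
instance : Div Expr := ⟨.bin .div⟩
instance : Mod Expr := ⟨.bin .mod⟩

@[simp] lemma eval_const (c : ℤ) (s : Env) : (Expr.const c).eval s = c := rfl
@[simp] lemma eval_var (x : ℕ) (s : Env) : (Expr.var x).eval s = s.v x := rfl
@[simp] lemma eval_add (a b : Expr) (s : Env) : (a + b).eval s = a.eval s + b.eval s := rfl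
@[simp] lemma eval_sub (a b : Expr) (s : Env) : (a - b).eval s = a.eval s - b.eval s := rfl
@[simp] lemma eval_mul (a b : Expr) (s : Env) : (a * b).eval s = a.eval s * b.eval s := rfl
@[simp] lemma eval_div (a b : Expr) (s : Env) : (a / b).eval s = a.eval s / b.eval s := rfl
@[simp] lemma eval_mod (a b : Expr) (s : Env) : (a % b).eval s = a.eval s % b.eval s := rfl
@[simp] lemma eval_get (i : Fin 16) (e : Expr) (s : Env) :
    (Expr.get i e).eval s = s.a i (e.eval s).toNat := rfl
@[simp] lemma eval_ifp (c a b : Expr) (s : Env) :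
    (Expr.ifp c a b).eval s = if 0 < c.eval s then a.eval s else b.eval s := rfl
@[simp] lemma eval_letE (x : ℕ) (a b : Expr) (s : Env) :
    (Expr.letE x a b).eval s = b.eval (s.setv x (a.eval s)) := rfl

lemma foldVal_add (z : ℤ) (f : ℕ → ℤ) (N : ℕ) :
    foldVal .add z f N = z + ∑ i ∈ Finset.range N, f i := by
  induction N with
  | zero => simp
  | succ N ih => rw [foldVal_succ, ih, Finset.sum_range_succ]; simp only [Bin.eval]; ring

lemma foldVal_min_le (z : ℤ) (f : ℕ → ℤ) (N : ℕ) :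
    foldVal .min z f N ≤ z ∧ ∀ i < N, foldVal .min z f N ≤ f i := by
  induction N with
  | zero => simp
  | succ N ih =>
    rw [foldVal_succ]
    refine ⟨(min_le_left _ _).trans ih.1, fun i hi => ?_⟩
    rcases Nat.lt_succ_iff_lt_or_eq.1 hi with h | rfl
    · exact (min_le_left _ _).trans (ih.2 i h)
    · exact min_le_right _ _

lemma foldVal_min_mem (z : ℤ) (f : ℕ → ℤ) (N : ℕ) :
    foldVal .min z f N = z ∨ ∃ i < N, foldVal .min z f N = f i := by
  induction N with
  | zero => simp
  | succ N ih =>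
    rw [foldVal_succ]
    simp only [Bin.eval]
    rcases min_choice (foldVal .min z f N) (f N) with h | h
    · rw [h]
      exact ih.imp id fun ⟨i, hi, h⟩ => ⟨i, by omega, h⟩
    · exact .inr ⟨N, by omega, h⟩

/-- A sum `∑ x < b, e`. -/
def sumE (x : ℕ) (b e : Expr) : Expr := .fold .add x b (.const 0) e

lemma eval_sumE (x : ℕ) (b e : Expr) (s : Env) {N : ℕ} (hN : b.eval s = N) :
    (sumE x b e).eval s = ∑ i ∈ Finset.range N, e.eval (s.setv x i) := by
  rw [sumE, eval_fold, foldVal_add, hN]; simp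

/-- A power, computed with the loop variable `17`. -/
def powE (b e : Expr) : Expr := .fold .mul 17 e (.const 1) b

lemma eval_powE (b e : Expr) (s : Env) {N : ℕ} (hN : e.eval s = N)
    (hb : ∀ i : ℕ, b.eval (s.setv 17 i) = b.eval s) : (powE b e).eval s = b.eval s ^ N := by
  rw [powE, eval_fold, hN, Int.toNat_natCast]
  simp only [hb]
  clear hN
  induction N with
  | zero => simp
  | succ N ih => rw [foldVal_succ, ih, pow_succ]; rfl

/-- The bit `u` of the variable `y`. -/
def bitE (y : ℕ) (u : Expr) : Expr := .var y / powE (.const 2) u % .const 2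

lemma eval_bitE (y : ℕ) (u : Expr) (s : Env) {m i : ℕ} (hm : s.v y = m) (hu : u.eval s = i) :
    (bitE y u).eval s = OLA.bit m i := by
  rw [bitE, eval_mod, eval_div, eval_powE _ _ _ hu (fun _ => rfl)]
  simp [hm, OLA.bit]

/-- The cut of the vertex set in variable `y`. -/
def cutE (y : ℕ) : Expr :=
  sumE 10 (.var 0) (sumE 11 (.var 0) (bitE y (.var 10) * (.const 1 - bitE y (.var 11)) *
    .get 0 (.const 1 + .var 10 * .var 0 + .var 11)))

/-- The size of the vertex set in variable `y`. -/
def pcE (y : ℕ) : Expr := sumE 10 (.var 0) (bitE y (.var 10))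

/-- The environment holds the graph `G`. -/
structure Holds {n : ℕ} (G : SimpleGraph (Fin n)) (s : Env) : Prop where
  n : s.v 0 = n
  a : s.a 0 = (OLA.input G).mem

lemma Holds.setv {n : ℕ} {G : SimpleGraph (Fin n)} {s : Env} (h : Holds G s) {x : ℕ} (hx : 0 ≠ x)
    (z : ℤ) : Holds G (s.setv x z) :=
  ⟨(s.setv_v_of_ne z hx).trans h.n, h.a⟩

lemma eval_pcE {n : ℕ} {G : SimpleGraph (Fin n)} {s : Env} (h : Holds G s) {y m : ℕ}
    (hm : s.v y = m) (hy : 50 ≤ y) : (pcE y).eval s = OLA.pcZ n m := by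
  rw [pcE, eval_sumE _ (.var 0) _ _ h.n, OLA.pcZ]
  refine Finset.sum_congr rfl fun u _ => eval_bitE _ _ _ ?_ (by simp)
  rw [Env.setv_v_of_ne _ _ (by omega), hm]

lemma eval_cutE {n : ℕ} {G : SimpleGraph (Fin n)} {s : Env} (h : Holds G s) {y m : ℕ}
    (hm : s.v y = m) (hy : 50 ≤ y) : (cutE y).eval s = OLA.cutZ G m := by
  rw [cutE, eval_sumE _ (.var 0) _ _ h.n, OLA.cutZ]
  refine Finset.sum_congr rfl fun u _ => ?_
  rw [eval_sumE _ (.var 0) _ _ (h.setv (by norm_num) _).n]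
  refine Finset.sum_congr rfl fun v _ => ?_
  have h2 := (h.setv (x := 10) (by norm_num) (u : ℤ)).setv (x := 11) (by norm_num) (v : ℤ)
  have e1 : ((s.setv 10 u).setv 11 v).v 10 = u := by
    rw [Env.setv_v_of_ne _ _ (by norm_num)]; simp
  have e3 : ((s.setv 10 u).setv 11 v).v y = m := by
    rw [Env.setv_v_of_ne _ _ (by omega), Env.setv_v_of_ne _ _ (by omega), hm]
  rw [eval_mul, eval_mul, eval_sub, eval_bitE _ (.var 10) _ e3 e1,
    eval_bitE _ (.var 11) _ e3 (i := v) (by simp)]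
  simp only [eval_const, eval_get, eval_add, eval_mul, eval_var, h2.n, h2.a, e1,
    Env.setv_v_self, OLA.adj]
  congr 2

/-- Outside the listed variables and arrays the environments agree. -/
def Same (vs : List ℕ) (as : List (Fin 16)) (s s' : Env) : Prop :=
  (∀ y, y ∉ vs → s'.v y = s.v y) ∧ ∀ i, i ∉ as → s'.a i = s.a i

lemma Same.refl (vs : List ℕ) (as : List (Fin 16)) (s : Env) : Same vs as s s :=
  ⟨fun _ _ => rfl, fun _ _ => rfl⟩

lemma Same.trans {vs vs' ws : List ℕ} {as as' bs : List (Fin 16)} {s s' s'' : Env}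
    (h : Same vs as s s') (h' : Same vs' as' s' s'') (hv : vs ⊆ ws) (hv' : vs' ⊆ ws)
    (ha : as ⊆ bs) (ha' : as' ⊆ bs) : Same ws bs s s'' :=
  ⟨fun y hy => (h'.1 y fun h => hy (hv' h)).trans (h.1 y fun h => hy (hv h)),
    fun i hi => (h'.2 i fun h => hi (ha' h)).trans (h.2 i fun h => hi (ha h))⟩

lemma Same.mono {vs ws : List ℕ} {as bs : List (Fin 16)} {s s' : Env}
    (h : Same vs as s s') (hv : vs ⊆ ws) (ha : as ⊆ bs) : Same ws bs s s' :=
  ⟨fun y hy => h.1 y fun h => hy (hv h), fun i hi => h.2 i fun h => hi (ha h)⟩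

lemma Same.setv (s : Env) (x : ℕ) (z : ℤ) : Same [x] [] s (s.setv x z) :=
  ⟨fun y hy => s.setv_v_of_ne z (by simpa using hy), fun _ _ => rfl⟩

lemma Same.holds {n : ℕ} {G : SimpleGraph (Fin n)} {vs : List ℕ} {as : List (Fin 16)} {s s' : Env}
    (h : Same vs as s s') (hs : Holds G s) (h0 : 0 ∉ vs) (ha : 0 ∉ as) : Holds G s' :=
  ⟨(h.1 0 h0).trans hs.n, (h.2 0 ha).trans hs.a⟩

/-- Filling a segment of an array. -/
lemma triple_fill {P x : ℕ} {b : Expr} {i : Fin 16} {e₁ e₂ : Expr} {s : Env} (N off : ℕ)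
    (f : ℕ → ℤ) (hs : s.Good P) (hN : b.eval s = N) (hNP : N < 2 ^ P) (hx : smallVar x → N ≤ P)
    (hf : ∀ j < N, (f j).natAbs < 2 ^ P) (hfs : smallArr i → ∀ j < N, (f j).natAbs ≤ P)
    (hev : ∀ j < N, ∀ s', Same [x] [i] s s' → s'.v x = j →
      (∀ l, s'.a i l = if off ≤ l ∧ l < off + j then f (l - off) else s.a i l) →
      e₁.eval s' = (off + j : ℕ) ∧ e₂.eval s' = f j) :
    Triple P (.loop x b (.store i e₁ e₂)) s (1 + N * 2) fun s' => s'.Good P ∧ Same [x] [i] s s' ∧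
      ∀ l, s'.a i l = if off ≤ l ∧ l < off + N then f (l - off) else s.a i l := by
  refine Triple.loop (M := 1) (fun j s' => s'.Good P ∧ Same [x] [i] s s' ∧
    ∀ l, s'.a i l = if off ≤ l ∧ l < off + j then f (l - off) else s.a i l) hs (by rw [hN]; simp)
    ⟨hs, Same.refl _ _ _, fun l => by rw [if_neg (by omega)]⟩ ?_
  rintro j hj s' ⟨hg, hsame, hl⟩
  have hg' : (s'.setv x j).Good P := hg.setv (by simp; omega) (fun h => by have := hx h; simp; omega)
  have hsame' : Same [x] [i] s (s'.setv x j) :=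
    hsame.trans (Same.setv _ _ _) (by simp) (by simp) (by simp) (by simp)
  obtain ⟨h1, h2⟩ := hev j hj _ hsame' (by simp) hl
  have key : ∀ l, Function.update ((s'.setv x j).a i) (e₁.eval (s'.setv x j)).toNat
      (e₂.eval (s'.setv x j)) l =
      if off ≤ l ∧ l < off + (j + 1) then f (l - off) else s.a i l := fun l => by
    rw [h1, h2, Int.toNat_natCast, Function.update_apply]
    split_ifs with c1 c2 c2
    · rw [c1]; congr 1; omega
    · omega
    · exact (hl l).trans (if_pos (by omega))
    · exact (hl l).trans (if_neg (by omega))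
  refine Triple.store hg' ⟨hg'.seta (fun l => ?_) (fun hi l => ?_), ?_, fun l => ?_⟩
  · rw [Function.update_apply]
    split_ifs
    · rw [h2]; exact hf j hj
    · exact hg'.a i l
  · rw [Function.update_apply]
    split_ifs
    · rw [h2]; exact hfs hi j hj
    · exact hg'.sa i l hi
  · refine ⟨hsame'.1, fun k hk => ?_⟩
    have hki : k ≠ i := by simpa using hk
    simp only [Env.seta, Function.update_of_ne hki]
    exact hsame'.2 k hk
  · rw [← key l]; simp [Env.seta]

/-- Finds the index of a largest cell among the first cells of array `i`. -/
def argmax (i : Fin 16) (b : Expr) : Cmd :=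
  .seq (.assign 62 (.const 0)) <|
    .loop 52 b (.assign 62 (.ifp (.get i (.var 52) - .get i (.var 62)) (.var 52) (.var 62)))

lemma triple_argmax {P : ℕ} {b : Expr} {i : Fin 16} {s : Env} (N : ℕ) (hs : s.Good P)
    (hb : ∀ z, b.eval (s.setv 62 z) = N) (hN0 : 0 < N) (hNP : N < 2 ^ P) :
    Triple P (argmax i b) s (2 + N * 2) fun s' => s'.Good P ∧ Same [52, 62] [] s s' ∧
      ∃ z < N, s'.v 62 = (z : ℕ) ∧ ∀ j < N, s.a i j ≤ s.a i z := by
  have h0 : (s.setv 62 0).Good P := hs.setv_small (by simp)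
  refine ((Triple.assign hs (Q := fun s' => s' = s.setv 62 0) rfl).seq (N₂ := 1 + N * (1 + 1)) ?_).mono
    (by omega) fun s' h => h
  rintro _ rfl
  refine (Triple.loop (M := 1) (fun j s' => s'.Good P ∧ Same [52, 62] [] s s' ∧
      ∃ z < N, s'.v 62 = (z : ℕ) ∧ ∀ k < j, s.a i k ≤ s.a i z) h0 (by rw [hb]; simp)
    ⟨h0, (Same.setv _ _ _).mono (by simp) (by simp), 0, hN0, by simp, by simp⟩ ?_)
  rintro j hj s' ⟨hg, hsame, z, hz, hz1, hz2⟩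
  have hg' : (s'.setv 52 j).Good P := hg.setv (by simp; omega) (by simp)
  have ha : s'.a = s.a := funext fun k => hsame.2 k (by simp)
  have hz1' : (s'.setv 52 j).v 62 = z := by rw [Env.setv_v_of_ne _ _ (by norm_num), hz1]
  refine Triple.assign hg' ?_
  simp only [eval_ifp, eval_sub, eval_get, eval_var, Env.setv_v_self, hz1', Env.setv_a, ha,
    Int.toNat_natCast]
  have hsame' : ∀ w, Same [52, 62] [] s ((s'.setv 52 j).setv 62 w) := fun w =>
    (hsame.trans (Same.setv _ _ _) (ws := [52, 62]) (bs := []) (by simp) (by simp) (by simp)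
      (by simp)).trans (Same.setv _ _ _) (by simp) (by simp) (by simp) (by simp)
  split_ifs with hc
  · refine ⟨hg'.setv (by simp; omega) (by simp), hsame' _, j, hj, by simp, fun k hk => ?_⟩
    rcases Nat.lt_succ_iff_lt_or_eq.1 hk with h | rfl
    · have := hz2 k h; omega
    · exact le_rfl
  · refine ⟨hg'.setv (by simp; omega) (by simp), hsame' _, z, hz, by simp, fun k hk => ?_⟩
    rcases Nat.lt_succ_iff_lt_or_eq.1 hk with h | rfl
    · exact hz2 k h
    · omega

end Lang

/-! ### Dynamic programming over sets of vertices -/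

namespace OLA

open Lang

/-- The contribution of the last element `v` of the set `X` to the coded cost of an ordering. -/
noncomputable def wt {n : ℕ} (G : SimpleGraph (Fin n)) (X : Finset (Fin n)) (v : Fin n) : ℤ :=
  cutN G X * (n + 1) ^ n + (X.card - 1) * (n + 1) ^ (v : ℕ)

lemma wt_le {n : ℕ} (G : SimpleGraph (Fin n)) (X : Finset (Fin n)) (v : Fin n) :
    wt G X v ≤ (n + 1) ^ (n + 2) := by
  have h1 : (cutN G X : ℤ) ≤ n * n := by exact_mod_cast cutN_le G X
  have h2 : (X.card : ℤ) ≤ n := by exact_mod_cast (Finset.card_le_univ X).trans_eq (by simp)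
  have h3 : ((n : ℤ) + 1) ^ (v : ℕ) ≤ (n + 1) ^ n := pow_le_pow_right₀ (by omega) v.2.le
  have h4 : (0 : ℤ) < ((n : ℤ) + 1) ^ (v : ℕ) := by positivity
  unfold wt
  calc _ ≤ (n * n : ℤ) * (n + 1) ^ n + n * (n + 1) ^ n := by
        gcongr
        nlinarith
    _ ≤ _ := by
        rw [pow_add]
        nlinarith [show (0 : ℤ) < ((n : ℤ) + 1) ^ n by positivity]

/-- Values of the dynamic program, indexed by the number of steps. -/
noncomputable def dpAux {n : ℕ} (G : SimpleGraph (Fin n)) (B : Finset (Fin n)) (init big : ℤ) :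
    ℕ → Finset (Fin n) → ℤ
  | 0, _ => init
  | c + 1, D => cutN G (B ∪ D) * (n + 1) ^ n + foldVal .min big (fun v =>
      if h : v < n then
        if (⟨v, h⟩ : Fin n) ∈ D then
          dpAux G B init big c (D.erase ⟨v, h⟩) + ((B ∪ D).card - 1) * (n + 1) ^ v
        else big
      else big) n

/-- The value of the dynamic program at `B ∪ D` when it starts at `B` with the value `init`. -/
noncomputable def dp {n : ℕ} (G : SimpleGraph (Fin n)) (B : Finset (Fin n)) (init big : ℤ)
    (D : Finset (Fin n)) : ℤ := dpAux G B init big D.card D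

/-! ### The values of the dynamic program and the orderings they encode -/

section dp

variable {n : ℕ} (G : SimpleGraph (Fin n)) (B : Finset (Fin n)) {init big : ℤ}

@[simp] lemma dp_empty : dp G B init big ∅ = init := rfl

lemma dp_eq {D : Finset (Fin n)} (hD : D.Nonempty) : dp G B init big D =
    cutN G (B ∪ D) * (n + 1) ^ n + foldVal .min big (fun v =>
      if h : v < n then
        if (⟨v, h⟩ : Fin n) ∈ D then
          dp G B init big (D.erase ⟨v, h⟩) + ((B ∪ D).card - 1) * (n + 1) ^ v
        else big
      else big) n := by
  obtain ⟨c, hc⟩ := Nat.exists_eq_succ_of_ne_zero hD.card_pos.ne'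
  rw [dp, hc, dpAux]
  congr 2
  funext v
  split_ifs with h1 h2
  · rw [dp, Finset.card_erase_of_mem h2, hc]; rfl
  · rfl
  · rfl

lemma dp_le {D : Finset (Fin n)} {v : Fin n} (hv : v ∈ D) :
    dp G B init big D ≤ dp G B init big (D.erase v) + wt G (B ∪ D) v := by
  rw [dp_eq G B ⟨v, hv⟩, wt]
  refine (Int.add_le_add_left ((foldVal_min_le _ _ _).2 v v.2) _).trans_eq ?_
  simp only [v.2, dif_pos, Fin.eta, hv, if_true]
  ring

lemma dp_nonneg (h0 : 0 ≤ init) (hb : 0 ≤ big) (D : Finset (Fin n)) : 0 ≤ dp G B init big D := by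
  induction D using Finset.strongInduction with
  | H D ih =>
    rcases D.eq_empty_or_nonempty with rfl | hD
    · simpa
    rw [dp_eq G B hD]
    refine add_nonneg (by positivity) ?_
    rcases foldVal_min_mem big (fun v =>
      if h : v < n then
        if (⟨v, h⟩ : Fin n) ∈ D then
          dp G B init big (D.erase ⟨v, h⟩) + ((B ∪ D).card - 1) * (n + 1) ^ v
        else big
      else big) n with h | ⟨v, hv, h⟩
    · rw [h]; exact hb
    · rw [h, dif_pos hv]
      split_ifs with h2
      · refine add_nonneg (ih _ (Finset.erase_ssubset h2)) (mul_nonneg ?_ (by positivity))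
        have : 0 < (B ∪ D).card := Finset.card_pos.2 (hD.mono Finset.subset_union_right)
        omega
      · exact hb

/-- Following any order of removal adds at most `(n + 1) ^ (n + 2)` in each step, whatever `big` is.
So a larger `big` can never be the minimum. -/
lemma dp_le_mul (D : Finset (Fin n)) :
    dp G B init big D ≤ init + D.card * (n + 1) ^ (n + 2) := by
  induction D using Finset.strongInduction with
  | H D ih =>
    rcases D.eq_empty_or_nonempty with rfl | ⟨v, hv⟩
    · simp
    · have h1 := ih _ (Finset.erase_ssubset hv)
      rw [Finset.card_erase_of_mem hv] at h1
      have h2 := dp_le G B (init := init) (big := big) hv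
      have h3 := wt_le G (B ∪ D) v
      have h4 := Finset.card_pos.2 ⟨v, hv⟩
      push_cast [Nat.cast_sub h4] at h1
      linarith

/-- If the minimum were the placeholder `big`, the value would exceed the bound of `dp_le_mul`; so
it comes from an element of `D`. -/
lemma exists_dp_eq {D : Finset (Fin n)} (hD : D.Nonempty)
    (hb : init + D.card * (n + 1) ^ (n + 2) < big) :
    ∃ v ∈ D, dp G B init big D = dp G B init big (D.erase v) + wt G (B ∪ D) v := by
  have hle := dp_le_mul G B (init := init) (big := big) D
  rw [dp_eq G B hD] at hle ⊢
  rcases foldVal_min_mem big (fun v =>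
      if h : v < n then
        if (⟨v, h⟩ : Fin n) ∈ D then
          dp G B init big (D.erase ⟨v, h⟩) + ((B ∪ D).card - 1) * (n + 1) ^ v
        else big
      else big) n with h | ⟨v, hv, h⟩
  · rw [h] at hle
    have : (0 : ℤ) ≤ cutN G (B ∪ D) * (n + 1) ^ n := by positivity
    omega
  · rw [dif_pos hv] at h
    split_ifs at h with h2
    · exact ⟨⟨v, hv⟩, h2, by rw [h, wt]; ring⟩
    · rw [h] at hle
      have : (0 : ℤ) ≤ cutN G (B ∪ D) * (n + 1) ^ n := by positivity
      omega

/-- The coded cost of the arrangement of `X` by the positions `p`. -/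
noncomputable def val (X : Finset (Fin n)) (p : Fin n → ℕ) : ℤ :=
  ∑ v ∈ X, wt G (X.filter fun u => p u ≤ p v) v

/-- `p` arranges the elements of `X` at the first positions. -/
def Arranges (X : Finset (Fin n)) (p : Fin n → ℕ) : Prop :=
  (∀ v ∈ X, p v < X.card) ∧ Set.InjOn p X

/-- Trace the minimum back: the minimizing `v` gets the last position, and the prefixes of all other
elements stay as they were. -/
lemma exists_val_eq_dp {p : Fin n → ℕ} (hp : Arranges B p) (D : Finset (Fin n))
    (hBD : Disjoint B D) (hb : val G B p + D.card * (n + 1) ^ (n + 2) < big) :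
    ∃ p', Arranges (B ∪ D) p' ∧ (∀ v ∈ B, p' v = p v) ∧
      val G (B ∪ D) p' = dp G B (val G B p) big D := by
  induction D using Finset.strongInduction with
  | H D ih =>
    rcases D.eq_empty_or_nonempty with rfl | hD
    · exact ⟨p, by simpa using hp, fun _ _ => rfl, by simp⟩
    obtain ⟨v, hv, hdp⟩ := exists_dp_eq G B hD hb
    obtain ⟨p', ⟨h1, h2⟩, h3, h4⟩ := ih _ (Finset.erase_ssubset hv)
      (hBD.mono_right (Finset.erase_subset _ _)) (by
        have : (((D.erase v).card : ℕ) : ℤ) ≤ D.card := by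
          exact_mod_cast Finset.card_le_card (Finset.erase_subset _ _)
        have h5 : (0 : ℤ) ≤ (n + 1) ^ (n + 2) := by positivity
        nlinarith)
    have hvB : v ∉ B := fun h => Finset.disjoint_left.1 hBD h hv
    have hvE : v ∉ B ∪ D.erase v := by simp [hvB]
    have hX : B ∪ D = insert v (B ∪ D.erase v) := by
      rw [← Finset.union_insert, Finset.insert_erase hv]
    set Y := B ∪ D.erase v with hY
    have hcard : (B ∪ D).card = Y.card + 1 := by rw [hX, Finset.card_insert_of_notMem hvE]
    have hq : ∀ u ∈ Y, Function.update p' v Y.card u = p' u := fun u hu =>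
      Function.update_of_ne (fun h : u = v => hvE (h ▸ hu)) _ _
    have hqv : Function.update p' v Y.card v = Y.card := Function.update_self _ _ _
    refine ⟨Function.update p' v Y.card, ⟨fun u hu => ?_, ?_⟩, fun u hu => ?_, ?_⟩
    · rw [hcard]
      rw [hX, Finset.mem_insert] at hu
      rcases hu with rfl | hu
      · rw [hqv]; omega
      · rw [hq u hu]; have := h1 u hu; omega
    · rw [hX, Finset.coe_insert]
      intro x hx y hy hxy
      rcases Set.mem_insert_iff.1 hx with rfl | hx <;> rcases Set.mem_insert_iff.1 hy with rfl | hy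
      · rfl
      · rw [hqv, hq y hy] at hxy; have := h1 y hy; omega
      · rw [hqv, hq x hx] at hxy; have := h1 x hx; omega
      · rw [hq x hx, hq y hy] at hxy; exact h2 hx hy hxy
    · rw [hq u (Finset.mem_union_left _ hu), h3 u hu]
    · rw [hdp, ← h4, val, val, hX, Finset.sum_insert hvE, add_comm]
      congr 1
      · refine Finset.sum_congr rfl fun u hu => ?_
        congr 1
        rw [Finset.filter_insert, hqv, hq u hu, if_neg (by have := h1 u hu; omega)]
        exact Finset.filter_congr fun x hx => by rw [hq x hx]
      · congr 1
        rw [Finset.filter_true_of_mem]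
        intro x hx
        rcases Finset.mem_insert.1 hx with rfl | hx
        · exact le_rfl
        · rw [hqv, hq x hx]; exact (h1 x hx).le

/-- The coded cost of an ordering. -/
noncomputable def code (π : Equiv.Perm (Fin n)) : ℤ :=
  cost G π * (n + 1) ^ n + ∑ v, ((π v : ℕ) : ℤ) * (n + 1) ^ (v : ℕ)

lemma pre_succ_card (π : Equiv.Perm (Fin n)) (v : Fin n) :
    (pre π (π v + 1)).card = (π v : ℕ) + 1 := card_pre π (by omega)

lemma sum_wt (π : Equiv.Perm (Fin n)) : ∑ v, wt G (pre π (π v + 1)) v = code G π := by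
  simp only [wt, Finset.sum_add_distrib, code, ← Finset.sum_mul, pre_succ_card]
  congr 1
  · congr 1
    rw [cost_eq_sum_cutN]
    rw [Equiv.sum_comp π (fun i => ((cutN G (pre π (i + 1)) : ℕ) : ℤ)),
      Fin.sum_univ_eq_sum_range (fun i => ((cutN G (pre π (i + 1)) : ℕ) : ℤ))]
    rcases Nat.eq_zero_or_pos n with rfl | hn
    · simp
    obtain ⟨m, rfl⟩ := Nat.exists_eq_succ_of_ne_zero hn.ne'
    rw [Finset.sum_range_succ, Finset.sum_Ico_eq_sum_range]
    have : pre π (m + 1) = Finset.univ := by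
      ext v; simp [mem_pre, Nat.lt_succ_iff.1 (π v).2]
    -- The weights also include the prefix of all `n` vertices, which `cost` omits; no edge leaves
    -- it.
    have h0 : cutN G Finset.univ = 0 := by simp [cutN]
    rw [this, h0]
    push_cast
    simp [add_comm]
  · exact Finset.sum_congr rfl fun v _ => by push_cast; ring

lemma pre_succ (π : Equiv.Perm (Fin n)) (v : Fin n) :
    pre π (π v + 1) = insert v (pre π (π v)) := by
  ext u
  simp only [mem_pre, Finset.mem_insert, Nat.lt_succ_iff_lt_or_eq, ← π.injective.eq_iff (a := u),
    ← Fin.val_inj]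
  exact or_comm

/-- The prefixes of `π` are one admissible path through the recursion, and `dp_le` bounds each of
its steps. -/
lemma dp_le_sum (π : Equiv.Perm (Fin n)) {a : ℕ} : ∀ b, a ≤ b → b ≤ n →
    dp G (pre π a) init big (pre π b \ pre π a) ≤ init +
      ∑ v ∈ pre π b \ pre π a, wt G (pre π (π v + 1)) v := by
  intro b hab
  induction b, hab using Nat.le_induction with
  | base => simp
  | succ b hab ih =>
    intro hb
    set v := π.symm ⟨b, hb⟩ with hv
    have hpv : ((π v : Fin n) : ℕ) = b := by simp [hv]
    have h1 : v ∈ pre π (b + 1) \ pre π a := by simp [mem_pre, hpv]; omega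
    have h2 : (pre π (b + 1) \ pre π a).erase v = pre π b \ pre π a := by
      have := pre_succ π v
      rw [hpv] at this
      rw [this, ← Finset.erase_sdiff_comm, Finset.erase_insert (by simp [mem_pre, hpv])]
    have h3 : pre π a ∪ (pre π (b + 1) \ pre π a) = pre π (b + 1) := by
      apply Finset.union_sdiff_of_subset
      intro u hu
      rw [mem_pre] at *
      omega
    have h4 := dp_le G (pre π a) (init := init) (big := big) h1
    rw [h2, h3] at h4
    rw [← Finset.add_sum_erase _ _ h1, h2, hpv]
    have := ih (by omega)
    linarith

lemma digits_sum (b : ℕ) : ∀ (n : ℕ) (d : ℕ → ℕ) (c : ℕ), (∀ u < n, d u < b) → ∀ v < n,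
    (∑ u ∈ Finset.range n, d u * b ^ u + c * b ^ n) / b ^ v % b = d v := by
  intro n
  induction n with
  | zero => intro _ _ _ v hv; omega
  | succ n ih =>
    intro d c hd v hv
    have hb : 0 < b := (Nat.zero_le _).trans_lt (hd 0 (by omega))
    have h1 : ∑ u ∈ Finset.range (n + 1), d u * b ^ u + c * b ^ (n + 1) =
        d 0 + b * (∑ u ∈ Finset.range n, d (u + 1) * b ^ u + c * b ^ n) := by
      rw [Finset.sum_range_succ', mul_add, Finset.mul_sum, pow_zero, mul_one]
      have : ∀ u, d (u + 1) * b ^ (u + 1) = b * (d (u + 1) * b ^ u) := fun u => by ring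
      simp only [this]
      ring
    rw [h1]
    rcases v with _ | v
    · rw [pow_zero, Nat.div_one, Nat.add_mul_mod_self_left, Nat.mod_eq_of_lt (hd 0 (by omega))]
    · rw [pow_succ', ← Nat.div_div_eq_div_mul, Nat.add_mul_div_left _ _ hb,
        Nat.div_eq_of_lt (hd 0 (by omega)), zero_add]
      exact ih (fun u => d (u + 1)) c (fun u hu => hd _ (by omega)) v (by omega)

/-- Positions are smaller than the base `n + 1`, hence are the digits of the code below `(n + 1) ^
n`. The optimum thus carries its own ordering, and no predecessors have to be stored. -/
lemma code_div_mod (π : Equiv.Perm (Fin n)) (v : Fin n) :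
    code G π / (n + 1) ^ (v : ℕ) % (n + 1) = ((π v : ℕ) : ℤ) := by
  have h := digits_sum (n + 1) n (fun u => if h : u < n then (π ⟨u, h⟩ : ℕ) else 0) (cost G π)
    (fun u hu => by simp only [hu, dif_pos]; omega) v v.2
  simp only [v.2, dif_pos, Fin.eta] at h
  rw [← h, code, Finset.sum_range]
  push_cast
  simp only [Fin.is_lt, dif_pos, Fin.eta]
  rw [add_comm]

lemma sum_digits_lt (π : Equiv.Perm (Fin n)) :
    ∑ v, ((π v : ℕ) : ℤ) * (n + 1) ^ (v : ℕ) < (n + 1) ^ n := by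
  have h : ∑ v : Fin n, (n : ℤ) * (n + 1) ^ (v : ℕ) = (n + 1) ^ n - 1 := by
    rw [← Finset.mul_sum, Fin.sum_univ_eq_sum_range (fun i => ((n : ℤ) + 1) ^ i), mul_comm]
    simpa using geom_sum_mul ((n : ℤ) + 1) n
  calc _ ≤ ∑ v : Fin n, (n : ℤ) * (n + 1) ^ (v : ℕ) := by
        gcongr with v
        omega
    _ < _ := by omega

/-- Two runs of the dynamic program find the best ordering that starts with `S`. -/
theorem exists_optimal_extension (S : Finset (Fin n))
    (hbig : (n : ℤ) * (n + 1) ^ (n + 2) < big) :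
    ∃ π, dp G S (dp G ∅ 0 big S) big Sᶜ = code G π ∧
      ∀ π', pre π' S.card = S → cost G π ≤ cost G π' := by
  have hS : S.card ≤ n := (Finset.card_le_univ S).trans_eq (by simp)
  have hU : (0 : ℤ) ≤ (n + 1) ^ (n + 2) := by positivity
  have hSU : (S.card : ℤ) * (n + 1) ^ (n + 2) ≤ n * (n + 1) ^ (n + 2) := by gcongr
  obtain ⟨p, hp1, -, hp2⟩ := exists_val_eq_dp G ∅ (p := fun _ => 0) (big := big)
    ⟨by simp, by simp⟩ S (by simp) (by simp [val]; omega)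
  simp only [Finset.empty_union] at hp1 hp2
  have h0 : val G ∅ (fun _ => 0) = 0 := rfl
  rw [h0] at hp2
  have hc : ((Sᶜ.card : ℕ) : ℤ) = n - S.card := by
    rw [Finset.card_compl, Fintype.card_fin, Nat.cast_sub hS]
  have hpS := dp_le_mul G ∅ (init := 0) (big := big) S
  obtain ⟨q, hq1, hq2, hq3⟩ := exists_val_eq_dp G S (big := big) hp1 Sᶜ disjoint_compl_right
    (by rw [hp2, hc]; linarith)
  rw [Finset.union_compl] at hq1 hq3
  rw [hp2] at hq3
  have hqn : ∀ v, q v < n := fun v => by simpa using hq1.1 v (Finset.mem_univ v)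
  let f : Fin n → Fin n := fun v => ⟨q v, hqn v⟩
  have hf : Function.Injective f := fun u v h =>
    hq1.2 (Finset.mem_coe.2 (Finset.mem_univ _)) (Finset.mem_coe.2 (Finset.mem_univ _))
      (by simpa [f] using h)
  let π : Equiv.Perm (Fin n) := Equiv.ofBijective f (Finite.injective_iff_bijective.1 hf)
  have hπ : ∀ v, ((π v : Fin n) : ℕ) = q v := fun v => rfl
  have hcode : dp G S (dp G ∅ 0 big S) big Sᶜ = code G π := by
    rw [← hq3, ← sum_wt, val]
    refine Finset.sum_congr rfl fun v _ => ?_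
    congr 1
    ext u
    simp [mem_pre, hπ]
  refine ⟨π, hcode, fun π' hπ' => ?_⟩
  have h1 := dp_le_sum G π' (init := 0) (big := big) (a := 0) S.card (Nat.zero_le _) hS
  have h2 := dp_le_sum G π' (init := dp G ∅ 0 big S) (big := big) n hS le_rfl
  have e0 : pre π' 0 = ∅ := by ext; simp [mem_pre]
  have e1 : pre π' n = Finset.univ := by ext; simp [mem_pre]
  rw [hπ', e0, Finset.sdiff_empty, zero_add] at h1
  rw [hπ', e1, ← Finset.compl_eq_univ_sdiff] at h2
  have h3 : code G π ≤ code G π' := by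
    rw [← hcode, ← sum_wt G π', ← Finset.sum_add_sum_compl S]
    linarith
  -- The digits amount to less than `(n + 1) ^ n`, so a difference of one in the cost already
  -- decides the comparison of codes.
  by_contra hlt
  have h4 : (cost G π' : ℤ) + 1 ≤ cost G π := by omega
  have h5 := sum_digits_lt π'
  have h6 : 0 ≤ ∑ v, ((π v : ℕ) : ℤ) * (n + 1) ^ (v : ℕ) := by positivity
  have h7 : (0 : ℤ) < (n + 1) ^ n := by positivity
  have h8 := mul_le_mul_of_nonneg_right h4 h7.le
  unfold code at h3
  linarith

end dp

end OLA

/-! ### The dynamic program as a command -/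

namespace OLA

/-- The number of bits of `m` below position `v`. -/
def rk (m v : ℕ) : ℕ := ∑ u ∈ Finset.range v, bit m u

lemma rk_lt_rk {m u v : ℕ} (huv : u < v) (hu : m.testBit u) : rk m u < rk m v := by
  have h : rk m (u + 1) ≤ rk m v :=
    Finset.sum_le_sum_of_subset (Finset.range_mono (by omega))
  have : rk m (u + 1) = rk m u + 1 := by
    rw [rk, Finset.sum_range_succ, bit_eq, if_pos hu]; rfl
  omega

lemma rk_eq_card (n m : ℕ) : rk m n = (setOf n m).card := by
  have := pcZ_eq n m
  rw [pcZ] at this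
  rw [rk]
  exact_mod_cast this

lemma rk_injOn (n m : ℕ) : Set.InjOn (fun v : Fin n => rk m v) (setOf n m) := by
  intro u hu v hv h
  rw [Finset.mem_coe, mem_setOf] at hu hv
  rcases lt_trichotomy (u : ℕ) v with h' | h' | h'
  · exact absurd h (rk_lt_rk h' hu).ne
  · exact Fin.ext h'
  · exact absurd h (rk_lt_rk h' hv).ne'

/-- The ranks of the elements leave no gap. Hence the subsets of a set with `c` elements are indexed
by the numbers below `2 ^ c`, and the table has `2 ^ c` cells instead of `2 ^ n`. -/
lemma image_rk (n m : ℕ) :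
    (setOf n m).image (fun v : Fin n => rk m v) = Finset.range (setOf n m).card := by
  apply Finset.eq_of_subset_of_card_le
  · intro i hi
    obtain ⟨v, hv, rfl⟩ := Finset.mem_image.1 hi
    rw [Finset.mem_range, ← rk_eq_card]
    exact rk_lt_rk v.2 (mem_setOf.1 hv)
  · rw [Finset.card_image_of_injOn (rk_injOn n m), Finset.card_range]

/-- The subset with index `j` of the set with binary number `m`. -/
def sub (n m j : ℕ) : Finset (Fin n) := (setOf n m).filter fun v => j.testBit (rk m v)

lemma mem_sub {n m j : ℕ} {v : Fin n} : v ∈ sub n m j ↔ m.testBit v ∧ j.testBit (rk m v) := by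
  rw [sub, Finset.mem_filter, mem_setOf]

lemma sub_subset (n m j : ℕ) : sub n m j ⊆ setOf n m := Finset.filter_subset _ _

lemma sum_rk_eq {n m : ℕ} {X : Finset (Fin n)} (hX : X ⊆ setOf n m) :
    ∑ v ∈ X, 2 ^ rk m v = ∑ i ∈ X.image (fun v : Fin n => rk m v), 2 ^ i := by
  rw [Finset.sum_image]
  exact fun u hu v hv h => rk_injOn n m (hX hu) (hX hv) h

lemma testBit_sum_rk {n m : ℕ} {X : Finset (Fin n)} (hX : X ⊆ setOf n m) {u : Fin n}
    (hu : m.testBit u) : (∑ v ∈ X, 2 ^ rk m v).testBit (rk m u) = decide (u ∈ X) := by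
  rw [sum_rk_eq hX, testBit_sum_two_pow, decide_eq_decide, Finset.mem_image]
  constructor
  · rintro ⟨v, hv, h⟩
    rwa [← rk_injOn n m (hX hv) (Finset.mem_coe.2 (mem_setOf.2 hu)) h]
  · exact fun h => ⟨u, h, rfl⟩

lemma sum_sub {n m j : ℕ} (hj : j < 2 ^ (setOf n m).card) : ∑ v ∈ sub n m j, 2 ^ rk m v = j := by
  apply Nat.eq_of_testBit_eq
  intro i
  rw [sum_rk_eq (sub_subset n m j), testBit_sum_two_pow, Bool.eq_iff_iff, decide_eq_true_iff,
    Finset.mem_image]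
  constructor
  · rintro ⟨v, hv, rfl⟩
    exact (mem_sub.1 hv).2
  · intro h
    have hi : i ∈ Finset.range (setOf n m).card := by
      rw [Finset.mem_range]
      by_contra hi
      rw [Nat.testBit_eq_false_of_lt (hj.trans_le (Nat.pow_le_pow_right (by norm_num)
        (by omega)))] at h
      cases h
    rw [← image_rk] at hi
    obtain ⟨v, hv, rfl⟩ := Finset.mem_image.1 hi
    exact ⟨v, mem_sub.2 ⟨mem_setOf.1 hv, h⟩, rfl⟩

lemma sub_zero (n m : ℕ) : sub n m 0 = ∅ := by ext v; simp [mem_sub]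

lemma sub_nonempty {n m j : ℕ} (hj0 : 0 < j) (hj : j < 2 ^ (setOf n m).card) :
    (sub n m j).Nonempty := by
  rw [Finset.nonempty_iff_ne_empty]
  intro h
  have := sum_sub hj
  rw [h, Finset.sum_empty] at this
  omega

/-- Removing `v` clears the bit `rk m v` of the index. Since the index decreases, filling the table
by increasing index respects the recursion. -/
lemma sub_sub {n m j : ℕ} (hj : j < 2 ^ (setOf n m).card) {v : Fin n} (hv : v ∈ sub n m j) :
    2 ^ rk m v ≤ j ∧ sub n m (j - 2 ^ rk m v) = (sub n m j).erase v := by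
  have h := sum_sub hj
  rw [← Finset.add_sum_erase _ _ hv] at h
  refine ⟨by omega, ?_⟩
  have h2 : j - 2 ^ rk m v = ∑ u ∈ (sub n m j).erase v, 2 ^ rk m u := by omega
  have h3 := (Finset.erase_subset v (sub n m j)).trans (sub_subset n m j)
  ext u
  rw [mem_sub, h2]
  constructor
  · rintro ⟨h4, h5⟩
    rw [testBit_sum_rk h3 h4] at h5
    simpa using h5
  · intro h4
    have h5 := mem_setOf.1 (h3 h4)
    refine ⟨h5, ?_⟩
    rw [testBit_sum_rk h3 h5]
    simpa using h4

lemma sub_last (n m : ℕ) : sub n m (2 ^ (setOf n m).card - 1) = setOf n m := by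
  apply Finset.filter_true_of_mem
  intro v hv
  rw [Nat.testBit_two_pow_sub_one]
  have := rk_lt_rk v.2 (mem_setOf.1 hv)
  rw [rk_eq_card n] at this
  simpa

lemma mk_sub (n m j : ℕ) :
    (mk (sub n m j) : ℤ) =
      ∑ v ∈ Finset.range n, (bit m v : ℤ) * bit j (rk m v) * 2 ^ v := by
  rw [mk, sub, setOf, Finset.filter_filter, Finset.sum_filter, Finset.sum_range]
  push_cast
  refine Finset.sum_congr rfl fun v _ => ?_
  rw [bit_eq, bit_eq]
  by_cases h1 : m.testBit v <;> by_cases h2 : j.testBit (rk m v) <;> simp [h1, h2]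

lemma mk_union {n : ℕ} {X Y : Finset (Fin n)} (h : Disjoint X Y) : mk (X ∪ Y) = mk X + mk Y :=
  Finset.sum_union h

end OLA

/-! ### Cells and passes of the dynamic program -/

namespace Lang

lemma Env.setv_v (s : Env) (x : ℕ) (z : ℤ) (y : ℕ) :
    (s.setv x z).v y = if y = x then z else s.v y := by
  simp [Env.setv, Function.update_apply]

lemma foldVal_congr {o : Bin} {z z' : ℤ} {f g : ℕ → ℤ} {N : ℕ} (hz : z = z')
    (h : ∀ i < N, f i = g i) : foldVal o z f N = foldVal o z' g N := by
  subst hz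
  induction N with
  | zero => rfl
  | succ N ih => rw [foldVal_succ, foldVal_succ, ih fun i hi => h i (by omega), h N (by omega)]

/-- The number of elements of the set in variable `58` below variable `15`. -/
def rkE : Expr := sumE 13 (.var 15) (bitE 58 (.var 13))

lemma eval_rkE {s : Env} {v m : ℕ} (hv : s.v 15 = v) (hm : s.v 58 = m) :
    rkE.eval s = OLA.rk m v := by
  rw [rkE, eval_sumE _ (.var 15) _ _ hv, OLA.rk]
  push_cast
  refine Finset.sum_congr rfl fun u _ => eval_bitE _ (.var 13) _ ?_ (by simp)
  rw [Env.setv_v_of_ne _ _ (by omega), hm]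

/-- Membership of variable `15` in the set with index `52`. -/
def memE : Expr := bitE 58 (.var 15) * bitE 52 rkE

/-- The value of the dynamic program at the set with index `52`. -/
def dpCell : Expr :=
  .ifp (.var 52)
    (.letE 53 (.var 59 + sumE 15 (.var 0) (memE * powE (.const 2) (.var 15)))
      (cutE 53 * .var 65 + .fold .min 15 (.var 0) (.var 66)
        (.ifp memE
          (.get 10 (.var 52 - powE (.const 2) rkE) +
            (pcE 53 - .const 1) * powE (.var 0 + .const 1) (.var 15))
          (.var 66))))
    (.var 60)

lemma eval_memE {s : Env} {v m j : ℕ} (hv : s.v 15 = v) (hm : s.v 58 = m) (hj : s.v 52 = j) :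
    memE.eval s = OLA.bit m v * OLA.bit j (OLA.rk m v) := by
  rw [memE, eval_mul, eval_bitE _ (.var 15) _ hm hv, eval_bitE _ _ _ hj (eval_rkE hv hm)]

/-- The recursion refers to smaller indices only, and `hg` says that those cells are already
correct. -/
lemma eval_dpCell {n : ℕ} {G : SimpleGraph (Fin n)} {s : Env} (h : Holds G s) {A B : Finset (Fin n)}
    (hAB : Disjoint B A) {j : ℕ} {init big : ℤ} (hj : j < 2 ^ A.card) (h58 : s.v 58 = OLA.mk A)
    (h59 : s.v 59 = OLA.mk B) (h60 : s.v 60 = init) (h65 : s.v 65 = (n + 1) ^ n)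
    (h66 : s.v 66 = big) (h52 : s.v 52 = j)
    (hg : ∀ l < j, s.a 10 l = OLA.dp G B init big (OLA.sub n (OLA.mk A) l)) :
    dpCell.eval s = OLA.dp G B init big (OLA.sub n (OLA.mk A) j) := by
  set m := OLA.mk A with hm
  have hA : OLA.setOf n m = A := OLA.setOf_mk A
  rw [← hA] at hj
  rw [dpCell, eval_ifp, eval_var, h52]
  split_ifs with hj0
  swap
  · have : j = 0 := by omega
    rw [this, OLA.sub_zero, OLA.dp_empty, eval_var, h60]
  have hj0' : 0 < j := by omega
  have hX : (Expr.var 59 + sumE 15 (.var 0) (memE * powE (.const 2) (.var 15))).eval s =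
      OLA.mk (B ∪ OLA.sub n m j) := by
    rw [eval_add, eval_var, h59, eval_sumE _ (.var 0) _ _ h.n, OLA.mk_union, Nat.cast_add,
      OLA.mk_sub]
    · congr 1
      refine Finset.sum_congr rfl fun v _ => ?_
      rw [eval_mul, eval_memE (v := v) (m := m) (j := j) (by simp) (by simp [Env.setv_v, h58])
        (by simp [Env.setv_v, h52]), eval_powE _ (.var 15) _ (N := v) (by simp) fun _ => rfl,
        eval_const]
    · exact hAB.mono_right ((OLA.sub_subset n m j).trans hA.subset)
  rw [eval_letE, hX, eval_add, eval_mul, eval_var]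
  set s₁ := s.setv 53 (OLA.mk (B ∪ OLA.sub n m j) : ℕ) with hs₁
  have h₁ : Holds G s₁ := h.setv (by norm_num) _
  rw [eval_cutE h₁ (m := OLA.mk (B ∪ OLA.sub n m j)) (by simp [hs₁]) (by norm_num), OLA.cutZ_eq,
    OLA.setOf_mk, show s₁.v 65 = (n + 1) ^ n by simp [hs₁, Env.setv_v, h65],
    OLA.dp_eq G B (OLA.sub_nonempty hj0' hj), eval_fold,
    show (Expr.var 0).eval s₁ = n from h₁.n, Int.toNat_natCast]
  congr 1
  refine foldVal_congr (by simp [hs₁, Env.setv_v, h66]) fun v hv => ?_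
  rw [dif_pos hv, eval_ifp, eval_memE (v := v) (m := m) (j := j) (by simp)
    (by simp [hs₁, Env.setv_v, h58]) (by simp [hs₁, Env.setv_v, h52])]
  have hmem : (0 : ℤ) < OLA.bit m v * OLA.bit j (OLA.rk m v) ↔
      (⟨v, hv⟩ : Fin n) ∈ OLA.sub n m j := by
    rw [OLA.mem_sub, OLA.bit_eq, OLA.bit_eq]
    by_cases h1 : m.testBit v <;> by_cases h2 : j.testBit (OLA.rk m v) <;> simp [h1, h2]
  simp only [hmem]
  split_ifs with hvm
  swap
  · simp [hs₁, Env.setv_v, h66]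
  obtain ⟨hle, hsub⟩ := OLA.sub_sub hj hvm
  have h₂ : Holds G (s₁.setv 15 v) := h₁.setv (by norm_num) _
  have hr : rkE.eval (s₁.setv 15 v) = OLA.rk m v :=
    eval_rkE (by simp) (by simp [hs₁, Env.setv_v, h58])
  rw [eval_add, eval_get, eval_sub, eval_powE _ _ _ hr fun _ => rfl, eval_mul, eval_sub,
    eval_pcE h₂ (m := OLA.mk (B ∪ OLA.sub n m j)) (by simp [hs₁, Env.setv_v]) (by norm_num),
    OLA.pcZ_eq, OLA.setOf_mk, eval_powE _ (.var 15) _ (N := v) (by simp)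
    (fun i => by simp [Env.setv_v]), eval_add, eval_var, eval_var, h₂.n]
  simp only [eval_const]
  congr 1
  have e1 : (s₁.setv 15 v).v 52 = j := by simp [hs₁, Env.setv_v, h52]
  have e2 : ((j : ℤ) - 2 ^ OLA.rk m v).toNat = j - 2 ^ OLA.rk m v := by
    rw [← Int.toNat_natCast (j - 2 ^ OLA.rk m v)]
    congr 1
    push_cast [Nat.cast_sub hle]
    rfl
  have e3 : (s₁.setv 15 v).a 10 = s.a 10 := rfl
  have e4 : 0 < 2 ^ OLA.rk m v := by positivity
  rw [e1, e2, e3, hg _ (by omega), hsub]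

/-- One run of the dynamic program. -/
def dpPass : Cmd :=
  .seq (.assign 4 (pcE 58)) <|
  .seq (.loop 52 (powE (.const 2) (.var 4)) (.store 10 (.var 52) dpCell))
    (.assign 60 (.get 10 (powE (.const 2) (.var 4) - .const 1)))

lemma triple_dpPass {P n : ℕ} {G : SimpleGraph (Fin n)} {s : Env} (hs : s.Good P) (h : Holds G s)
    {A B : Finset (Fin n)} (hAB : Disjoint B A) {init big : ℤ} (h58 : s.v 58 = OLA.mk A)
    (h59 : s.v 59 = OLA.mk B) (h60 : s.v 60 = init) (h65 : s.v 65 = (n + 1) ^ n)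
    (h66 : s.v 66 = big) (h0 : 0 ≤ init) (hb : 0 ≤ big) (hnP : n < P)
    (hP : init + A.card * (n + 1) ^ (n + 2) < 2 ^ P) :
    Triple P dpPass s (3 + 2 * 2 ^ A.card) fun s' => s'.Good P ∧ Same [4, 52, 60] [10] s s' ∧
      s'.v 60 = OLA.dp G B init big A := by
  have hA : OLA.setOf n (OLA.mk A) = A := OLA.setOf_mk A
  have hAn : A.card ≤ n := (Finset.card_le_univ A).trans_eq (by simp)
  have hbound : ∀ D ⊆ A, (OLA.dp G B init big D).natAbs < 2 ^ P := fun D hD => by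
    have h1 := OLA.dp_nonneg G B h0 hb D
    have h2 := OLA.dp_le_mul G B (init := init) (big := big) D
    have h3 : (D.card : ℤ) ≤ A.card := by exact_mod_cast Finset.card_le_card hD
    have h4 : (D.card : ℤ) * (n + 1) ^ (n + 2) ≤ A.card * (n + 1) ^ (n + 2) := by gcongr
    zify
    rw [abs_of_nonneg h1]
    omega
  have hpc : (pcE 58).eval s = A.card := by
    rw [eval_pcE h h58 (by norm_num), OLA.pcZ_eq, hA]
  refine ((Triple.assign hs (Q := fun s' => s' = s.setv 4 A.card) (by rw [hpc])).seq
    (N₂ := (1 + 2 ^ A.card * 2) + 1) ?_).mono (by omega) fun _ h => h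
  rintro _ rfl
  set s₁ := s.setv 4 (A.card : ℤ) with hs₁
  have hg₁ : s₁.Good P := hs.setv_small (by simp; omega)
  have hw : ∀ s' : Env, s'.v 4 = A.card → (powE (.const 2) (.var 4)).eval s' =
      (2 ^ A.card : ℕ) := fun s' h => by
    rw [eval_powE _ (.var 4) _ h fun _ => rfl]; simp
  have hsame₁ : Same [4] [] s s₁ := Same.setv _ _ _
  refine (triple_fill (2 ^ A.card) 0 (fun j => OLA.dp G B init big (OLA.sub n (OLA.mk A) j)) hg₁
    (hw _ (by simp [hs₁])) (Nat.pow_lt_pow_right (by norm_num) (by omega)) (by simp)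
    (fun j _ => hbound _ ((OLA.sub_subset _ _ _).trans hA.subset)) (by simp) ?_).seq ?_
  · intro j hj s' hsame h52 hl
    have hsame' : Same [4, 52] [10] s s' := hsame₁.trans hsame (by simp) (by simp) (by simp)
      (by simp)
    refine ⟨by simpa using h52, ?_⟩
    refine eval_dpCell (hsame'.holds h (by simp) (by simp)) hAB hj ?_ ?_ ?_ ?_ ?_ h52
      fun l hl' => ?_
    · rw [hsame'.1 _ (by simp), h58]
    · rw [hsame'.1 _ (by simp), h59]
    · rw [hsame'.1 _ (by simp), h60]
    · rw [hsame'.1 _ (by simp), h65]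
    · rw [hsame'.1 _ (by simp), h66]
    · rw [hl, if_pos (by omega), Nat.sub_zero]
  · rintro s' ⟨hg, hsame, hl⟩
    have hsame' : Same [4, 52] [10] s s' := hsame₁.trans hsame (by simp) (by simp) (by simp)
      (by simp)
    have hv : (Expr.get 10 (powE (.const 2) (.var 4) - .const 1)).eval s' =
        OLA.dp G B init big A := by
      rw [eval_get, eval_sub, hw s' (by rw [hsame.1 _ (by simp)]; simp [hs₁]), eval_const, hl,
        if_pos]
      · have : (((2 ^ A.card : ℕ) : ℤ) - 1).toNat = 2 ^ A.card - 1 := by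
          have := Nat.one_le_two_pow (n := A.card)
          omega
        have h1 := OLA.sub_last n (OLA.mk A)
        rw [hA] at h1
        rw [this, Nat.sub_zero, h1]
      · have := Nat.one_le_two_pow (n := A.card)
        omega
    refine Triple.assign hg ⟨hg.setv ?_ (by simp), ?_, ?_⟩
    · rw [hv]; exact hbound A subset_rfl
    · exact hsame'.trans (Same.setv _ _ _) (by simp) (by simp) (by simp) (by simp)
    · rw [Env.setv_v_self, hv]

end Lang

/-! ### Extending a set to an ordering -/

namespace Lang

lemma Triple.assign_seq {P x : ℕ} {e : Expr} {c : Cmd} {s : Env} {N : ℕ} {z : ℤ}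
    {Q : Env → Prop} (hs : s.Good P) (hz : e.eval s = z) (h : Triple P c (s.setv x z) N Q) :
    Triple P (.seq (.assign x e) c) s (1 + N) Q := by
  subst hz
  exact (Triple.assign hs (Q := fun s' => s' = s.setv x (e.eval s)) rfl).seq
    (by rintro _ rfl; exact h)

/-- Extends the set in variable `56` to an ordering, which is left in array `11`. -/
def extend : Cmd :=
  .seq (.assign 65 (powE (.var 0 + .const 1) (.var 0))) <|
  .seq (.assign 66 (powE (.var 0 + .const 1) (.var 0 + .const 3))) <|
  .seq (.assign 58 (.var 56)) <|
  .seq (.assign 59 (.const 0)) <|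
  .seq (.assign 60 (.const 0)) <|
  .seq dpPass <|
  .seq (.assign 59 (.var 56)) <|
  .seq (.assign 58 (powE (.const 2) (.var 0) - .const 1 - .var 56)) <|
  .seq dpPass
    (.loop 16 (.var 0) (.store 11 (.var 16)
      (.var 60 / powE (.var 0 + .const 1) (.var 16) % (.var 0 + .const 1))))

/-- The first pass handles `S` on top of the empty set; the second starts from its result and
handles the complement on top of `S`. The vertices' positions are then the digits of the final value
in base `n + 1`. -/
lemma triple_extend {P n : ℕ} {G : SimpleGraph (Fin n)} {s : Env} (hs : s.Good P) (h : Holds G s)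
    {S : Finset (Fin n)} (h56 : s.v 56 = OLA.mk S) (hnP : n < P)
    (hP : (n + 1) ^ (n + 3) < 2 ^ P) :
    Triple P extend s (14 + 2 * n + 2 * (2 ^ S.card + 2 ^ (n - S.card))) fun s' => s'.v 0 = n ∧
      ∃ π : Equiv.Perm (Fin n), (∀ v : Fin n, s'.a 11 v = ((π v : ℕ) : ℤ)) ∧
        ∀ π', OLA.pre π' S.card = S → OLA.cost G π ≤ OLA.cost G π' := by
  have hS : S.card ≤ n := (Finset.card_le_univ S).trans_eq (by simp)
  set U : ℤ := (n + 1) ^ (n + 2) with hU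
  have hU0 : 0 ≤ U := by positivity
  set big : ℤ := (n + 1) ^ (n + 3) with hbig
  have hbigU : n * U < big := by
    have : 0 < U := by positivity
    rw [hbig, pow_succ, ← hU]; nlinarith
  have hbigP : big < 2 ^ P := by rw [hbig]; exact_mod_cast hP
  have hbig0 : 0 ≤ big := by positivity
  have hSU : (S.card : ℤ) * U ≤ n * U := by gcongr
  have hmk : ∀ X : Finset (Fin n), OLA.mk X < 2 ^ P := fun X =>
    (OLA.mk_lt X).trans_le (Nat.pow_le_pow_right (by norm_num) hnP.le)
  have hZ : (n + 1) ^ n < 2 ^ P :=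
    (Nat.pow_le_pow_right (by omega) (by omega : n ≤ n + 3)).trans_lt hP
  have hpow : ∀ (s' : Env) (e : Expr) (i : ℕ), s'.v 0 = n → e.eval s' = i →
      (powE (.var 0 + .const 1) e).eval s' = (n + 1) ^ i := fun s' e i h0 h => by
    rw [eval_powE _ _ _ h (fun i => by simp [Env.setv_v])]; simp [h0]
  set s₁ := s.setv 65 ((n + 1) ^ n) with hs₁
  have g₁ : s₁.Good P := hs.setv (by zify; rw [abs_of_nonneg (by positivity)]; exact_mod_cast hZ)
    (by simp)
  set s₂ := s₁.setv 66 big with hs₂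
  have g₂ : s₂.Good P := g₁.setv (by zify; rwa [abs_of_nonneg hbig0]) (by simp)
  set s₃ := s₂.setv 58 (OLA.mk S) with hs₃
  have g₃ : s₃.Good P := g₂.setv (by simpa using hmk S) (by simp)
  set s₄ := s₃.setv 59 0 with hs₄
  have g₄ : s₄.Good P := g₃.setv_small (by simp)
  set s₅ := s₄.setv 60 0 with hs₅
  have g₅ : s₅.Good P := g₄.setv_small (by simp)
  have h₅ : Holds G s₅ := by
    refine Holds.setv (Holds.setv (Holds.setv (Holds.setv (Holds.setv h ?_ _) ?_ _) ?_ _) ?_ _) ?_ _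
      <;> norm_num
  refine Triple.mono (N := 1 + (1 + (1 + (1 + (1 + ((3 + 2 * 2 ^ S.card) +
    (1 + (1 + ((3 + 2 * 2 ^ Sᶜ.card) + (1 + n * 2)))))))))) ?_ (by
      rw [Finset.card_compl, Fintype.card_fin]; omega) fun _ h => h
  refine Triple.assign_seq hs (hpow _ _ _ h.n h.n) ?_
  refine Triple.assign_seq g₁ (hpow _ _ (n + 3) (by simp [Env.setv_v, h.n])
    (by simp [Env.setv_v, h.n])) ?_
  refine Triple.assign_seq g₂ (z := OLA.mk S) (by simp [Env.setv_v, h56]) ?_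
  refine Triple.assign_seq g₃ (z := 0) rfl ?_
  refine Triple.assign_seq g₄ (z := 0) rfl ?_
  refine (triple_dpPass (A := S) (B := ∅) (init := 0) (big := big) g₅ h₅ (by simp)
    (by simp [hs₅, hs₄, hs₃, Env.setv_v]) (by simp [hs₅, hs₄, Env.setv_v, OLA.mk])
    (by simp [hs₅]) (by simp [hs₅, hs₄, hs₃, hs₂, hs₁, Env.setv_v])
    (by simp [hs₅, hs₄, hs₃, hs₂, Env.setv_v]) le_rfl hbig0 hnP (by linarith)).seq ?_
  rintro s₆ ⟨g₆, same₆, h60⟩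
  have hres : OLA.dp G ∅ 0 big S ≤ S.card * U := by
    simpa using OLA.dp_le_mul G ∅ (init := 0) (big := big) S
  have hres0 := OLA.dp_nonneg G ∅ (init := 0) le_rfl hbig0 S
  have h56₆ : s₆.v 56 = OLA.mk S := by
    rw [same₆.1 _ (by simp)]; simp [hs₅, hs₄, hs₃, hs₂, hs₁, Env.setv_v, h56]
  have h₆ := same₆.holds h₅ (by simp) (by simp)
  set s₇ := s₆.setv 59 (OLA.mk S) with hs₇
  have g₇ : s₇.Good P := g₆.setv (by simpa using hmk S) (by simp)
  set s₈ := s₇.setv 58 (OLA.mk Sᶜ) with hs₈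
  have g₈ : s₈.Good P := g₇.setv (by simpa using hmk Sᶜ) (by simp)
  have h₈ : Holds G s₈ := Holds.setv (Holds.setv h₆ (by norm_num) _) (by norm_num) _
  refine Triple.assign_seq g₆ (z := OLA.mk S) h56₆ ?_
  -- The binary numbers of a set and of its complement add up to `2 ^ n - 1`.
  refine Triple.assign_seq g₇ (z := OLA.mk Sᶜ) ?_ ?_
  · rw [eval_sub, eval_sub, eval_powE _ (.var 0) _ (N := n) (by simp [Env.setv_v, h₆.n])
      fun _ => rfl]
    have := OLA.mk_add_mk_compl S
    simp only [eval_const, eval_var, Env.setv_v, h56₆]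
    zify at this
    simp
    omega
  have hcc : ((Sᶜ.card : ℕ) : ℤ) = n - S.card := by
    rw [Finset.card_compl, Fintype.card_fin, Nat.cast_sub hS]
  refine (triple_dpPass (A := Sᶜ) (B := S) (init := OLA.dp G ∅ 0 big S) (big := big) g₈ h₈
    disjoint_compl_right (by simp [hs₈]) (by simp [hs₈, hs₇, Env.setv_v])
    (by simp [hs₈, hs₇, Env.setv_v, h60]) ?_ ?_ hres0 hbig0 hnP ?_).seq ?_
  · simp only [hs₈, hs₇, Env.setv_v]
    rw [if_neg (by norm_num), if_neg (by norm_num), same₆.1 _ (by simp)]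
    simp [hs₅, hs₄, hs₃, hs₂, hs₁, Env.setv_v]
  · simp only [hs₈, hs₇, Env.setv_v]
    rw [if_neg (by norm_num), if_neg (by norm_num), same₆.1 _ (by simp)]
    simp [hs₅, hs₄, hs₃, hs₂, Env.setv_v]
  · rw [hcc, ← hU]; linarith
  rintro s₉ ⟨g₉, same₉, h60'⟩
  obtain ⟨π, hπ, hopt⟩ := OLA.exists_optimal_extension G S (big := big) hbigU
  rw [hπ] at h60'
  have h₉ := same₉.holds h₈ (by simp) (by simp)
  have hnP' : n < 2 ^ P := hnP.trans Nat.lt_two_pow_self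
  refine (triple_fill (b := .var 0) n 0 (fun v => if h : v < n then ((π ⟨v, h⟩ : ℕ) : ℤ) else 0) g₉
    h₉.n hnP' (fun _ => hnP.le) (fun v hv => ?_) (by simp) ?_).mono le_rfl ?_
  · simp only [hv, dif_pos, Int.natAbs_natCast]
    omega
  · intro v hv s' hsame h16 _
    have h0 : s'.v 0 = n := (hsame.1 _ (by simp)).trans h₉.n
    refine ⟨by simpa using h16, ?_⟩
    rw [eval_mod, eval_div, hpow s' (.var 16) v h0 h16, eval_add, eval_var, eval_var, eval_const,
      h0, hsame.1 _ (by simp), h60', dif_pos hv]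
    exact OLA.code_div_mod G π ⟨v, hv⟩
  · rintro s' ⟨-, hsame, hl⟩
    refine ⟨(hsame.1 _ (by simp)).trans h₉.n, π, fun v => ?_, hopt⟩
    rw [hl, if_pos (by omega), Nat.sub_zero, dif_pos v.2]

end Lang

/-! ### The tensor power transform as a command -/

namespace MatMul

open Finset

/-- The result of `j` layers of the transform. -/
def layers (M : ℕ → ℕ → ℤ) (R C k : ℕ) (v : ℕ → ℤ) : ℕ → ℕ → ℤ
  | 0 => v
  | j + 1 => layer M R C (C ^ (k - 1 - j) * R ^ j) (layers M R C k v j)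

lemma layers_last (M : ℕ → ℕ → ℤ) (R C k : ℕ) (v : ℕ → ℤ) {x : ℕ} (hx : x < R ^ k) :
    layers M R C k v k x = ∑ y ∈ range (C ^ k), ten M R C k x y * v y := by
  have := layers_eq M (R := R) (C := C) k (layers M R C k v) (fun j _ i _ => rfl) k le_rfl 0
    (by simp) x hx
  simpa [layers] using this

lemma layer_index {R C k j i e : ℕ} (hj : j < k) (hi : i < C ^ (k - 1 - j) * R ^ j * R)
    (he : e < C) :
    e * (C ^ (k - 1 - j) * R ^ j) + i / R < C ^ (k - j) * R ^ j := by
  have hi' : i / R < C ^ (k - 1 - j) * R ^ j := Nat.div_lt_of_lt_mul (by rwa [mul_comm] at hi)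
  have e1 : C ^ (k - j) = C * C ^ (k - 1 - j) := by rw [← pow_succ']; congr 1; omega
  rw [e1, mul_assoc]
  calc _ < (e + 1) * (C ^ (k - 1 - j) * R ^ j) := by rw [add_mul, one_mul]; omega
    _ ≤ _ := Nat.mul_le_mul_right _ he

/-- An entry of a new layer is a sum of `C` products with table entries of size at most `μ`, so each
layer adds at most `lam` bits. -/
lemma layers_bound {M : ℕ → ℕ → ℤ} {R C k μ lam V : ℕ} {v : ℕ → ℤ}
    (hM : ∀ x < R, ∀ y < C, (M x y).natAbs ≤ μ) (hμ : C * μ ≤ 2 ^ lam)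
    (hv : ∀ y < C ^ k, (v y).natAbs ≤ 2 ^ V) : ∀ j ≤ k, ∀ i < C ^ (k - j) * R ^ j,
    (layers M R C k v j i).natAbs ≤ 2 ^ (V + lam * j) := by
  intro j
  induction j with
  | zero => intro _ i hi; exact hv i (by simpa using hi)
  | succ j ih =>
    intro hj i hi
    have hR : 0 < R := Nat.pos_of_ne_zero fun h => by simp [h] at hi
    have hi' : i < C ^ (k - 1 - j) * R ^ j * R := by
      rwa [mul_assoc, ← pow_succ, Nat.sub_sub, add_comm 1 j]
    rw [layers, layer]
    calc _ ≤ ∑ e ∈ range C, μ * 2 ^ (V + lam * j) := by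
          refine (Int.natAbs_sum_le _ _).trans (Finset.sum_le_sum fun e he => ?_)
          rw [mem_range] at he
          rw [Int.natAbs_mul]
          exact Nat.mul_le_mul (hM _ (Nat.mod_lt _ hR) _ he)
            (ih (by omega) _ (layer_index hj hi' he))
      _ = C * μ * 2 ^ (V + lam * j) := by rw [sum_const, card_range, smul_eq_mul, mul_assoc]
      _ ≤ 2 ^ lam * 2 ^ (V + lam * j) := Nat.mul_le_mul_right _ hμ
      _ = _ := by rw [← pow_add]; congr 1; ring

end MatMul

/-! ### Tables and the layered transform as commands -/

namespace Lang

open MatMul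

lemma Env.Good.pow_lt {P : ℕ} {a b : ℕ} (h : a ≤ 2 ^ b) (hb : b < P) : a < 2 ^ P :=
  h.trans_lt (Nat.pow_lt_pow_right (by norm_num) hb)

/-- The array `i` holds the table `M` with `R` rows and `C` columns. -/
def HasTable (i : Fin 16) (M : ℕ → ℕ → ℤ) (R C : ℕ) (s : Env) : Prop :=
  ∀ x < R, ∀ y < C, s.a i (x * C + y) = M x y

/-- Writes the first `L` values of `f` to array `i`. -/
def tableCmd (i : Fin 16) (f : ℕ → ℤ) : ℕ → Cmd
  | 0 => .assign 62 (.const 0)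
  | L + 1 => .seq (tableCmd i f L) (.store i (.const L) (.const (f L)))

lemma tableCmd_ok (i : Fin 16) (f : ℕ → ℤ) (L : ℕ) : (tableCmd i f L).ok := by
  induction L with
  | zero => rfl
  | succ L ih => simp [tableCmd, Cmd.ok, Expr.ok, ih]

lemma triple_tableCmd {P : ℕ} {i : Fin 16} (hi : ¬ smallArr i) (f : ℕ → ℤ) (L : ℕ) {s : Env}
    (hs : s.Good P) (hf : ∀ t < L, (f t).natAbs < 2 ^ P) :
    Triple P (tableCmd i f L) s (1 + L) fun s' => s'.Good P ∧ Same [62] [i] s s' ∧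
      ∀ t < L, s'.a i t = f t := by
  induction L with
  | zero =>
    exact Triple.assign hs ⟨hs.setv_small (by simp), (Same.setv _ _ _).mono (by simp) (by simp),
      by simp⟩
  | succ L ih =>
    refine (ih fun t ht => hf t (by omega)).seq (N₂ := 1) ?_
    rintro s' ⟨hg, hsame, h⟩
    refine Triple.store hg ⟨hg.seta (fun j => ?_) fun h => absurd h hi, ⟨hsame.1, fun j hj => ?_⟩,
      fun t ht => ?_⟩
    · rw [Function.update_apply]
      split_ifs
      · exact hf L (by omega)
      · exact hg.a i j
    · have hji : j ≠ i := by simpa using hj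
      simp only [Env.seta, Function.update_of_ne hji]
      exact hsame.2 j hj
    · simp only [Env.seta, Function.update_self, eval_const, Int.toNat_natCast,
        Function.update_apply]
      split_ifs with h1
      · rw [h1]
      · exact h t (by omega)

/-- Writes the table `M` to array `i`. -/
def storeTable (i : Fin 16) (M : ℕ → ℕ → ℤ) (R C : ℕ) : Cmd :=
  tableCmd i (fun t => M (t / C) (t % C)) (R * C)

lemma triple_storeTable {P : ℕ} {i : Fin 16} (hi : ¬ smallArr i) {M : ℕ → ℕ → ℤ} {R C μ : ℕ}
    {s : Env} (hs : s.Good P) (hM : ∀ x < R, ∀ y < C, (M x y).natAbs ≤ μ) (hμ : μ < 2 ^ P) :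
    Triple P (storeTable i M R C) s (1 + R * C) fun s' => s'.Good P ∧ Same [62] [i] s s' ∧
      HasTable i M R C s' := by
  refine (triple_tableCmd hi _ (R * C) hs fun t ht => ?_).mono le_rfl ?_
  · have hC : 0 < C := Nat.pos_of_ne_zero fun h => by simp [h] at ht
    exact (hM _ ((Nat.div_lt_iff_lt_mul hC).2 ht) _ (Nat.mod_lt _ hC)).trans_lt hμ
  · rintro s' ⟨hg, hsame, h⟩
    refine ⟨hg, hsame, fun x hx y hy => ?_⟩
    rw [h _ (by nlinarith)]
    congr 1
    · rw [mul_comm, Nat.mul_add_div (by omega), Nat.div_eq_of_lt hy, add_zero]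
    · rw [mul_comm, Nat.mul_add_mod, Nat.mod_eq_of_lt hy]

/-- One layer of the transform of array `7` by the table in array `i`. -/
def layerCmd (i : Fin 16) (R C : ℕ) : Cmd :=
  .seq (.assign 70 (powE (.const C) (.var 1 - .const 1 - .var 5) * powE (.const R) (.var 5))) <|
  .seq (.assign 71 (.var 70 * .const R)) <|
  .seq (.loop 52 (.var 71) (.store 8 (.var 52) (sumE 14 (.const C)
    (.get i (.var 52 % .const R * .const C + .var 14) *
      .get 7 (.var 14 * .var 70 + .var 52 / .const R)))))
    (.loop 52 (.var 71) (.store 7 (.var 52) (.get 8 (.var 52))))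

/-- The tensor power transform of array `7` by the table in array `i`. -/
def transform (i : Fin 16) (R C : ℕ) : Cmd := .loop 5 (.var 1) (layerCmd i R C)

/-- A layer permutes digits, so writing in place would destroy entries that are still needed; the
new layer is built in array `8` and copied back to array `7`. -/
lemma triple_layerCmd {P : ℕ} {i : Fin 16} (hi8 : i ≠ 8) {M : ℕ → ℕ → ℤ}
    {R C k j : ℕ} {s : Env} {w : ℕ → ℤ} (hs : s.Good P) (hT : HasTable i M R C s) (hk : s.v 1 = k)
    (hj : s.v 5 = j) (hjk : j < k) (h7 : ∀ y < C ^ (k - j) * R ^ j, s.a 7 y = w y)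
    (hsz : C ^ (k - 1 - j) * R ^ j * R < 2 ^ P) (hR : 0 < R)
    (hb : ∀ y < C ^ (k - 1 - j) * R ^ j * R,
      (layer M R C (C ^ (k - 1 - j) * R ^ j) w y).natAbs < 2 ^ P) :
    Triple P (layerCmd i R C) s (4 + 4 * (C ^ (k - 1 - j) * R ^ j * R)) fun s' =>
      s'.Good P ∧ Same [52, 70, 71] [7, 8] s s' ∧ ∀ y < C ^ (k - 1 - j) * R ^ j * R,
        s'.a 7 y = layer M R C (C ^ (k - 1 - j) * R ^ j) w y := by
  set L := C ^ (k - 1 - j) * R ^ j with hL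
  have hLP : L < 2 ^ P := lt_of_le_of_lt (Nat.le_mul_of_pos_right L hR) hsz
  refine Triple.mono (N := 1 + (1 + ((1 + L * R * 2) + (1 + L * R * 2)))) ?_ (by omega)
    fun _ h => h
  have h70 : (powE (.const C) (.var 1 - .const 1 - .var 5) * powE (.const R) (.var 5)).eval s =
      (L : ℕ) := by
    rw [eval_mul, eval_powE _ _ _ (N := k - 1 - j) (by simp [hk, hj]; omega) fun _ => rfl,
      eval_powE _ (.var 5) _ hj fun _ => rfl, hL]
    simp
  refine Triple.assign_seq hs h70 ?_
  have g₁ : (s.setv 70 (L : ℕ)).Good P := hs.setv (by simpa using hLP) (by simp)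
  refine Triple.assign_seq g₁ (z := (L * R : ℕ)) (by simp) ?_
  set s₂ := (s.setv 70 (L : ℕ)).setv 71 (L * R : ℕ) with hs₂
  have g₂ : s₂.Good P := g₁.setv (by rwa [Int.natAbs_natCast]) (by simp)
  have same₂ : Same [70, 71] [] s s₂ := (Same.setv _ _ _).trans (Same.setv _ _ _) (by simp)
    (by simp) (by simp) (by simp)
  refine (triple_fill (b := .var 71) (L * R) 0 (layer M R C L w) g₂ (by simp [hs₂]) hsz (by simp)
    hb (by simp) ?_).seq ?_
  · intro y hy s' hsame h52 hl
    refine ⟨by simpa using h52, ?_⟩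
    rw [eval_sumE _ (.const C) _ _ (N := C) rfl, layer]
    refine Finset.sum_congr rfl fun e he => ?_
    rw [Finset.mem_range] at he
    have h70' : s'.v 70 = L := by rw [hsame.1 _ (by simp)]; simp [hs₂, Env.setv_v]
    have hi' : s'.a i = s.a i := by rw [hsame.2 _ (by simpa using hi8)]; rfl
    have h7' : s'.a 7 = s.a 7 := by rw [hsame.2 _ (by simp)]; rfl
    have i1 : ((y : ℤ) % (R : ℤ) * C + e).toNat = y % R * C + e := by
      exact_mod_cast Int.toNat_natCast (y % R * C + e)
    have i2 : ((e : ℤ) * L + (y : ℤ) / R).toNat = e * L + y / R := by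
      exact_mod_cast Int.toNat_natCast (e * L + y / R)
    simp only [eval_mul, eval_get, eval_add, eval_mod, eval_div, eval_var, eval_const, Env.setv_v,
      Env.setv_a, h52, h70', hi', h7']
    norm_num
    rw [i1, i2, hT _ (Nat.mod_lt _ hR) _ he, h7 _ (layer_index hjk hy he)]
  rintro s₃ ⟨g₃, same₃, h₃⟩
  refine (triple_fill (b := .var 71) (L * R) 0 (layer M R C L w) g₃ ?_ hsz (by simp)
    hb (by simp) ?_).mono le_rfl ?_
  · rw [eval_var, same₃.1 _ (by simp)]; simp [hs₂]
  · intro y hy s' hsame h52 hl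
    refine ⟨by simpa using h52, ?_⟩
    rw [eval_get, eval_var, h52, Int.toNat_natCast, hsame.2 _ (by simp), h₃, if_pos (by omega),
      Nat.sub_zero]
  · rintro s₄ ⟨g₄, same₄, h₄⟩
    refine ⟨g₄, ?_, fun y hy => by rw [h₄, if_pos (by omega), Nat.sub_zero]⟩
    have h1 : Same [52, 70, 71] [8] s s₃ := same₂.trans same₃ (by simp) (by simp) (by simp)
      (by simp)
    exact h1.trans same₄ (by simp) (by simp) (by simp) (by simp)

/-- All intermediate vectors have length `C ^ (k - j) * R ^ j`, at most `r ^ k`, and entries of at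
most `V + lam * k` bits. -/
lemma triple_transform {P : ℕ} {i : Fin 16} (hi7 : i ≠ 7) (hi8 : i ≠ 8) {M : ℕ → ℕ → ℤ}
    {R C k μ lam V r : ℕ} {s : Env} {v : ℕ → ℤ} (hs : s.Good P) (hT : HasTable i M R C s)
    (hk : s.v 1 = k) (hM : ∀ x < R, ∀ y < C, (M x y).natAbs ≤ μ) (hμ : C * μ ≤ 2 ^ lam)
    (hv : ∀ y < C ^ k, (v y).natAbs ≤ 2 ^ V) (h7 : ∀ y < C ^ k, s.a 7 y = v y)
    (hR : 0 < R) (hRr : R ≤ r) (hCr : C ≤ r) (hr : r ^ k < 2 ^ P) (hP : V + lam * k < P) :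
    Triple P (transform i R C) s (1 + k * (5 + 4 * r ^ k)) fun s' =>
      s'.Good P ∧ Same [5, 52, 70, 71] [7, 8] s s' ∧
      ∀ x < R ^ k, s'.a 7 x = ∑ y ∈ Finset.range (C ^ k), ten M R C k x y * v y := by
  have hkP : k ≤ P := by have := hs.sv 1 (by decide); rw [hk] at this; simpa using this
  refine (Triple.loop (M := 4 + 4 * r ^ k) (N := k) (fun j s' => s'.Good P ∧
    Same [5, 52, 70, 71] [7, 8] s s' ∧ ∀ y < C ^ (k - j) * R ^ j,
      s'.a 7 y = layers M R C k v j y) hs (by simp [hk]) ⟨hs, Same.refl _ _ _,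
        by simpa [layers] using h7⟩ ?_).mono (by rw [← add_assoc]) ?_
  · rintro j hj s' ⟨hg, hsame, h⟩
    have hsz : C ^ (k - 1 - j) * R ^ j * R ≤ r ^ k := by
      calc _ ≤ r ^ (k - 1 - j) * r ^ j * r := by gcongr
        _ = r ^ k := by rw [mul_assoc, ← pow_succ, ← pow_add]; congr 1; omega
    have hsz' : C ^ (k - (j + 1)) * R ^ (j + 1) = C ^ (k - 1 - j) * R ^ j * R := by
      rw [mul_assoc, ← pow_succ, Nat.sub_sub, add_comm 1 j]
    have hsame' : Same [5, 52, 70, 71] [7, 8] s (s'.setv 5 j) :=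
      hsame.trans (Same.setv _ _ _) (by simp) (by simp) (by simp) (by simp)
    refine (triple_layerCmd hi8 (M := M) (w := layers M R C k v j)
      (hg.setv_small (by simp; omega)) ?_ ?_ (by simp) hj ?_ (hsz.trans_lt hr) hR ?_).mono
      (by omega) ?_
    · intro x hx y hy
      rw [hsame'.2 i (by simp [hi7, hi8])]
      exact hT x hx y hy
    · rw [hsame'.1 _ (by simp), hk]
    · exact h
    · intro y hy
      refine Env.Good.pow_lt (b := V + lam * (j + 1)) ?_ ?_
      · exact layers_bound hM hμ hv (j + 1) hj y (by rw [hsz']; exact hy)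
      · exact lt_of_le_of_lt (by gcongr; omega) hP
    · rintro s'' ⟨hg', hs', h'⟩
      refine ⟨hg', hsame'.trans hs' (by simp) (by simp) (by simp) (by simp), ?_⟩
      rw [hsz']
      exact h'
  · rintro s' ⟨hg, hsame, h⟩
    refine ⟨hg, hsame, fun x hx => ?_⟩
    rw [h x (by simpa using hx), layers_last _ _ _ _ _ hx]

end Lang

/-! ### Smallest cuts from matrix products -/

namespace OLA

open MatMul Finset

lemma bit_add {x p : ℕ} (hx : x < 2 ^ p) (y u : ℕ) :
    bit (x + y * 2 ^ p) u = bit x u + bit (y * 2 ^ p) u := by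
  have h1 := Nat.testBit_two_pow_mul_add y hx u
  have h2 := Nat.testBit_two_pow_mul_add y (show 0 < 2 ^ p by positivity) u
  rw [add_zero, mul_comm] at h2
  rw [mul_comm, add_comm] at h1
  rw [bit_eq, bit_eq, bit_eq, h1, h2]
  by_cases hu : u < p
  · simp [hu]
  · have h3 : x.testBit u = false :=
      Nat.testBit_eq_false_of_lt (hx.trans_le (Nat.pow_le_pow_right (by norm_num) (by omega)))
    simp [hu, h3]

lemma cutZ_nonneg {n : ℕ} (G : SimpleGraph (Fin n)) (m : ℕ) : 0 ≤ cutZ G m := by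
  rw [cutZ_eq]; positivity

lemma cutZ_le {n : ℕ} (G : SimpleGraph (Fin n)) (m : ℕ) : cutZ G m ≤ n * n := by
  rw [cutZ_eq]; exact_mod_cast cutN_le G _

/-! ### Three blocks of vertices and the matrix entries -/

section

variable {n : ℕ} (G : SimpleGraph (Fin n)) {q i j l : ℕ}

lemma part_lt (hi : i < 2 ^ q) (hj : j < 2 ^ q) : i + j * 2 ^ q < 2 ^ (q + q) := by
  rw [pow_add]
  calc _ < (j + 1) * 2 ^ q := by rw [add_mul, one_mul]; omega
    _ ≤ _ := Nat.mul_le_mul_right _ hj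

lemma bit_parts (hi : i < 2 ^ q) (hj : j < 2 ^ q) (u : ℕ) :
    bit (i + j * 2 ^ q + l * 2 ^ q * 2 ^ q) u =
      bit i u + bit (j * 2 ^ q) u + bit (l * 2 ^ q * 2 ^ q) u := by
  have h := bit_add (part_lt hi hj) l u
  rwa [pow_add, ← mul_assoc, bit_add hi j] at h

lemma bit_parts₂ (hj : j < 2 ^ q) (u : ℕ) :
    bit (j * 2 ^ q + l * 2 ^ q * 2 ^ q) u = bit (j * 2 ^ q) u + bit (l * 2 ^ q * 2 ^ q) u := by
  have h := bit_add (x := j * 2 ^ q) (p := q + q) (by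
    rw [pow_add]; exact Nat.mul_lt_mul_of_pos_right hj (by positivity)) l u
  rwa [pow_add, ← mul_assoc] at h

lemma bit_parts₃ (hi : i < 2 ^ q) (u : ℕ) :
    bit (i + l * 2 ^ q * 2 ^ q) u = bit i u + bit (l * 2 ^ q * 2 ^ q) u :=
  bit_add hi _ u

lemma pcZ_parts (hi : i < 2 ^ q) (hj : j < 2 ^ q) :
    pcZ n (i + j * 2 ^ q + l * 2 ^ q * 2 ^ q) =
      pcZ n (i + l * 2 ^ q * 2 ^ q) + pcZ n (j * 2 ^ q) := by
  simp only [pcZ, bit_parts hi hj, bit_parts₃ hi, Nat.cast_add, sum_add_distrib]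
  ring

/-- In terms of the bits the cut is a quadratic polynomial without constant term, and the bits of
disjoint blocks add. Such an `f` satisfies `f(x+y+z) = f(x+y) + f(y+z) + f(x+z) - f(x) - f(y) -
f(z)`; each subtracted term is attached to one of the pairs. -/
lemma cutZ_parts (hi : i < 2 ^ q) (hj : j < 2 ^ q) :
    cutZ G (i + j * 2 ^ q + l * 2 ^ q * 2 ^ q) =
      (cutZ G (i + j * 2 ^ q) - cutZ G i) +
      (cutZ G (j * 2 ^ q + l * 2 ^ q * 2 ^ q) - cutZ G (j * 2 ^ q)) +
      (cutZ G (i + l * 2 ^ q * 2 ^ q) - cutZ G (l * 2 ^ q * 2 ^ q)) := by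
  simp only [cutZ, bit_parts hi hj, bit_parts₂ hj, bit_parts₃ hi, bit_add hi, ← sum_sub_distrib,
    ← sum_add_distrib]
  refine sum_congr rfl fun u _ => sum_congr rfl fun v _ => ?_
  push_cast
  ring

/-- The base of the number system in which cuts are counted. -/
def base (q : ℕ) : ℤ := 2 * 2 ^ q

variable (n) in
/-- The exponent that encodes a cut of size `c`. -/
def ex (c : ℤ) : ℕ := (n * n - c).toNat

/-- An entry of the first matrix. -/
noncomputable def entX (q : ℕ) (p : ℤ) (i j : ℕ) : ℤ :=
  if pcZ n (j * 2 ^ q) = p then base q ^ ex n (cutZ G (i + j * 2 ^ q) - cutZ G i) else 0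

/-- An entry of the second matrix. -/
noncomputable def entY (q j l : ℕ) : ℤ :=
  base q ^ ex n (cutZ G (j * 2 ^ q + l * 2 ^ q * 2 ^ q) - cutZ G (j * 2 ^ q))

/-- The weight of an entry of the product. -/
noncomputable def entZ (q i l : ℕ) : ℤ :=
  base q ^ ex n (cutZ G (i + l * 2 ^ q * 2 ^ q) - cutZ G (l * 2 ^ q * 2 ^ q))

/-- An entry of the product. -/
noncomputable def entXY (q : ℕ) (p : ℤ) (i l : ℕ) : ℤ :=
  ∑ j ∈ range (2 ^ q), entX G q p i j * entY G q j l

/-- The size of a vertex set is admissible. -/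
def Mid (n a : ℕ) (p : ℤ) : Prop := (a : ℤ) ≤ p ∧ p ≤ n - a

instance (n a : ℕ) (p : ℤ) : Decidable (Mid n a p) := by unfold Mid; infer_instance

/-- The weighted number of middle parts that fit to the outer parts `i` and `l`. -/
noncomputable def score (q a : ℕ) (δ : ℤ) (p : ℤ) (i l : ℕ) : ℤ :=
  if Mid n a (pcZ n (i + l * 2 ^ q * 2 ^ q) + p) then δ * entXY G q p i l * entZ G q i l else -1

lemma one_lt_base (q : ℕ) : 1 < base q := by
  have : (0 : ℤ) < 2 ^ q := by positivity
  unfold base; omega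

/-- Each of the three differences of cuts is at most `n * n`, so `toNat` loses nothing, and the
exponents add up by `cutZ_parts`. -/
lemma entX_mul (hi : i < 2 ^ q) (hj : j < 2 ^ q) (p : ℤ) :
    entX G q p i j * entY G q j l * entZ G q i l =
      if pcZ n (j * 2 ^ q) = p then
        base q ^ (3 * (n * n) - cutZ G (i + j * 2 ^ q + l * 2 ^ q * 2 ^ q)).toNat else 0 := by
  have h := cutZ_parts G (l := l) hi hj
  have a1 := cutZ_nonneg G i
  have a2 := cutZ_nonneg G (j * 2 ^ q)
  have a3 := cutZ_nonneg G (l * 2 ^ q * 2 ^ q)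
  have b1 := cutZ_le G (i + j * 2 ^ q)
  have b2 := cutZ_le G (j * 2 ^ q + l * 2 ^ q * 2 ^ q)
  have b3 := cutZ_le G (i + l * 2 ^ q * 2 ^ q)
  unfold entX entY entZ ex
  split_ifs
  · rw [← pow_add, ← pow_add]
    congr 1
    omega
  · simp

lemma score_eq {a : ℕ} (hi : i < 2 ^ q) {p : ℤ} (δ : ℤ)
    (hm : Mid n a (pcZ n (i + l * 2 ^ q * 2 ^ q) + p)) :
    score G q a δ p i l = δ * ∑ j ∈ range (2 ^ q), if pcZ n (j * 2 ^ q) = p then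
      base q ^ (3 * (n * n) - cutZ G (i + j * 2 ^ q + l * 2 ^ q * 2 ^ q)).toNat else 0 := by
  rw [score, if_pos hm, entXY, mul_assoc, sum_mul]
  congr 1
  exact sum_congr rfl fun j hj => entX_mul G hi (mem_range.1 hj) p

/-- All terms of the sum are nonnegative, so the term of `j` is a lower bound. -/
lemma base_pow_le_score {a : ℕ} (hi : i < 2 ^ q) (hj : j < 2 ^ q) {δ : ℤ} (hδ : 0 < δ)
    (hm : Mid n a (pcZ n (i + j * 2 ^ q + l * 2 ^ q * 2 ^ q))) :
    δ * base q ^ (3 * (n * n) - cutZ G (i + j * 2 ^ q + l * 2 ^ q * 2 ^ q)).toNat ≤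
      score G q a δ (pcZ n (j * 2 ^ q)) i l := by
  rw [pcZ_parts hi hj] at hm
  rw [score_eq G hi δ hm]
  have hb := one_lt_base q
  refine mul_le_mul_of_nonneg_left ?_ hδ.le
  refine (single_le_sum (f := fun x => if pcZ n (x * 2 ^ q) = pcZ n (j * 2 ^ q) then
    base q ^ (3 * (n * n) - cutZ G (i + x * 2 ^ q + l * 2 ^ q * 2 ^ q)).toNat else 0)
    (fun x _ => ?_) (mem_range.2 hj)).trans_eq' ?_
  · split_ifs <;> positivity
  · simp

/-- If all admissible middle parts had larger cuts, the sum would consist of at most `2 ^ q` terms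
that are smaller than the claimed power by a factor `base q = 2 * 2 ^ q`, and could not reach it. -/
lemma exists_cutZ_le {a : ℕ} (hi : i < 2 ^ q) {δ : ℤ} (hδ : 0 < δ) {p c : ℤ} (hc0 : 0 ≤ c)
    (hcn : c ≤ n * n)
    (h : δ * base q ^ (3 * (n * n) - c).toNat ≤ score G q a δ p i l) : ∃ j < 2 ^ q,
      Mid n a (pcZ n (i + j * 2 ^ q + l * 2 ^ q * 2 ^ q)) ∧
      cutZ G (i + j * 2 ^ q + l * 2 ^ q * 2 ^ q) ≤ c := by
  have hb := one_lt_base q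
  have hpos : 0 < δ * base q ^ (3 * (n * n) - c).toNat := by positivity
  by_cases hm : Mid n a (pcZ n (i + l * 2 ^ q * 2 ^ q) + p)
  swap
  · rw [score, if_neg hm] at h; omega
  rw [score_eq G hi δ hm] at h
  by_contra! hno
  have h1 := le_of_mul_le_mul_left h hδ
  have hn0 : (0 : ℤ) ≤ n * n := by positivity
  obtain ⟨e, he⟩ : ∃ e, (3 * (n * n) - c).toNat = e := ⟨_, rfl⟩
  -- There is no smaller power when the exponent is `0`. As `c ≤ n * n`, this happens only for `n =
  -- 0`, where all cuts vanish and it suffices that some term is nonzero.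
  rcases Nat.eq_zero_or_pos e with h0 | he0
  · have hn : (n * n : ℤ) = 0 := by omega
    have h2 : (0 : ℤ) < base q ^ e := by positivity
    rw [he] at h1
    obtain ⟨j, hj, hj'⟩ := exists_ne_zero_of_sum_ne_zero (h2.trans_le h1).ne'
    rw [mem_range] at hj
    rw [ne_eq, ite_eq_right_iff, Classical.not_imp] at hj'
    have h3 := hno j hj (by rw [pcZ_parts hi hj, hj'.1]; exact hm)
    have := cutZ_le G (i + j * 2 ^ q + l * 2 ^ q * 2 ^ q)
    omega
  · have h2 : ∑ j ∈ range (2 ^ q), (if pcZ n (j * 2 ^ q) = p then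
        base q ^ (3 * (n * n) - cutZ G (i + j * 2 ^ q + l * 2 ^ q * 2 ^ q)).toNat else 0) ≤
        ∑ _j ∈ range (2 ^ q), base q ^ (e - 1) := by
      refine sum_le_sum fun j hj => ?_
      rw [mem_range] at hj
      split_ifs with hp
      · have h3 := hno j hj (by rw [pcZ_parts hi hj, hp]; exact hm)
        exact pow_le_pow_right₀ hb.le (by omega)
      · positivity
    rw [sum_const, card_range, nsmul_eq_mul] at h2
    rw [he] at h1
    obtain ⟨d, rfl⟩ := Nat.exists_eq_succ_of_ne_zero he0.ne'
    rw [Nat.succ_sub_one] at h2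
    rw [Nat.succ_eq_add_one, pow_succ'] at h1
    have h3 : (0 : ℤ) < base q ^ d := by positivity
    have h4 := (mul_le_mul_iff_of_pos_right h3).1 (h1.trans h2)
    have h5 : (0 : ℤ) < 2 ^ q := by positivity
    unfold base at h4
    push_cast at h4
    omega

lemma exists_min_cut {a : ℕ} (ha : 2 * a ≤ n) : ∃ X : Finset (Fin n), a ≤ X.card ∧
    X.card ≤ n - a ∧ ∀ Y : Finset (Fin n), a ≤ Y.card → Y.card ≤ n - a →
      cutN G X ≤ cutN G Y := by
  have hne : (univ.filter fun X : Finset (Fin n) => a ≤ X.card ∧ X.card ≤ n - a).Nonempty := by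
    obtain ⟨X, -, hX⟩ := exists_subset_card_eq (s := (univ : Finset (Fin n))) (n := a)
      (by simp; omega)
    exact ⟨X, by simp; omega⟩
  obtain ⟨X, hX, h⟩ := exists_min_image _ (cutN G) hne
  simp only [mem_filter, mem_univ, true_and] at hX h
  exact ⟨X, hX.1, hX.2, fun Y h1 h2 => h Y ⟨h1, h2⟩⟩

lemma mid_iff {a m : ℕ} (ha : a ≤ n) :
    Mid n a (pcZ n m) ↔ a ≤ (setOf n m).card ∧ (setOf n m).card ≤ n - a := by
  rw [Mid, pcZ_eq]
  omega

/-- A largest score belongs to the outer parts of a smallest cut. -/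
theorem exists_middle {a : ℕ} (ha : 2 * a ≤ n) (hq : n ≤ 3 * q) {δ : ℤ} (hδ : 0 < δ) {p : ℤ}
    (hi : i < 2 ^ q) (hmax : ∀ p' < n + 1, ∀ i' < 2 ^ q, ∀ l' < 2 ^ q,
      score G q a δ (p' : ℕ) i' l' ≤ score G q a δ p i l) :
    ∃ j < 2 ^ q, Mid n a (pcZ n (i + j * 2 ^ q + l * 2 ^ q * 2 ^ q)) ∧
      ∀ Y : Finset (Fin n), a ≤ Y.card → Y.card ≤ n - a →
        cutZ G (i + j * 2 ^ q + l * 2 ^ q * 2 ^ q) ≤ cutN G Y := by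
  obtain ⟨X, hX1, hX2, hX⟩ := exists_min_cut G ha
  have hD : 0 < 2 ^ q := by positivity
  set x := mk X with hx
  have hxlt : x < 2 ^ q * 2 ^ q * 2 ^ q := by
    refine (mk_lt X).trans_le ?_
    rw [← pow_add, ← pow_add]
    exact Nat.pow_le_pow_right (by norm_num) (by omega)
  have hi' : x % 2 ^ q < 2 ^ q := Nat.mod_lt _ hD
  have hj' : x / 2 ^ q % 2 ^ q < 2 ^ q := Nat.mod_lt _ hD
  have hl' : x / 2 ^ q / 2 ^ q < 2 ^ q := by
    rw [Nat.div_div_eq_div_mul, Nat.div_lt_iff_lt_mul (by positivity), ← mul_assoc]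
    exact hxlt
  have hsplit : x % 2 ^ q + x / 2 ^ q % 2 ^ q * 2 ^ q + x / 2 ^ q / 2 ^ q * 2 ^ q * 2 ^ q = x := by
    have h1 := Nat.div_add_mod' x (2 ^ q)
    have h2 := Nat.div_add_mod' (x / 2 ^ q) (2 ^ q)
    nlinarith
  have hmid : Mid n a (pcZ n x) := by
    rw [mid_iff (by omega), hx, setOf_mk]; exact ⟨hX1, hX2⟩
  -- The blocks of a smallest cut produce a large score, so the largest score is at least as large,
  -- and `exists_cutZ_le` turns it into a middle part.
  have h1 := base_pow_le_score G (l := x / 2 ^ q / 2 ^ q) hi' hj' hδ (by rw [hsplit]; exact hmid)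
  have hp : pcZ n (x / 2 ^ q % 2 ^ q * 2 ^ q) = ((setOf n (x / 2 ^ q % 2 ^ q * 2 ^ q)).card : ℕ) :=
    pcZ_eq _ _
  have hpn : (setOf n (x / 2 ^ q % 2 ^ q * 2 ^ q)).card < n + 1 :=
    Nat.lt_succ_of_le ((card_le_univ _).trans_eq (by simp))
  rw [hp, hsplit] at h1
  obtain ⟨j, hj, hm, hc⟩ := exists_cutZ_le G hi hδ (cutZ_nonneg G x) (cutZ_le G x)
    (h1.trans (hmax _ hpn _ hi' _ hl'))
  refine ⟨j, hj, hm, fun Y hY1 hY2 => hc.trans ?_⟩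
  rw [cutZ_eq, hx, setOf_mk]
  exact_mod_cast hX Y hY1 hY2

end

end OLA

/-! ### The search for a smallest cut as a command -/

namespace MatMul

/-- An integral bilinear algorithm for matrices whose size is a power of two. -/
structure Scheme where
  m : ℕ
  N : ℕ
  r : ℕ
  δ : ℕ
  μ : ℕ
  lam : ℕ
  F : ℕ → ℕ → ℤ
  G : ℕ → ℕ → ℤ
  W : ℕ → ℕ → ℤ
  N_eq : N = 2 ^ m
  dec : IsDecomp N r δ F G W
  le : N * N ≤ r
  F_le : ∀ x < r, ∀ y < N * N, (F x y).natAbs ≤ μ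
  G_le : ∀ x < r, ∀ y < N * N, (G x y).natAbs ≤ μ
  W_le : ∀ x < N * N, ∀ y < r, (W x y).natAbs ≤ μ
  μ_pos : 1 ≤ μ
  μ_le : r * μ ≤ 2 ^ lam

namespace Scheme

variable (S : Scheme)

lemma N_pos : 0 < S.N := by rw [S.N_eq]; positivity

lemma r_pos : 0 < S.r := (Nat.mul_pos S.N_pos S.N_pos).trans_le S.le

lemma pow_N (k : ℕ) : S.N ^ k = 2 ^ (S.m * k) := by rw [S.N_eq, pow_mul]

lemma sq_pow_le (k : ℕ) : (S.N * S.N) ^ k ≤ S.r ^ k := Nat.pow_le_pow_left S.le k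

lemma μ_le' : S.N * S.N * S.μ ≤ 2 ^ S.lam := (Nat.mul_le_mul_right _ S.le).trans S.μ_le

lemma r_pow_le (k : ℕ) : S.r ^ k ≤ 2 ^ (S.lam * k) := by
  rw [pow_mul]
  exact Nat.pow_le_pow_left ((Nat.le_mul_of_pos_right _ S.μ_pos).trans S.μ_le) k

end Scheme

open Finset in
lemma sum_ten_bound {M : ℕ → ℕ → ℤ} {R C k μ lam V : ℕ} {v : ℕ → ℤ}
    (hM : ∀ x < R, ∀ y < C, (M x y).natAbs ≤ μ) (hμ : C * μ ≤ 2 ^ lam)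
    (hv : ∀ y < C ^ k, (v y).natAbs ≤ 2 ^ V) {x : ℕ} (hx : x < R ^ k) :
    (∑ y ∈ range (C ^ k), ten M R C k x y * v y).natAbs ≤ 2 ^ (V + lam * k) := by
  rw [← layers_last _ _ _ _ _ hx]
  exact layers_bound hM hμ hv k le_rfl x (by simpa using hx)

end MatMul

/-! ### Bit lengths of the matrix entries -/

namespace OLA

/-- A bound for the bit length of the entries. -/
def entBits (n q : ℕ) : ℕ := (q + 1) * (2 * (n * n))

/-- The exponent is at most `2 * (n * n)` and the base is `2 ^ (q + 1)`. -/
lemma natAbs_base_pow_le {n : ℕ} (q : ℕ) {c : ℤ} (hc : -(n * n : ℤ) ≤ c) :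
    (base q ^ ex n c).natAbs ≤ 2 ^ entBits n q := by
  rw [Int.natAbs_pow, base, entBits, pow_mul]
  have h1 : (2 * 2 ^ q : ℤ).natAbs = 2 ^ (q + 1) := by
    rw [Int.natAbs_mul, Int.natAbs_pow, pow_succ']; rfl
  rw [h1]
  refine Nat.pow_le_pow_right (by positivity) ?_
  unfold ex
  have : ((2 * (n * n) : ℕ) : ℤ) = n * n + n * n := by push_cast; ring
  omega

section

variable {n : ℕ} (G : SimpleGraph (Fin n)) (q : ℕ)

lemma cutZ_sub_bounds (x y : ℕ) : -(n * n : ℤ) ≤ cutZ G x - cutZ G y ∧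
    cutZ G x - cutZ G y ≤ n * n := by
  have := cutZ_nonneg G x
  have := cutZ_le G x
  have := cutZ_nonneg G y
  have := cutZ_le G y
  omega

lemma entX_le (p : ℤ) (i j : ℕ) : (entX G q p i j).natAbs ≤ 2 ^ entBits n q := by
  unfold entX
  split_ifs
  · exact natAbs_base_pow_le q (cutZ_sub_bounds G _ _).1
  · simp

lemma entY_le (j l : ℕ) : (entY G q j l).natAbs ≤ 2 ^ entBits n q :=
  natAbs_base_pow_le q (cutZ_sub_bounds G _ _).1

lemma entZ_le (i l : ℕ) : (entZ G q i l).natAbs ≤ 2 ^ entBits n q :=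
  natAbs_base_pow_le q (cutZ_sub_bounds G _ _).1

end

end OLA

/-! ### One round: a weighted matrix product -/

namespace Lang

open MatMul OLA

/-- The row index of the position in variable `52`. -/
def decE₁ (N : ℕ) : Expr :=
  sumE 13 (.var 1) (.var 52 / powE (.const (N * N : ℕ)) (.var 13) % .const (N * N : ℕ) / .const N *
    powE (.const N) (.var 13))

/-- The column index of the position in variable `52`. -/
def decE₂ (N : ℕ) : Expr :=
  sumE 13 (.var 1) (.var 52 / powE (.const (N * N : ℕ)) (.var 13) % .const N *
    powE (.const N) (.var 13))

lemma eval_decE₁ {s : Env} {N k x : ℕ} (h1 : s.v 1 = k) (hx : s.v 52 = x) :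
    (decE₁ N).eval s = dec₁ N k x := by
  rw [decE₁, eval_sumE _ (.var 1) _ _ h1, dec₁]
  push_cast
  refine Finset.sum_congr rfl fun d _ => ?_
  rw [eval_mul, eval_div, eval_mod, eval_div, eval_powE _ (.var 13) _ (N := d) (by simp)
    fun _ => rfl, eval_powE _ (.var 13) _ (N := d) (by simp) fun _ => rfl]
  simp [Env.setv_v, hx]

lemma eval_decE₂ {s : Env} {N k x : ℕ} (h1 : s.v 1 = k) (hx : s.v 52 = x) :
    (decE₂ N).eval s = dec₂ N k x := by
  rw [decE₂, eval_sumE _ (.var 1) _ _ h1, dec₂]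
  push_cast
  refine Finset.sum_congr rfl fun d _ => ?_
  rw [eval_mul, eval_mod, eval_div, eval_powE _ (.var 13) _ (N := d) (by simp)
    fun _ => rfl, eval_powE _ (.var 13) _ (N := d) (by simp) fun _ => rfl]
  simp [Env.setv_v, hx]

/-- The power of the base that encodes the difference of the cuts of the sets `x` and `y`. -/
def entE (x y : ℕ) : Expr := powE (.var 63) (.var 0 * .var 0 - (cutE x - cutE y))

lemma eval_entE {n : ℕ} {G : SimpleGraph (Fin n)} {s : Env} (h : Holds G s) {q x y mx my : ℕ}
    (h63 : s.v 63 = base q) (hx : s.v x = mx) (hy : s.v y = my) (hx50 : 50 ≤ x) (hy50 : 50 ≤ y) :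
    (entE x y).eval s = base q ^ ex n (cutZ G mx - cutZ G my) := by
  rw [entE, eval_powE _ _ _ (N := ex n (cutZ G mx - cutZ G my)) ?_ fun i => by simp [Env.setv_v],
    eval_var, h63]
  rw [eval_sub, eval_sub, eval_mul, eval_var, h.n, eval_cutE h hx hx50, eval_cutE h hy hy50, ex,
    Int.toNat_of_nonneg]
  have := (cutZ_sub_bounds G mx my).2
  omega

/-- Chooses `e₁` if the size `e` is admissible and `e₂` otherwise. -/
def midE (e e₁ e₂ : Expr) : Expr :=
  .ifp (e - .var 2 + .const 1) (.ifp (.var 0 - .var 2 - e + .const 1) e₁ e₂) e₂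

lemma eval_midE {s : Env} {n a : ℕ} {e e₁ e₂ : Expr} (h0 : s.v 0 = n) (h2 : s.v 2 = a) :
    (midE e e₁ e₂).eval s = if Mid n a (e.eval s) then e₁.eval s else e₂.eval s := by
  simp only [midE, eval_ifp, eval_add, eval_sub, eval_var, eval_const, h0, h2]
  by_cases h3 : (a : ℤ) ≤ e.eval s <;> by_cases h4 : e.eval s ≤ n - a
  · rw [if_pos (by omega), if_pos (by omega), if_pos (show Mid n a _ from ⟨h3, h4⟩)]
  · rw [if_pos (by omega), if_neg (by omega), if_neg fun h : Mid n a _ => h4 h.2]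
  · rw [if_neg (by omega), if_neg fun h : Mid n a _ => h3 h.1]
  · rw [if_neg (by omega), if_neg fun h : Mid n a _ => h3 h.1]

/-- The environment holds the graph, the parameters and the bilinear algorithm. -/
structure Setup {n : ℕ} (G : SimpleGraph (Fin n)) (S : Scheme) (k a : ℕ) (s : Env) : Prop where
  holds : Holds G s
  v1 : s.v 1 = k
  v2 : s.v 2 = a
  v50 : s.v 50 = (2 ^ (S.m * k) : ℕ)
  v51 : s.v 51 = ((S.N * S.N) ^ k : ℕ)
  v63 : s.v 63 = base (S.m * k)
  v64 : s.v 64 = (S.r ^ k : ℕ)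
  t4 : HasTable 4 S.F S.r (S.N * S.N) s
  t5 : HasTable 5 S.G S.r (S.N * S.N) s
  t6 : HasTable 6 S.W (S.N * S.N) S.r s

lemma HasTable.of_same {i : Fin 16} {M : ℕ → ℕ → ℤ} {R C : ℕ} {s s' : Env} {vs : List ℕ}
    {as : List (Fin 16)} (h : HasTable i M R C s) (hs : Same vs as s s') (hi : i ∉ as) :
    HasTable i M R C s' :=
  fun x hx y hy => by rw [hs.2 _ hi, h x hx y hy]

lemma Setup.of_same {n : ℕ} {G : SimpleGraph (Fin n)} {S : Scheme} {k a : ℕ} {s s' : Env}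
    (h : Setup G S k a s) {vs : List ℕ} {as : List (Fin 16)} (hs : Same vs as s s')
    (hv : ∀ x ∈ [0, 1, 2, 50, 51, 63, 64], x ∉ vs)
    (ha : ∀ i ∈ ([0, 4, 5, 6] : List (Fin 16)), i ∉ as) : Setup G S k a s' where
  holds := hs.holds h.holds (hv _ (by simp)) (ha _ (by simp))
  v1 := (hs.1 _ (hv _ (by simp))).trans h.v1
  v2 := (hs.1 _ (hv _ (by simp))).trans h.v2
  v50 := (hs.1 _ (hv _ (by simp))).trans h.v50
  v51 := (hs.1 _ (hv _ (by simp))).trans h.v51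
  v63 := (hs.1 _ (hv _ (by simp))).trans h.v63
  v64 := (hs.1 _ (hv _ (by simp))).trans h.v64
  t4 := h.t4.of_same hs (ha _ (by simp))
  t5 := h.t5.of_same hs (ha _ (by simp))
  t6 := h.t6.of_same hs (ha _ (by simp))

/-- The first matrix. -/
def cellX (N : ℕ) : Expr :=
  .letE 53 (decE₁ N) <| .letE 54 (decE₂ N * .var 50) <| .letE 55 (.var 53 + .var 54) <|
    -- For integers, `1 - (x - p) ^ 2` is positive exactly when `x = p`.
    .ifp (.const 1 - (pcE 54 - .var 3) * (pcE 54 - .var 3)) (entE 55 53) (.const 0)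

/-- The second matrix. -/
def cellY (N : ℕ) : Expr :=
  .letE 53 (decE₁ N * .var 50) <| .letE 54 (decE₂ N * .var 50 * .var 50) <|
    .letE 55 (.var 53 + .var 54) (entE 55 53)

/-- The weighted product. -/
def cellZ (N : ℕ) : Expr :=
  .letE 53 (decE₁ N) <| .letE 54 (decE₂ N * .var 50 * .var 50) <|
    .letE 55 (.var 53 + .var 54) <|
      midE (pcE 55 + .var 3) (.get 7 (.var 52) * entE 55 54) (.const (-1))

lemma same_setv₃ (s : Env) (x y z : ℤ) :
    Same [53, 54, 55] [] s (((s.setv 53 x).setv 54 y).setv 55 z) :=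
  ((Same.setv _ _ _).trans (Same.setv _ _ _) (ws := [53, 54]) (bs := []) (by simp) (by simp)
    (by simp) (by simp)).trans (Same.setv _ _ _) (by simp) (by simp) (by simp) (by simp)

section

variable {n : ℕ} {G : SimpleGraph (Fin n)} {S : Scheme} {k a : ℕ} {s : Env}

lemma eval_cellX (h : Setup G S k a s) {p : ℤ} {x : ℕ} (h3 : s.v 3 = p) (hx : s.v 52 = x) :
    (cellX S.N).eval s = entX G (S.m * k) p (dec₁ S.N k x) (dec₂ S.N k x) := by
  set i := dec₁ S.N k x with hi
  set j := dec₂ S.N k x with hj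
  set q := S.m * k with hq
  rw [cellX, eval_letE, eval_decE₁ h.v1 hx, eval_letE, eval_mul,
    eval_decE₂ (k := k) (x := x) (by simp [Env.setv_v, h.v1]) (by simp [Env.setv_v, hx]), eval_letE]
  set s₁ := ((s.setv 53 i).setv 54 _).setv 55 _ with hs₁
  have same : Same [53, 54, 55] [] s s₁ := same_setv₃ _ _ _ _
  have h₁ : Setup G S k a s₁ := h.of_same same (by simp) (by simp)
  have e53 : s₁.v 53 = i := by simp [hs₁, Env.setv_v]
  have e54 : s₁.v 54 = (j * 2 ^ q : ℕ) := by simp [hs₁, Env.setv_v, h.v50, hq, hj, hi]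
  have e55 : s₁.v 55 = (i + j * 2 ^ q : ℕ) := by simp [hs₁, Env.setv_v, h.v50, hq, hj, hi]
  have e3 : s₁.v 3 = p := (same.1 _ (by simp)).trans h3
  rw [eval_ifp, eval_sub, eval_mul, eval_sub, eval_pcE h₁.holds e54 (by norm_num), eval_var, e3,
    eval_entE h₁.holds h₁.v63 e55 e53 (by norm_num) (by norm_num), entX, eval_const, eval_const]
  by_cases hp : pcZ n (j * 2 ^ q) = p
  · rw [if_pos (by rw [hp]; simp), if_pos hp]
  · rw [if_neg, if_neg hp]
    have : pcZ n (j * 2 ^ q) - p ≠ 0 := by omega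
    have := mul_self_pos.2 this
    omega

lemma eval_cellY (h : Setup G S k a s) {x : ℕ} (hx : s.v 52 = x) :
    (cellY S.N).eval s = entY G (S.m * k) (dec₁ S.N k x) (dec₂ S.N k x) := by
  set i := dec₁ S.N k x with hi
  set j := dec₂ S.N k x with hj
  set q := S.m * k with hq
  rw [cellY, eval_letE, eval_mul, eval_decE₁ h.v1 hx, eval_letE, eval_mul, eval_mul,
    eval_decE₂ (k := k) (x := x) (by simp [Env.setv_v, h.v1]) (by simp [Env.setv_v, hx]), eval_letE]
  set s₁ := ((s.setv 53 _).setv 54 _).setv 55 _ with hs₁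
  have same : Same [53, 54, 55] [] s s₁ := same_setv₃ _ _ _ _
  have h₁ : Setup G S k a s₁ := h.of_same same (by simp) (by simp)
  have e53 : s₁.v 53 = (i * 2 ^ q : ℕ) := by simp [hs₁, Env.setv_v, h.v50, hq, hi]
  have e55 : s₁.v 55 = (i * 2 ^ q + j * 2 ^ q * 2 ^ q : ℕ) := by
    simp [hs₁, Env.setv_v, h.v50, hq, hj, hi]
  rw [eval_entE h₁.holds h₁.v63 e55 e53 (by norm_num) (by norm_num), entY]

lemma eval_cellZ (h : Setup G S k a s) {p : ℤ} {x : ℕ} (h3 : s.v 3 = p) (hx : s.v 52 = x)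
    {δ : ℤ} (h7 : s.a 7 x = δ * entXY G (S.m * k) p (dec₁ S.N k x) (dec₂ S.N k x)) :
    (cellZ S.N).eval s = score G (S.m * k) a δ p (dec₁ S.N k x) (dec₂ S.N k x) := by
  set i := dec₁ S.N k x with hi
  set j := dec₂ S.N k x with hj
  set q := S.m * k with hq
  rw [cellZ, eval_letE, eval_decE₁ h.v1 hx, eval_letE, eval_mul, eval_mul,
    eval_decE₂ (k := k) (x := x) (by simp [Env.setv_v, h.v1]) (by simp [Env.setv_v, hx]), eval_letE]
  set s₁ := ((s.setv 53 _).setv 54 _).setv 55 _ with hs₁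
  have same : Same [53, 54, 55] [] s s₁ := same_setv₃ _ _ _ _
  have h₁ : Setup G S k a s₁ := h.of_same same (by simp) (by simp)
  have e54 : s₁.v 54 = (j * 2 ^ q * 2 ^ q : ℕ) := by simp [hs₁, Env.setv_v, h.v50, hq, hj]
  have e55 : s₁.v 55 = (i + j * 2 ^ q * 2 ^ q : ℕ) := by
    simp [hs₁, Env.setv_v, h.v50, hq, hj, hi]
  have e3 : s₁.v 3 = p := (same.1 _ (by simp)).trans h3
  have e52 : s₁.v 52 = x := (same.1 _ (by simp)).trans hx
  rw [eval_midE h₁.holds.n h₁.v2, eval_add, eval_pcE h₁.holds e55 (by norm_num), eval_var, e3,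
    eval_mul, eval_get, eval_var, e52, Int.toNat_natCast, same.2 _ (by simp), h7,
    eval_entE h₁.holds h₁.v63 e55 e54 (by norm_num) (by norm_num), score, eval_const, entZ]

end

/-- The scores for the middle parts of the size in variable `3`. -/
def round (S : Scheme) : Cmd :=
  .seq (.loop 52 (.var 51) (.store 7 (.var 52) (cellX S.N))) <|
  .seq (transform 4 S.r (S.N * S.N)) <|
  .seq (.loop 52 (.var 64) (.store 12 (.var 52) (.get 7 (.var 52)))) <|
  .seq (.loop 52 (.var 51) (.store 7 (.var 52) (cellY S.N))) <|
  .seq (transform 5 S.r (S.N * S.N)) <|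
  .seq (.loop 52 (.var 64) (.store 7 (.var 52) (.get 12 (.var 52) * .get 7 (.var 52)))) <|
  .seq (transform 6 (S.N * S.N) S.r)
    (.loop 52 (.var 51) (.store 9 (.var 3 * .var 51 + .var 52) (cellZ S.N)))

/-- The number of steps of a round. -/
def roundSteps (S : Scheme) (k : ℕ) : ℕ := 8 + 10 * S.r ^ k + 3 * (k * (5 + 4 * S.r ^ k))

/-- The two matrices are transformed to the `r ^ k` linear forms, multiplied pointwise and
recombined. With `E` bits per entry and `L = lam * k`, the numbers grow to `E + L`, `2 E + 2 L` and
`2 E + 3 L` bits, and the final weight brings them to `3 E + 3 L`; this explains `hP`. -/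
lemma triple_round {P n : ℕ} {G : SimpleGraph (Fin n)} {S : Scheme} {k a p : ℕ} {s : Env}
    (hs : s.Good P) (h : Setup G S k a s) (h3 : s.v 3 = p)
    (hP : 3 * entBits n (S.m * k) + 3 * (S.lam * k) < P) :
    Triple P (round S) s (roundSteps S k) fun s' => s'.Good P ∧
      Same [5, 52, 70, 71] [7, 8, 9, 12] s s' ∧
      ∀ l, s'.a 9 l = if p * (S.N * S.N) ^ k ≤ l ∧ l < p * (S.N * S.N) ^ k + (S.N * S.N) ^ k then
        score G (S.m * k) a (S.δ ^ k) p (dec₁ S.N k (l - p * (S.N * S.N) ^ k))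
          (dec₂ S.N k (l - p * (S.N * S.N) ^ k)) else s.a 9 l := by
  set q := S.m * k with hq
  set D₂ := (S.N * S.N) ^ k with hD₂
  set R := S.r ^ k with hR
  set E := entBits n q with hE
  set L := S.lam * k with hL
  have hNN : 0 < S.N * S.N := Nat.mul_pos S.N_pos S.N_pos
  have hD₂R : D₂ ≤ R := S.sq_pow_le k
  have hRP : R < 2 ^ P := Env.Good.pow_lt (S.r_pow_le k) (by omega)
  have hD₂P : D₂ < 2 ^ P := hD₂R.trans_lt hRP
  refine Triple.mono (N := (1 + D₂ * 2) + ((1 + k * (5 + 4 * R)) + ((1 + R * 2) + ((1 + D₂ * 2) +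
    ((1 + k * (5 + 4 * R)) + ((1 + R * 2) + ((1 + k * (5 + 4 * R)) + (1 + D₂ * 2)))))))) ?_
    (by rw [roundSteps, ← hR]; omega) fun _ h => h
  -- the first matrix
  refine (triple_fill (b := .var 51) D₂ 0 (fun x => entX G q p (dec₁ S.N k x) (dec₂ S.N k x)) hs
    h.v51 hD₂P (by simp) (fun x _ => Env.Good.pow_lt (entX_le G q _ _ _) (by omega)) (by simp)
    ?_).seq ?_
  · intro x hx s' hsame h52 _
    exact ⟨by simpa using h52, eval_cellX (h.of_same hsame (by simp) (by simp))
      ((hsame.1 _ (by simp)).trans h3) h52⟩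
  rintro s₁ ⟨g₁, same₁, h₁⟩
  have S₁ := h.of_same same₁ (by simp) (by simp)
  refine (triple_transform (by decide) (by decide) g₁ S₁.t4 S₁.v1 S.F_le S.μ_le'
    (v := fun x => entX G q p (dec₁ S.N k x) (dec₂ S.N k x)) (V := E)
    (fun x _ => entX_le G q _ _ _) (fun x hx => by rw [h₁, if_pos (by omega), Nat.sub_zero])
    S.r_pos le_rfl S.le hRP (by omega)).seq ?_
  rintro s₂ ⟨g₂, same₂, h₂⟩
  have same₂' : Same [5, 52, 70, 71] [7, 8] s s₂ :=
    same₁.trans same₂ (by simp) (by simp) (by simp) (by simp)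
  have S₂ := h.of_same same₂' (by simp) (by simp)
  set X : ℕ → ℤ := fun x => ∑ y ∈ Finset.range ((S.N * S.N) ^ k), ten S.F S.r (S.N * S.N) k x y *
    entX G q p (dec₁ S.N k y) (dec₂ S.N k y) with hX
  have X_le : ∀ x < R, (X x).natAbs ≤ 2 ^ (E + L) := fun x hx =>
    sum_ten_bound S.F_le S.μ_le' (fun y _ => entX_le G q _ _ _) hx
  -- saving the result
  refine (triple_fill (b := .var 64) R 0 X g₂ S₂.v64 hRP (by simp)
    (fun x hx => Env.Good.pow_lt (X_le x hx) (by omega)) (by simp) ?_).seq ?_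
  · intro x hx s' hsame h52 _
    refine ⟨by simpa using h52, ?_⟩
    rw [eval_get, eval_var, h52, Int.toNat_natCast, hsame.2 _ (by simp), h₂ x hx]
  rintro s₃ ⟨g₃, same₃, h₃⟩
  have same₃' : Same [5, 52, 70, 71] [7, 8, 12] s s₃ :=
    same₂'.trans same₃ (by simp) (by simp) (by simp) (by simp)
  have S₃ := h.of_same same₃' (by simp) (by simp)
  -- the second matrix
  refine (triple_fill (b := .var 51) D₂ 0 (fun x => entY G q (dec₁ S.N k x) (dec₂ S.N k x)) g₃
    S₃.v51 hD₂P (by simp) (fun x _ => Env.Good.pow_lt (entY_le G q _ _) (by omega)) (by simp)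
    ?_).seq ?_
  · intro x hx s' hsame h52 _
    exact ⟨by simpa using h52, eval_cellY (S₃.of_same hsame (by simp) (by simp)) h52⟩
  rintro s₄ ⟨g₄, same₄, h₄⟩
  have S₄ := S₃.of_same same₄ (by simp) (by simp)
  refine (triple_transform (by decide) (by decide) g₄ S₄.t5 S₄.v1 S.G_le S.μ_le'
    (v := fun x => entY G q (dec₁ S.N k x) (dec₂ S.N k x)) (V := E)
    (fun x _ => entY_le G q _ _) (fun x hx => by rw [h₄, if_pos (by omega), Nat.sub_zero])
    S.r_pos le_rfl S.le hRP (by omega)).seq ?_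
  rintro s₅ ⟨g₅, same₅, h₅⟩
  have same₅' : Same [5, 52, 70, 71] [7, 8] s₃ s₅ :=
    same₄.trans same₅ (by simp) (by simp) (by simp) (by simp)
  have S₅ := S₃.of_same same₅' (by simp) (by simp)
  set Y : ℕ → ℤ := fun x => ∑ y ∈ Finset.range ((S.N * S.N) ^ k), ten S.G S.r (S.N * S.N) k x y *
    entY G q (dec₁ S.N k y) (dec₂ S.N k y) with hY
  have Y_le : ∀ x < R, (Y x).natAbs ≤ 2 ^ (E + L) := fun x hx =>
    sum_ten_bound S.G_le S.μ_le' (fun y _ => entY_le G q _ _) hx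
  have XY_le : ∀ x < R, (X x * Y x).natAbs ≤ 2 ^ (2 * E + 2 * L) := fun x hx => by
    rw [Int.natAbs_mul, show 2 * E + 2 * L = (E + L) + (E + L) by ring, pow_add 2 (E + L)]
    exact Nat.mul_le_mul (X_le x hx) (Y_le x hx)
  -- the pointwise product
  refine (triple_fill (b := .var 64) R 0 (fun x => X x * Y x) g₅ S₅.v64 hRP (by simp)
    (fun x hx => Env.Good.pow_lt (XY_le x hx) (by omega)) (by simp) ?_).seq ?_
  · intro x hx s' hsame h52 hl
    refine ⟨by simpa using h52, ?_⟩
    rw [eval_mul, eval_get, eval_get, eval_var, h52, Int.toNat_natCast, hsame.2 _ (by simp),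
      same₅'.2 _ (by simp), h₃, if_pos (by omega), Nat.sub_zero, hl, if_neg (by omega), h₅ x hx]
  rintro s₆ ⟨g₆, same₆, h₆⟩
  have S₆ := S₅.of_same same₆ (by simp) (by simp)
  refine (triple_transform (by decide) (by decide) g₆ S₆.t6 S₆.v1 S.W_le S.μ_le
    (v := fun x => X x * Y x) (V := 2 * E + 2 * L) XY_le
    (fun x hx => by rw [h₆, if_pos (by omega), Nat.sub_zero]) hNN S.le le_rfl hRP (by omega)).seq ?_
  rintro s₇ ⟨g₇, same₇, h₇⟩
  have same₇' : Same [5, 52, 70, 71] [7, 8, 12] s s₇ :=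
    (same₃'.trans ((same₅'.trans same₆ (ws := [5, 52, 70, 71]) (bs := [7, 8]) (by simp) (by simp)
      (by simp) (by simp)).trans same₇ (ws := [5, 52, 70, 71]) (bs := [7, 8]) (by simp) (by simp)
      (by simp) (by simp)) (by simp) (by simp) (by simp) (by simp))
  have S₇ := h.of_same same₇' (by simp) (by simp)
  have prod_eq : ∀ z, ∑ y ∈ Finset.range (S.r ^ k), ten S.W (S.N * S.N) S.r k z y * (X y * Y y) =
      (S.δ : ℤ) ^ k * entXY G q p (dec₁ S.N k z) (dec₂ S.N k z) := fun z => by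
    rw [hX, hY, S.dec.matMul S.N_pos k z (entX G q p) (entY G q), entXY, S.pow_N]
  have prod_le : ∀ z < D₂, ((S.δ : ℤ) ^ k * entXY G q p (dec₁ S.N k z) (dec₂ S.N k z)).natAbs ≤
      2 ^ (2 * E + 2 * L + L) := fun z hz => by
    rw [← prod_eq]
    exact sum_ten_bound S.W_le S.μ_le XY_le hz
  -- the scores
  refine (triple_fill (b := .var 51) D₂ (p * D₂) (fun x => score G q a (S.δ ^ k) p
    (dec₁ S.N k x) (dec₂ S.N k x)) g₇ S₇.v51 hD₂P (by simp) ?_ (by simp) ?_).mono le_rfl ?_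
  · intro z hz
    rw [score]
    split_ifs
    · refine Env.Good.pow_lt (b := (2 * E + 2 * L + L) + E) ?_ (by omega)
      rw [Int.natAbs_mul, pow_add]
      exact Nat.mul_le_mul (prod_le z hz) (entZ_le G q _ _)
    · simp; omega
  · intro x hx s' hsame h52 hl
    have S' := S₇.of_same hsame (by simp) (by simp)
    have h3' : s'.v 3 = p := by rw [hsame.1 _ (by simp), same₇'.1 _ (by simp), h3]
    refine ⟨?_, eval_cellZ S' h3' h52 ?_⟩
    · rw [eval_add, eval_mul, eval_var, eval_var, eval_var, h52, h3', S'.v51]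
      push_cast
      rfl
    · rw [hsame.2 _ (by simp), h₇ x hx, prod_eq]
  · rintro s' ⟨hg, hsame, hl⟩
    refine ⟨hg, same₇'.trans hsame (by simp) (by simp) (by simp) (by simp), fun l => ?_⟩
    rw [hl, same₇'.2 _ (by simp)]

end Lang

/-! ### The smallest cut -/

namespace Lang

open MatMul OLA

/-- How good the set is that is built from the index in variable `52` and the outer parts. -/
def cellS : Expr :=
  .letE 55 (.var 57 + .var 52 * .var 50)
    (midE (pcE 55) (.var 0 * .var 0 + .const 1 - cutE 55) (.const 0))

/-- Finds a smallest cut by a set of admissible size. -/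
def search (S : Scheme) : Cmd :=
  .seq (.loop 3 (.var 0 + .const 1) (round S)) <|
  .seq (argmax 9 ((.var 0 + .const 1) * .var 51)) <|
  .seq (.assign 52 (.var 62 % .var 51)) <|
  .seq (.assign 57 (decE₁ S.N + decE₂ S.N * .var 50 * .var 50)) <|
  .seq (.loop 52 (.var 50) (.store 9 (.var 52) cellS)) <|
  .seq (argmax 9 (.var 50))
    (.assign 56 ((.var 57 + .var 62 * .var 50) % powE (.const 2) (.var 0)))

/-- The number of steps of the search. -/
def searchSteps (S : Scheme) (n k : ℕ) : ℕ :=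
  9 + (n + 1) * (1 + roundSteps S k) + 2 * (n + 1) * S.r ^ k + 4 * S.r ^ k

/-- The value of `cellS`. -/
noncomputable def gain {n : ℕ} (G : SimpleGraph (Fin n)) (a b q j : ℕ) : ℤ :=
  if Mid n a (pcZ n (b + j * 2 ^ q)) then n * n + 1 - cutZ G (b + j * 2 ^ q) else 0

lemma gain_le {n : ℕ} (G : SimpleGraph (Fin n)) (a b q j : ℕ) :
    (gain G a b q j).natAbs ≤ n * n + 1 := by
  have h1 := cutZ_nonneg G (b + j * 2 ^ q)
  have h2 := cutZ_le G (b + j * 2 ^ q)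
  have h3 : ((n * n : ℕ) : ℤ) = n * n := by push_cast; rfl
  unfold gain
  split_ifs <;> omega

lemma eval_cellS {n : ℕ} {G : SimpleGraph (Fin n)} {S : Scheme} {k a b j : ℕ} {s : Env}
    (h : Setup G S k a s) (h57 : s.v 57 = b) (h52 : s.v 52 = j) :
    cellS.eval s = gain G a b (S.m * k) j := by
  rw [cellS, eval_letE]
  set s₁ := s.setv 55 ((Expr.var 57 + Expr.var 52 * Expr.var 50).eval s) with hs₁
  have same : Same [55] [] s s₁ := Same.setv _ _ _
  have h₁ : Setup G S k a s₁ := h.of_same same (by simp) (by simp)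
  have e55 : s₁.v 55 = (b + j * 2 ^ (S.m * k) : ℕ) := by
    simp [hs₁, h57, h52, h.v50]
  rw [eval_midE h₁.holds.n h₁.v2, eval_pcE h₁.holds e55 (by norm_num), eval_sub,
    eval_cutE h₁.holds e55 (by norm_num), eval_add, eval_mul, eval_var, h₁.holds.n, gain]
  rfl

/-- A maximal score determines outer parts that belong to some smallest cut. The `2 ^ q` candidates
for the middle part are then compared directly. -/
lemma triple_search {P n : ℕ} {G : SimpleGraph (Fin n)} {S : Scheme} {k a : ℕ} {s : Env}
    (hs : s.Good P) (h : Setup G S k a s) (ha : 2 * a ≤ n) (hn : n ≤ 3 * (S.m * k))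
    (hP : 3 * entBits n (S.m * k) + 3 * (S.lam * k) + n < P) :
    Triple P (search S) s (searchSteps S n k) fun s' => s'.Good P ∧ Holds G s' ∧
      ∃ X : Finset (Fin n), s'.v 56 = mk X ∧ a ≤ X.card ∧ X.card ≤ n - a ∧
        ∀ Y : Finset (Fin n), a ≤ Y.card → Y.card ≤ n - a → cutN G X ≤ cutN G Y := by
  set q := S.m * k with hq
  set D₂ := (S.N * S.N) ^ k with hD₂
  set D := 2 ^ q with hD
  have hD0 : 0 < D := by positivity
  have hNN : 0 < S.N * S.N := Nat.mul_pos S.N_pos S.N_pos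
  have hD₂0 : 0 < D₂ := Nat.pow_pos hNN
  have hDD₂ : D ≤ D₂ := by
    rw [hD, ← S.pow_N k, hD₂]
    exact Nat.pow_le_pow_left (Nat.le_mul_of_pos_left _ S.N_pos) k
  have hRL : S.r ^ k ≤ 2 ^ (S.lam * k) := S.r_pow_le k
  have hD₂R : D₂ ≤ S.r ^ k := S.sq_pow_le k
  have hqL : q ≤ S.lam * k :=
    (Nat.pow_le_pow_iff_right (by norm_num)).1 (hDD₂.trans (hD₂R.trans hRL))
  have hDP : D < 2 ^ P := Nat.pow_lt_pow_right (by norm_num) (by omega)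
  have hcells : (n + 1) * D₂ < 2 ^ P := by
    refine Env.Good.pow_lt (b := n + S.lam * k) ?_ (by omega)
    rw [pow_add]
    exact Nat.mul_le_mul Nat.lt_two_pow_self (hD₂R.trans hRL)
  have hnE : n * n ≤ entBits n q := by
    unfold entBits
    nlinarith [Nat.zero_le (q * (n * n)), Nat.zero_le (n * n)]
  have hPP : P < 2 ^ P := Nat.lt_two_pow_self
  have hlin : (n + 1) * D₂ * 2 = 2 * ((n + 1) * D₂) := by ring
  have hnD : (n + 1) * D₂ ≤ (n + 1) * S.r ^ k := Nat.mul_le_mul_left _ hD₂R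
  refine Triple.mono (N := (1 + (n + 1) * (1 + roundSteps S k)) + ((2 + ((n + 1) * D₂) * 2) +
    (1 + (1 + ((1 + D * 2) + ((2 + D * 2) + 1)))))) ?_ (by
      rw [searchSteps, mul_assoc 2]; omega) fun _ h => h
  -- all scores
  refine (Triple.loop (M := roundSteps S k) (N := n + 1) (fun p s' => s'.Good P ∧
    Same [3, 5, 52, 70, 71] [7, 8, 9, 12] s s' ∧ ∀ p' < p, ∀ z < D₂,
      s'.a 9 (p' * D₂ + z) = score G q a (S.δ ^ k) p' (dec₁ S.N k z) (dec₂ S.N k z)) hs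
    ?_ ⟨hs, Same.refl _ _ _, by simp⟩ ?_).seq ?_
  · simp only [eval_add, eval_var, eval_const, h.holds.n]; omega
  · rintro p hp s' ⟨hg, hsame, h9⟩
    have hsame' : Same [3, 5, 52, 70, 71] [7, 8, 9, 12] s (s'.setv 3 p) :=
      hsame.trans (Same.setv _ _ _) (by simp) (by simp) (by simp) (by simp)
    refine (triple_round (p := p) (hg.setv_small (by simp; omega))
      (h.of_same hsame' (by simp) (by simp)) (by simp) (by rw [← hq]; omega)).mono le_rfl ?_
    rintro s'' ⟨hg', hs', h'⟩
    refine ⟨hg', hsame'.trans hs' (by simp) (by simp) (by simp) (by simp), fun p' hp' z hz => ?_⟩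
    rw [h', ← hD₂, ← hq]
    rcases Nat.lt_succ_iff_lt_or_eq.1 hp' with hlt | rfl
    · rw [if_neg]
      · exact h9 p' hlt z hz
      · have : p' * D₂ + D₂ ≤ p * D₂ := by
          rw [← Nat.succ_mul]; exact Nat.mul_le_mul_right _ hlt
        omega
    · rw [if_pos (by omega), Nat.add_sub_cancel_left]
  rintro s₁ ⟨g₁, same₁, h₁⟩
  have S₁ := h.of_same same₁ (by simp) (by simp)
  -- the outer parts
  refine (triple_argmax ((n + 1) * D₂) g₁ (fun z => ?_) (by positivity) hcells).seq ?_
  · simp [Env.setv_v, S₁.holds.n, S₁.v51, hD₂]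
  rintro s₂ ⟨g₂, same₂, w, hw, h62, hmax⟩
  have S₂ := S₁.of_same same₂ (by simp) (by simp)
  set p := w / D₂ with hp
  set z := w % D₂ with hz
  have hzD : z < D₂ := Nat.mod_lt _ hD₂0
  have hpn : p < n + 1 := (Nat.div_lt_iff_lt_mul hD₂0).2 hw
  set i := dec₁ S.N k z with hi
  set l := dec₂ S.N k z with hl
  have hiD : i < 2 ^ q := by rw [hq, ← S.pow_N]; exact (dec_lt S.N_pos k z).1
  have hlD : l < 2 ^ q := by rw [hq, ← S.pow_N]; exact (dec_lt S.N_pos k z).2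
  set b := i + l * 2 ^ q * 2 ^ q with hb
  have hδ : (0 : ℤ) < (S.δ : ℤ) ^ k := by have := S.dec.pos; positivity
  obtain ⟨j₀, hj₀, hm₀, hc₀⟩ := exists_middle G ha hn hδ (p := p) (l := l) hiD
    fun p' hp' i' hi' l' hl' => by
      obtain ⟨z', hz', rfl, rfl⟩ := exists_dec S.N_pos k i' (by rwa [S.pow_N]) l'
        (by rwa [S.pow_N])
      rw [← h₁ p' hp' z' hz', hi, hl, ← h₁ p hpn z hzD,
        show p * D₂ + z = w from Nat.div_add_mod' w D₂]
      refine hmax _ ?_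
      calc p' * D₂ + z' < p' * D₂ + D₂ := Nat.add_lt_add_left hz' _
        _ = (p' + 1) * D₂ := by ring
        _ ≤ _ := Nat.mul_le_mul_right _ hp'
  have hj₀' : i + j₀ * 2 ^ q + l * 2 ^ q * 2 ^ q = b + j₀ * 2 ^ q := by rw [hb]; ring
  rw [hj₀'] at hm₀ hc₀
  -- Only the place `z` within its round matters; the size `p` of the middle part is dropped. It
  -- goes to variable `52` because the decoding expressions read it there.
  refine Triple.assign_seq g₂ (z := z) ?_ ?_
  · rw [eval_mod, eval_var, eval_var, h62, S₂.v51]; rfl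
  have same₃ : Same [52] [] s₂ (s₂.setv 52 z) := Same.setv _ _ _
  have S₃ := S₂.of_same same₃ (by simp) (by simp)
  have g₃ : (s₂.setv 52 z).Good P :=
    g₂.setv (by simpa using hzD.trans_le ((Nat.le_mul_of_pos_left _ (by omega)).trans hcells.le))
      (by simp)
  have hbj : ∀ j < D, b + j * 2 ^ q < 2 ^ (q + q + q) := fun j hj => by
    have h1 := part_lt hiD hj
    have h2 : i + j * 2 ^ q + l * 2 ^ q * 2 ^ q < (l + 1) * (2 ^ q * 2 ^ q) := by
      rw [pow_add] at h1
      nlinarith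
    rw [hb, show i + l * 2 ^ q * 2 ^ q + j * 2 ^ q = i + j * 2 ^ q + l * 2 ^ q * 2 ^ q by ring,
      pow_add, pow_add, mul_comm (2 ^ q * 2 ^ q)]
    exact h2.trans_le (Nat.mul_le_mul_right _ hlD)
  have hbP : b < 2 ^ P := by
    have := hbj 0 hD0
    rw [zero_mul, add_zero] at this
    exact this.trans_le (Nat.pow_le_pow_right (by norm_num) (by omega))
  refine Triple.assign_seq g₃ (z := b) ?_ ?_
  · rw [eval_add, eval_mul, eval_mul, eval_decE₁ S₃.v1 (x := z) (by simp),
      eval_decE₂ S₃.v1 (x := z) (by simp), eval_var, S₃.v50, hb]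
    push_cast
    rfl
  set s₄ := (s₂.setv 52 z).setv 57 b with hs₄
  have same₄ : Same [57] [] (s₂.setv 52 z) s₄ := Same.setv _ _ _
  have S₄ := S₃.of_same same₄ (by simp) (by simp)
  have g₄ : s₄.Good P := g₃.setv (by simpa using hbP) (by simp)
  -- the middle part
  refine (triple_fill (b := .var 50) D 0 (gain G a b q) g₄ S₄.v50 hDP (by simp)
    (fun j _ => (gain_le G a b q j).trans_lt (by omega)) (by simp) ?_).seq ?_
  · intro j hj s' hsame h52 _
    refine ⟨by simpa using h52, eval_cellS (S₄.of_same hsame (by simp) (by simp)) ?_ h52⟩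
    rw [hsame.1 _ (by simp)]
    simp [hs₄]
  rintro s₅ ⟨g₅, same₅, h₅⟩
  have S₅ := S₄.of_same same₅ (by simp) (by simp)
  refine (triple_argmax D g₅ (fun z => ?_) hD0 hDP).seq ?_
  · rw [eval_var, Env.setv_v_of_ne _ _ (by norm_num), S₅.v50]
  rintro s₆ ⟨g₆, same₆, j, hj, h62', hmax'⟩
  have S₆ := S₅.of_same same₆ (by simp) (by simp)
  have hgain : gain G a b q j₀ ≤ gain G a b q j := by
    have := hmax' j₀ hj₀
    rwa [h₅, h₅, if_pos (by omega), if_pos (by omega), Nat.sub_zero, Nat.sub_zero] at this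
  have hcn := cutZ_le G (b + j₀ * 2 ^ q)
  rw [gain, if_pos hm₀] at hgain
  -- The summand `1` in `gain` makes admissible choices positive, hence strictly better than
  -- inadmissible ones; so the maximizer is admissible.
  have hmj : Mid n a (pcZ n (b + j * 2 ^ q)) := by
    by_contra hno
    rw [gain, if_neg hno] at hgain
    omega
  rw [gain, if_pos hmj] at hgain
  have h57 : s₆.v 57 = b := by
    rw [same₆.1 _ (by simp), same₅.1 _ (by simp)]; simp [hs₄]
  -- The three blocks may have more than `n` bits in total; reduction modulo `2 ^ n` removes the
  -- bits that belong to no vertex.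
  have hval : ((Expr.var 57 + Expr.var 62 * Expr.var 50) % powE (.const 2) (.var 0)).eval s₆ =
      mk (setOf n (b + j * 2 ^ q)) := by
    rw [← setOf_mod, mk_setOf (Nat.mod_lt _ (by positivity)), eval_mod,
      eval_powE _ (.var 0) _ S₆.holds.n fun _ => rfl, eval_add, eval_mul, eval_var, eval_var,
      eval_var, h57, h62', S₆.v50]
    push_cast
    rfl
  have hmid := (mid_iff (by omega)).1 hmj
  refine Triple.assign g₆ ?_
  rw [hval]
  refine ⟨g₆.setv ?_ (by simp), Holds.setv S₆.holds (by norm_num) _, setOf n (b + j * 2 ^ q),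
    by simp, hmid.1, hmid.2, fun Y hY1 hY2 => ?_⟩
  · rw [Int.natAbs_natCast]
    exact (mk_lt _).trans_le (Nat.pow_le_pow_right (by norm_num) (by omega))
  · have h1 := hc₀ Y hY1 hY2
    have h2 := cutZ_eq G (b + j * 2 ^ q)
    omega

end Lang

/-! ### The whole algorithm -/

namespace Lang

open MatMul OLA

/-- Computes the parameters and writes the tables. -/
def setup (S : Scheme) (b₁ b₂ : ℕ) : Cmd :=
  .seq (.assign 1 (.var 0 / .const (3 * S.m : ℕ) + .const 1)) <|
  .seq (.assign 2 (.var 0 * .const b₁ / .const b₂)) <|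
  .seq (.assign 50 (powE (.const S.N) (.var 1))) <|
  .seq (.assign 51 (powE (.const (S.N * S.N : ℕ)) (.var 1))) <|
  .seq (.assign 63 (.const 2 * .var 50)) <|
  .seq (.assign 64 (powE (.const S.r) (.var 1))) <|
  .seq (storeTable 4 S.F S.r (S.N * S.N)) <|
  .seq (storeTable 5 S.G S.r (S.N * S.N))
    (storeTable 6 S.W (S.N * S.N) S.r)

/-- The approximation algorithm. -/
def algorithm (S : Scheme) (b₁ b₂ : ℕ) : Cmd :=
  .seq (setup S b₁ b₂) <| .seq (search S) extend

lemma algorithm_ok (S : Scheme) (b₁ b₂ : ℕ) : (algorithm S b₁ b₂).ok := by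
  have h1 : (search S).ok = true := rfl
  have h2 : extend.ok = true := rfl
  have h3 : (setup S b₁ b₂).ok = true := by
    simp only [setup, Cmd.ok, storeTable, tableCmd_ok]
    rfl
  simp [algorithm, Cmd.ok, h1, h2, h3]

lemma initEnv_good {n P : ℕ} (G : SimpleGraph (Fin n)) (hP : n < P) : (initEnv G).Good P := by
  have h1 : ∀ x, ((initEnv G).v x).natAbs ≤ P := fun x => by
    simp only [initEnv]
    split_ifs
    · simp; omega
    · simp
  have h2 : ∀ i j, ((initEnv G).a i j).natAbs ≤ P := fun i j => by
    simp only [initEnv]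
    split_ifs
    · exact (input_mem_le G j).trans (by omega)
    · simp
  exact ⟨fun x => (h1 x).trans_lt Nat.lt_two_pow_self, fun x _ => h1 x,
    fun i j => (h2 i j).trans_lt Nat.lt_two_pow_self, fun i j _ => h2 i j⟩

lemma triple_setup {P n : ℕ} {G : SimpleGraph (Fin n)} {S : Scheme} {b₁ b₂ : ℕ} {s : Env}
    (hs : s.Good P) (h : Holds G s) {k a : ℕ} (hk : k = n / (3 * S.m) + 1)
    (ha : a = n * b₁ / b₂) (hkP : k ≤ P) (haP : a ≤ P) (hP : S.lam * k + 1 < P) :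
    Triple P (setup S b₁ b₂) s (9 + 3 * (S.r * (S.N * S.N))) fun s' => s'.Good P ∧
      Setup G S k a s' := by
  have hk0 : 1 ≤ k := by rw [hk]; exact Nat.le_add_left 1 _
  have hRP : S.r ^ k < 2 ^ P := Env.Good.pow_lt (S.r_pow_le k) (by omega)
  have hD₂P : (S.N * S.N) ^ k < 2 ^ P := (S.sq_pow_le k).trans_lt hRP
  have hDR : S.N ^ k ≤ (S.N * S.N) ^ k :=
    Nat.pow_le_pow_left (Nat.le_mul_of_pos_left _ S.N_pos) k
  have hqL : S.m * k ≤ S.lam * k := (Nat.pow_le_pow_iff_right (a := 2) (by norm_num)).1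
    (by rw [← S.pow_N]; exact hDR.trans ((S.sq_pow_le k).trans (S.r_pow_le k)))
  have hμP : S.μ < 2 ^ P := by
    refine Env.Good.pow_lt (b := S.lam) ?_ (lt_of_le_of_lt (Nat.le_mul_of_pos_right _ hk0) (by omega))
    exact (Nat.le_mul_of_pos_left _ S.r_pos).trans S.μ_le
  refine Triple.mono (N := 1 + (1 + (1 + (1 + (1 + (1 + ((1 + S.r * (S.N * S.N)) +
    ((1 + S.r * (S.N * S.N)) + (1 + (S.N * S.N) * S.r))))))))) ?_ (by
      rw [mul_comm (S.N * S.N) S.r]; omega) fun _ h => h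
  refine Triple.assign_seq hs (z := k) (by simp [h.n, hk]) ?_
  set s₁ := s.setv 1 k with hs₁
  have g₁ : s₁.Good P := hs.setv_small (by simpa using hkP)
  refine Triple.assign_seq g₁ (z := a) (by simp [hs₁, Env.setv_v, h.n, ha]) ?_
  set s₂ := s₁.setv 2 a with hs₂
  have g₂ : s₂.Good P := g₁.setv_small (by simpa using haP)
  refine Triple.assign_seq g₂ (z := (2 ^ (S.m * k) : ℕ)) ?_ ?_
  · rw [eval_powE _ (.var 1) _ (N := k) (by simp [hs₁, hs₂, Env.setv_v]) fun _ => rfl, ← S.pow_N]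
    simp
  set s₃ := s₂.setv 50 (2 ^ (S.m * k) : ℕ) with hs₃
  have g₃ : s₃.Good P := g₂.setv (by
    rw [Int.natAbs_natCast]; exact Nat.pow_lt_pow_right (by norm_num) (by omega)) (by simp)
  refine Triple.assign_seq g₃ (z := ((S.N * S.N) ^ k : ℕ)) ?_ ?_
  · rw [eval_powE _ (.var 1) _ (N := k) (by simp [hs₁, hs₂, hs₃, Env.setv_v]) fun _ => rfl]
    simp
  set s₄ := s₃.setv 51 ((S.N * S.N) ^ k : ℕ) with hs₄
  have g₄ : s₄.Good P := g₃.setv (by rwa [Int.natAbs_natCast]) (by simp)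
  refine Triple.assign_seq g₄ (z := base (S.m * k)) ?_ ?_
  · simp [hs₄, hs₃, Env.setv_v, base]
  set s₅ := s₄.setv 63 (base (S.m * k)) with hs₅
  have g₅ : s₅.Good P := g₄.setv (by
    have : base (S.m * k) = (2 ^ (S.m * k + 1) : ℕ) := by
      rw [base]; push_cast; ring
    rw [this, Int.natAbs_natCast]
    exact Nat.pow_lt_pow_right (by norm_num) (by omega)) (by simp)
  refine Triple.assign_seq g₅ (z := (S.r ^ k : ℕ)) ?_ ?_
  · rw [eval_powE _ (.var 1) _ (N := k) (by simp [hs₁, hs₂, hs₃, hs₄, hs₅, Env.setv_v])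
      fun _ => rfl]
    simp
  set s₆ := s₅.setv 64 (S.r ^ k : ℕ) with hs₆
  have g₆ : s₆.Good P := g₅.setv (by rwa [Int.natAbs_natCast]) (by simp)
  refine (triple_storeTable (by decide) g₆ S.F_le hμP).seq ?_
  rintro s₇ ⟨g₇, same₇, t4⟩
  refine (triple_storeTable (by decide) g₇ S.G_le hμP).seq ?_
  rintro s₈ ⟨g₈, same₈, t5⟩
  refine (triple_storeTable (by decide) g₈ S.W_le hμP).mono le_rfl ?_
  rintro s₉ ⟨g₉, same₉, t6⟩
  have same : Same [62] [4, 5, 6] s₆ s₉ :=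
    (same₇.trans same₈ (ws := [62]) (bs := [4, 5]) (by simp) (by simp) (by simp) (by simp)).trans
      same₉ (by simp) (by simp) (by simp) (by simp)
  have hv : ∀ x, x ≠ 62 → s₉.v x = s₆.v x := fun x hx => same.1 x (by simpa using hx)
  refine ⟨g₉, ⟨?_, ?_⟩, ?_, ?_, ?_, ?_, ?_, ?_, ?_, ?_, t6⟩
  · rw [hv _ (by norm_num), ← h.n]; simp [hs₁, hs₂, hs₃, hs₄, hs₅, hs₆, Env.setv_v]
  · rw [same.2 _ (by simp), ← h.a]; rfl
  · rw [hv _ (by norm_num)]; simp [hs₁, hs₂, hs₃, hs₄, hs₅, hs₆, Env.setv_v]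
  · rw [hv _ (by norm_num)]; simp [hs₂, hs₃, hs₄, hs₅, hs₆, Env.setv_v]
  · rw [hv _ (by norm_num)]; simp [hs₃, hs₄, hs₅, hs₆, Env.setv_v]
  · rw [hv _ (by norm_num)]; simp [hs₄, hs₅, hs₆, Env.setv_v]
  · rw [hv _ (by norm_num)]; simp [hs₅, hs₆, Env.setv_v]
  · rw [hv _ (by norm_num)]; simp [hs₆]
  · exact (t4.of_same same₈ (by simp)).of_same same₉ (by simp)
  · exact t5.of_same same₉ (by simp)

/-- A constant in the bound for the lengths of the numbers. -/
def bitsConst (S : Scheme) : ℕ := 6 * (S.m + 1) + 3 * S.lam + 10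

/-- A constant in the bound for the number of steps. -/
def stepsConst (S : Scheme) : ℕ := 100 + 3 * (S.r * (S.N * S.N))

lemma bitsConst_spec (S : Scheme) {n k : ℕ} (hk : k ≤ n + 1) :
    3 * entBits n (S.m * k) + 3 * (S.lam * k) + n * (n + 3) + n + k + 2 ≤
      bitsConst S * (n + 1) ^ 3 := by
  have h1 : S.m * k + 1 ≤ (S.m + 1) * (n + 1) := by nlinarith
  have h2 : n * n ≤ (n + 1) ^ 2 := by nlinarith
  have h3 : entBits n (S.m * k) ≤ (S.m + 1) * (n + 1) * (2 * (n + 1) ^ 2) :=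
    Nat.mul_le_mul h1 (Nat.mul_le_mul_left 2 h2)
  have h4 : n + 1 ≤ (n + 1) ^ 3 := Nat.le_self_pow (by norm_num) _
  have h5 : S.lam * k ≤ S.lam * (n + 1) ^ 3 := Nat.mul_le_mul_left _ (hk.trans h4)
  have h6 : n * (n + 3) ≤ 3 * (n + 1) ^ 3 := by
    have : (n + 1) ^ 2 ≤ (n + 1) ^ 3 := Nat.pow_le_pow_right (by omega) (by norm_num)
    nlinarith
  have h7 : (S.m + 1) * (n + 1) * (2 * (n + 1) ^ 2) = 2 * ((S.m + 1) * (n + 1) ^ 3) := by ring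
  have h8 : bitsConst S * (n + 1) ^ 3 = 6 * ((S.m + 1) * (n + 1) ^ 3) +
      3 * (S.lam * (n + 1) ^ 3) + 10 * (n + 1) ^ 3 := by unfold bitsConst; ring
  omega

lemma steps_le (S : Scheme) {n k e : ℕ} (hk : k ≤ n + 1) :
    9 + 3 * (S.r * (S.N * S.N)) + (searchSteps S n k + (14 + 2 * n + 2 * (e + e))) ≤
      stepsConst S * (n + 1) ^ 2 * (S.r ^ k + e) := by
  have hR : 1 ≤ S.r ^ k := Nat.one_le_pow _ _ S.r_pos
  set R := S.r ^ k with hRdef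
  set m := n + 1 with hm
  have hm1 : 1 ≤ m := by omega
  have h1 : roundSteps S k ≤ 45 * (m * R) := by
    rw [roundSteps, ← hRdef]
    have a1 : m ≤ m * R := Nat.le_mul_of_pos_right _ hR
    have a2 : R ≤ m * R := Nat.le_mul_of_pos_left _ hm1
    have a3 : k * R ≤ m * R := Nat.mul_le_mul_right _ hk
    have a4 : k * (5 + 4 * R) = 5 * k + 4 * (k * R) := by ring
    omega
  have hmR : m * R ≤ m ^ 2 * R := Nat.mul_le_mul_right _ (Nat.le_self_pow (by norm_num) _)
  have hmm : m ≤ m * R := Nat.le_mul_of_pos_right _ hR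
  have hRm : R ≤ m * R := Nat.le_mul_of_pos_left _ hm1
  have h2 : m * roundSteps S k ≤ 45 * (m ^ 2 * R) := by
    calc _ ≤ m * (45 * (m * R)) := Nat.mul_le_mul_left _ h1
      _ = _ := by ring
  have h3 : searchSteps S n k ≤ 61 * (m ^ 2 * R) := by
    rw [searchSteps, ← hRdef, ← hm, mul_add, mul_assoc 2]
    omega
  have h4 : e ≤ m ^ 2 * e := Nat.le_mul_of_pos_left _ (by positivity)
  have h5 : S.r * (S.N * S.N) ≤ S.r * (S.N * S.N) * (m ^ 2 * R) :=
    Nat.le_mul_of_pos_right _ (by positivity)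
  have h6 : stepsConst S * m ^ 2 * (R + e) = 100 * (m ^ 2 * R) + 100 * (m ^ 2 * e) +
      3 * (S.r * (S.N * S.N) * (m ^ 2 * R)) + 3 * (S.r * (S.N * S.N)) * (m ^ 2 * e) := by
    unfold stepsConst; ring
  have h7 := Nat.zero_le (3 * (S.r * (S.N * S.N)) * (m ^ 2 * e))
  omega

/-- The set found by the search has between `a` and `n - a` elements, so both passes of the
extension have at most `2 ^ (n - a)` cells. -/
lemma triple_algorithm {n : ℕ} (G : SimpleGraph (Fin n)) (S : Scheme) {b₁ b₂ : ℕ} (hm : 1 ≤ S.m)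
    {k a : ℕ} (hk : k = n / (3 * S.m) + 1) (ha : a = n * b₁ / b₂) (h3a : 3 * a ≤ n) {α : ℝ}
    (hα : α < 1) (haα : 3 * (a : ℝ) ≤ 2 * (α * n)) :
    Triple (bitsConst S * (n + 1) ^ 3) (algorithm S b₁ b₂) (initEnv G)
      (stepsConst S * (n + 1) ^ 2 * (S.r ^ k + 2 ^ (n - a))) fun s => s.v 0 = n ∧
        ∃ π : Equiv.Perm (Fin n), (∀ v : Fin n, s.a 11 v = ((π v : ℕ) : ℤ)) ∧
          (OLA.cost G π : ℝ) ≤ (1 + 1 / (2 * (1 - α))) * (OLA.opt G : ℝ) := by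
  have hkn : k ≤ n + 1 := by
    have := Nat.div_le_self n (3 * S.m)
    omega
  -- The summand `1` in `k` rounds up, so that three blocks of `S.m * k` bits cover all vertices.
  have hn : n ≤ 3 * (S.m * k) := by
    rw [hk, ← mul_assoc]
    exact (Nat.lt_mul_div_succ n (by omega)).le
  have hP := bitsConst_spec S hkn
  set P := bitsConst S * (n + 1) ^ 3
  have hpow : (n + 1) ^ (n + 3) < 2 ^ P := by
    calc (n + 1) ^ (n + 3) ≤ (2 ^ n) ^ (n + 3) := Nat.pow_le_pow_left Nat.lt_two_pow_self _
      _ = 2 ^ (n * (n + 3)) := (pow_mul _ _ _).symm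
      _ < _ := Nat.pow_lt_pow_right (by norm_num) (by omega)
  refine Triple.mono ?_ (steps_le S (e := 2 ^ (n - a)) hkn) fun _ h => h
  refine (triple_setup (initEnv_good G (by omega)) ⟨rfl, rfl⟩ hk ha (by omega) (by omega)
    (by omega)).seq ?_
  rintro s₁ ⟨g₁, S₁⟩
  refine (triple_search g₁ S₁ (by omega) hn (by omega)).seq ?_
  rintro s₂ ⟨g₂, h₂, X, h56, hX1, hX2, hX⟩
  refine (triple_extend g₂ h₂ h56 (by omega) hpow).mono ?_ ?_
  · have e1 : 2 ^ X.card ≤ 2 ^ (n - a) := Nat.pow_le_pow_right (by norm_num) hX2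
    have e2 : 2 ^ (n - X.card) ≤ 2 ^ (n - a) := Nat.pow_le_pow_right (by norm_num) (by omega)
    omega
  · rintro s₃ ⟨h0, π, hπ, hopt⟩
    exact ⟨h0, π, hπ, cost_le_of_min_cut G h3a hX hopt hα haα⟩

end Lang

/-! ### From the exponent to a fixed integral scheme -/

namespace MatMul

lemma exists_scheme {ε : ℝ} (hε : 0 < ε) : ∃ S : Scheme, 1 ≤ S.m ∧
    (S.r : ℝ) ≤ (2 : ℝ) ^ ((omega + ε) * S.m) := by
  obtain ⟨m, r, hm, hr, hle⟩ := exists_rankLE hε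
  obtain ⟨δ, F, G, W, hdec⟩ := hr.exists_isDecomp (by positivity)
  have hsq := hr.sq_le
  let B : (ℕ → ℕ → ℤ) → ℕ := fun M => ∑ x ∈ Finset.range r, ∑ y ∈ Finset.range r, (M x y).natAbs
  have hB : ∀ M : ℕ → ℕ → ℤ, ∀ x < r, ∀ y < r, (M x y).natAbs ≤ B M := fun M x hx y hy =>
    (Finset.single_le_sum (f := fun y => (M x y).natAbs) (fun _ _ => Nat.zero_le _)
      (Finset.mem_range.2 hy)).trans
    (Finset.single_le_sum (f := fun x => ∑ y ∈ Finset.range r, (M x y).natAbs)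
      (fun _ _ => Nat.zero_le _) (Finset.mem_range.2 hx))
  refine ⟨{ m := m, N := 2 ^ m, r := r, δ := δ, μ := 1 + B F + B G + B W,
            lam := r * (1 + B F + B G + B W), F := F, G := G, W := W, N_eq := rfl, dec := hdec
            le := hsq, F_le := fun x hx y hy => ?_, G_le := fun x hx y hy => ?_
            W_le := fun x hx y hy => ?_, μ_pos := by omega, μ_le := Nat.lt_two_pow_self.le },
    hm, hle⟩
  · have := hB F x hx y (by omega); omega
  · have := hB G x hx y (by omega); omega
  · have := hB W x (by omega) y hy; omega

/-- The rank is at least `N * N`. This is what puts `2 ^ (2 n / 3)` under the matrix multiplication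
term when `a` is about `n / 3`. -/
lemma Scheme.two_le {S : Scheme} (hm : 1 ≤ S.m) {τ : ℝ} (h : (S.r : ℝ) ≤ (2 : ℝ) ^ (τ * S.m)) :
    2 ≤ τ := by
  have h1 : ((S.N * S.N : ℕ) : ℝ) ≤ S.r := by exact_mod_cast S.le
  have h2 : ((S.N * S.N : ℕ) : ℝ) = (2 : ℝ) ^ ((2 : ℝ) * S.m) := by
    rw [S.N_eq, ← pow_add, ← two_mul]
    norm_cast
  rw [h2] at h1
  have h3 := (Real.rpow_le_rpow_left_iff (by norm_num)).1 (h1.trans h)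
  have h4 : (0 : ℝ) < S.m := by exact_mod_cast hm
  exact le_of_mul_le_mul_right h3 h4

/-- Rounding `n / (3 m)` up costs one more factor `r`, which is bounded by a constant. -/
lemma Scheme.r_pow_le_rpow {S : Scheme} (hm : 1 ≤ S.m) {τ : ℝ}
    (h : (S.r : ℝ) ≤ (2 : ℝ) ^ (τ * S.m)) (n : ℕ) :
    ((S.r ^ (n / (3 * S.m) + 1) : ℕ) : ℝ) ≤ (2 : ℝ) ^ (τ * S.m) * (2 : ℝ) ^ (τ * n / 3) := by
  have hτ := Scheme.two_le hm h
  have h4 : (0 : ℝ) < S.m := by exact_mod_cast hm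
  rw [pow_succ, mul_comm, Nat.cast_mul, Nat.cast_pow]
  refine mul_le_mul h ?_ (by positivity) (by positivity)
  calc (S.r : ℝ) ^ (n / (3 * S.m)) ≤ ((2 : ℝ) ^ (τ * S.m)) ^ (n / (3 * S.m)) :=
        pow_le_pow_left₀ (by positivity) h _
    _ = (2 : ℝ) ^ (τ * S.m * (n / (3 * S.m) : ℕ)) := by
        exact (Real.rpow_mul_natCast (by norm_num) _ _).symm
    _ ≤ _ := by
        refine Real.rpow_le_rpow_of_exponent_le (by norm_num) ?_
        have h5 : ((n / (3 * S.m) : ℕ) : ℝ) * (3 * S.m) ≤ n := by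
          exact_mod_cast Nat.div_mul_le_self n (3 * S.m)
        nlinarith

end MatMul

/-- The machine needs a rational ratio `b₁ / b₂`, while `α` is an arbitrary real. The first
inequality provides `3 a ≤ n`, the second the approximation factor, the disjunction the running
time. For `α < 1 / 2` there is a rational between `α / 2` and `min (1 / 3) (2 α / 3)`; for `α ≥ 1 /
2` the ratio `1 / 3` will do. -/
lemma exists_ratio {α : ℝ} (hα0 : 0 < α) : ∃ b₁ b₂ : ℕ, 0 < b₂ ∧ 3 * b₁ ≤ b₂ ∧
    3 * (b₁ : ℝ) ≤ 2 * α * b₂ ∧ (α * b₂ ≤ 2 * b₁ ∨ 3 * b₁ = b₂) := by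
  rcases le_or_gt (1 / 2) α with h | h
  · exact ⟨1, 3, by norm_num, by norm_num, by norm_num; linarith, .inr rfl⟩
  · obtain ⟨γ, h1, h2⟩ := exists_rat_btwn (show α / 2 < min (1 / 3) (2 * α / 3) by
      rw [lt_min_iff]; constructor <;> linarith)
    rw [lt_min_iff] at h2
    have hγ : (0 : ℚ) < γ := by exact_mod_cast (show (0 : ℝ) < γ by linarith)
    have hd : (0 : ℝ) < γ.den := by exact_mod_cast γ.den_pos
    have hnum : ((γ.num.toNat : ℕ) : ℝ) = γ * γ.den := by
      have h3 : ((γ.num.toNat : ℕ) : ℤ) = γ.num := Int.toNat_of_nonneg (Rat.num_pos.2 hγ).le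
      have h4 : ((γ.num : ℤ) : ℚ) = γ * γ.den := (Rat.mul_den_eq_num γ).symm
      calc ((γ.num.toNat : ℕ) : ℝ) = (((γ.num.toNat : ℕ) : ℤ) : ℝ) := by norm_cast
        _ = (((γ.num : ℤ) : ℚ) : ℝ) := by rw [h3]; norm_cast
        _ = _ := by rw [h4]; push_cast; rfl
    refine ⟨γ.num.toNat, γ.den, γ.den_pos, ?_, ?_, .inl ?_⟩
    · have : 3 * ((γ.num.toNat : ℕ) : ℝ) ≤ γ.den := by rw [hnum]; nlinarith
      exact_mod_cast this
    · rw [hnum]; nlinarith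
    · rw [hnum]; nlinarith

theorem mainTheorem7 (α : ℝ) (hα0 : 0 < α) (hα1 : α < 1) (ε : ℝ) (hε : 0 < ε) :
    OLA.HasApproxInTimeOStar (1 + 1 / (2 * (1 - α)))
      (fun n => (2 : ℝ) ^ ((MatMul.omega + ε) * (n : ℝ) / 3)
        + (2 : ℝ) ^ ((1 - α / 2) * (n : ℝ))) := by
  obtain ⟨S, hm, hS⟩ := MatMul.exists_scheme hε
  obtain ⟨b₁, b₂, hb₂, hb, hbα, hor⟩ := exists_ratio hα0
  set τ := MatMul.omega + ε with hτ
  have hτ2 := MatMul.Scheme.two_le hm hS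
  set K : ℝ := (2 : ℝ) ^ (τ * S.m) with hK
  have hK0 : 0 < K := by positivity
  refine Lang.hasApprox_of_cmd _ _ (fun n => ?_) (Lang.algorithm S b₁ b₂)
    (Lang.algorithm_ok S b₁ b₂) 11 (Lang.bitsConst S) 3 (fun n => ?_)
    (Lang.stepsConst S * (K + 2)) 2 fun n G => ?_
  · have h1 : (1 : ℝ) ≤ (2 : ℝ) ^ ((1 - α / 2) * (n : ℝ)) :=
      Real.one_le_rpow (by norm_num) (mul_nonneg (by linarith) (by positivity))
    have h2 : (0 : ℝ) < (2 : ℝ) ^ (τ * (n : ℝ) / 3) := by positivity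
    linarith
  · have := Lang.bitsConst_spec S (Nat.zero_le (n + 1))
    rw [mul_add] at this
    omega
  set a := n * b₁ / b₂ with ha
  have hab : a * b₂ ≤ n * b₁ := Nat.div_mul_le_self _ _
  have h3a : 3 * a ≤ n := by
    refine Nat.le_of_mul_le_mul_right ?_ hb₂
    nlinarith
  have hb₂' : (0 : ℝ) < b₂ := by exact_mod_cast hb₂
  have hab' : (a : ℝ) * b₂ ≤ n * b₁ := by exact_mod_cast hab
  have hn0 : (0 : ℝ) ≤ n := by positivity
  have haα : 3 * (a : ℝ) ≤ 2 * (α * n) := by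
    refine le_of_mul_le_mul_right ?_ hb₂'
    nlinarith
  -- Rounding down loses less than one vertex, hence at most a factor `2` in `2 ^ (n - a)`.
  have hab1 : (n : ℝ) * b₁ ≤ (a + 1) * b₂ := by
    have := (Nat.lt_mul_div_succ (n * b₁) hb₂).le
    rw [← ha] at this
    have h : ((n * b₁ : ℕ) : ℝ) ≤ (b₂ * (a + 1) : ℕ) := by exact_mod_cast this
    push_cast at h
    linarith
  refine ⟨_, ?_, Lang.triple_algorithm G S hm rfl ha h3a hα1 haα⟩
  have h1 := MatMul.Scheme.r_pow_le_rpow hm hS n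
  have h2 : ((2 ^ (n - a) : ℕ) : ℝ) ≤ 2 * ((2 : ℝ) ^ (τ * (n : ℝ) / 3)
      + (2 : ℝ) ^ ((1 - α / 2) * (n : ℝ))) := by
    have e1 : ((2 ^ (n - a) : ℕ) : ℝ) = (2 : ℝ) ^ ((n : ℝ) - a) := by
      rw [Nat.cast_pow, ← Real.rpow_natCast, Nat.cast_sub (by omega)]; rfl
    have p1 : (0 : ℝ) < (2 : ℝ) ^ (τ * (n : ℝ) / 3) := by positivity
    have p2 : (0 : ℝ) < (2 : ℝ) ^ ((1 - α / 2) * (n : ℝ)) := by positivity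
    have key : ∀ x : ℝ, (n : ℝ) - a ≤ x + 1 → ((2 ^ (n - a) : ℕ) : ℝ) ≤ 2 * (2 : ℝ) ^ x :=
      fun x hx => by
        rw [e1, mul_comm, ← Real.rpow_add_one (by norm_num)]
        exact Real.rpow_le_rpow_of_exponent_le (by norm_num) hx
    -- In the first case `n - a ≤ (1 - α / 2) n + 1`. In the second `n - a ≤ 2 n / 3 + 1`, and `2 ≤
    -- τ` lets the matrix multiplication term dominate.
    rcases hor with h | h
    · have := key ((1 - α / 2) * n) (by
        refine le_of_mul_le_mul_right ?_ hb₂'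
        nlinarith)
      linarith
    · have h' : 3 * (b₁ : ℝ) = b₂ := by exact_mod_cast h
      have := key (τ * n / 3) (by
        have hb₁ : (0 : ℝ) < b₁ := by linarith
        have : (n : ℝ) ≤ (a + 1) * 3 := by
          refine le_of_mul_le_mul_right ?_ hb₁
          rw [← h'] at hab1
          linarith
        nlinarith)
      linarith
  have h3 : (0 : ℝ) ≤ (Lang.stepsConst S : ℝ) * ((n : ℝ) + 1) ^ 2 := by positivity
  have p2 : (0 : ℝ) < (2 : ℝ) ^ ((1 - α / 2) * (n : ℝ)) := by positivity
  push_cast at h1 h2 ⊢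
  calc _ ≤ (Lang.stepsConst S : ℝ) * ((n : ℝ) + 1) ^ 2 *
        ((K + 2) * ((2 : ℝ) ^ (τ * (n : ℝ) / 3) + (2 : ℝ) ^ ((1 - α / 2) * (n : ℝ)))) := by
        refine mul_le_mul_of_nonneg_left ?_ h3
        nlinarith
    _ = _ := by ring
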